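/- **Setting.** Let $d\ge 2$ be even, $L\ge 1$, and let $H=H^*$ be a bounded operator on $\ell^2(\mathbb Z^d,\mathbb C^L)$ with $L\times L$ matrix entries $\langle x|H|y\rangle$, such that (i) $H$ has finite range $R$: $\langle x|H|y\rangle=0$ whenever $|x-y|>R$ (Euclidean distance); (ii) $H$ is periodic with periods $p_1,\dots,p_d\ge 1$: $\langle x+p_je_j|H|y+p_je_j\rangle=\langle x|H|y\rangle$ for all $x,y\in\mathbb Z^d$ and $j=1,\dots,d$; (iii) $0\notin\operatorname{spec}(H)$. Put $g=\|H^{-1}\|^{-1}$ and $M=\max_{j}\|[X_j,H]\|$, where $X_1,\dots,X_d$ are the position operators. Let $\hat\gamma_1,\dots,\hat\gamma_{d-1}$ be a selfadjoint irreducible representation on $\mathbb C^{d'}$ of the Clifford algebra with $d-1$ generators, $\hat\gamma_i\hat\gamma_j+\hat\gamma_j\hat\gamma_i=2\delta_{i,j}$, and let $\hat\gamma_d=\imath\mathbf 1$. For an integer $\rho\ge1$ such that $2\rho$ is a multiple of every $p_j$, let $H^{\rm per}_\rho$ be the operator on $\mathcal H_\rho=\ell^2((\mathbb Z/2\rho\mathbb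 Z)^d,\mathbb C^L)$ with entries $\langle x|H^{\rm per}_\rho|y\rangle=\sum_{a\in\mathbb Z^d}\langle x|H|y+2\rho a\rangle$, $x,y\in\{-\rho+1,\dots,\rho\}^d$. For $\eta>0$, the periodic spectral localizer is the Hermitian matrix on $(\mathcal H_\rho\oplus\mathcal H_\rho)\otimes\mathbb C^{d'}$ $$ L^{\rm per}_{\eta,\rho}=\begin{pmatrix}\sum_{j=1}^d(\mathbf 1-\cos(\tfrac{\pi}{\rho}X_j)) & \sum_{j=1}^d\sin(\tfrac{\pi}{\rho}X_j)\hat\gamma_j^*\\ \sum_{j=1}^d\sin(\tfrac{\pi}{\rho}X_j)\hat\gamma_j & -\sum_{j=1}^d(\mathbf 1-\cos(\tfrac{\pi}{\rho}X_j))\end{pmatrix}+\frac1\eta\begin{pmatrix}-H^{\rm per}_\rho&0\\0&H^{\rm per}_\rho\end{pmatrix}. $$ Call $(\eta,\rho)$, with $\eta>0$ real and $\rho\ge1$ an integer, *admissible* if $2\rho$ is an integer multiple of every $p_j$, $\rho\ge 2R$, $\eta\ge\frac g4$, $$ \rho\ \ge\ \frac{15\cdot10^6\,d^4\,M\,\|H\|^3\,\eta^2}{g^6}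 \qquad\text{and}\qquad \Big(1-\frac g{\|H\|}\Big)^2+4\Big(1-\frac\eta{\|H\|}\Big)\ \le\ \frac{g^2}{4\,d\,\eta\,\|H\|}. $$ **Proposition.** If $(\eta,\rho)$ is admissible, then $$(L^{\rm per}_{\eta,\rho})^2\ \ge\ \frac{g^2}{600\,d\,\eta^2}\,\mathbf 1 .$$ If $(\eta,\rho)$ and $(\eta',\rho')$ are both admissible (for the same $H$, $R$, $p_j$ and $\hat\gamma_j$), then $$\operatorname{Sig}(L^{\rm per}_{\eta,\rho})=\operatorname{Sig}(L^{\rm per}_{\eta',\rho'}),$$ where $\operatorname{Sig}$ is the number of positive minus the number of negative eigenvalues, counted with multiplicity. -/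

import Mathlib

namespace PeriodicLocalizer

open scoped Kronecker

/-- The Hilbert space `ℓ²(ℤ^d, ℂ^L)`. -/
abbrev Hilb (d L : ℕ) : Type :=
  lp (fun _ : Fin d → ℤ => EuclideanSpace ℂ (Fin L)) 2

/-- The `L × L` matrix `⟨x|H|y⟩`. -/
noncomputable def kernel {d L : ℕ} (H : Hilb d L →L[ℂ] Hilb d L) (x y : Fin d → ℤ) :
    Matrix (Fin L) (Fin L) ℂ :=
  Matrix.of fun a b => H (lp.single 2 y (EuclideanSpace.single b (1 : ℂ))) x a

/-- `⟨x|H|y⟩` vanishes whenever the Euclidean distance of `x` and `y` exceeds `R`. -/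
def HasFiniteRange {d L : ℕ} (H : Hilb d L →L[ℂ] Hilb d L) (R : ℝ) : Prop :=
  ∀ x y : Fin d → ℤ, R < √(∑ j, ((x j : ℝ) - (y j : ℝ)) ^ 2) → kernel H x y = 0

/-- `⟨x + p_j e_j|H|y + p_j e_j⟩ = ⟨x|H|y⟩` for all `j`. -/
def IsPeriodic {d L : ℕ} (H : Hilb d L →L[ℂ] Hilb d L) (p : Fin d → ℕ) : Prop :=
  ∀ (j : Fin d) (x y : Fin d → ℤ),
    kernel H (x + Pi.single j (p j : ℤ)) (y + Pi.single j (p j : ℤ)) = kernel H x y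

/-- The (unbounded) position operator `X_j` on its maximal domain. -/
noncomputable def position {d : ℕ} (L : ℕ) (j : Fin d) : Hilb d L →ₗ.[ℂ] Hilb d L where
  domain :=
    { carrier := {ψ | Memℓp (fun x : Fin d → ℤ => ((x j : ℤ) : ℂ) • ψ x) 2}
      zero_mem' := by
        have h : (fun x : Fin d → ℤ => ((x j : ℤ) : ℂ) • (0 : Hilb d L) x) = 0 := by
          funext x; simp
        change Memℓp (fun x : Fin d → ℤ => ((x j : ℤ) : ℂ) • (0 : Hilb d L) x) 2
        rw [h]
        exact zero_memℓp
      add_mem' := by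
        intro ψ φ hψ hφ
        have h : (fun x : Fin d → ℤ => ((x j : ℤ) : ℂ) • (ψ + φ) x)
            = (fun x : Fin d → ℤ => ((x j : ℤ) : ℂ) • ψ x)
              + fun x : Fin d → ℤ => ((x j : ℤ) : ℂ) • φ x := by
          funext x; simp
        change Memℓp (fun x : Fin d → ℤ => ((x j : ℤ) : ℂ) • (ψ + φ) x) 2
        rw [h]
        exact Memℓp.add hψ hφ
      smul_mem' := by
        intro c ψ hψ
        have h : (fun x : Fin d → ℤ => ((x j : ℤ) : ℂ) • (c • ψ) x)
            = c • fun x : Fin d → ℤ => ((x j : ℤ) : ℂ) • ψ x := by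
          funext x; exact smul_comm ((x j : ℤ) : ℂ) c (ψ x)
        change Memℓp (fun x : Fin d → ℤ => ((x j : ℤ) : ℂ) • (c • ψ) x) 2
        rw [h]
        exact Memℓp.const_smul hψ c }
  toFun :=
    { toFun := fun ψ => ⟨fun x => ((x j : ℤ) : ℂ) • ψ.1 x, ψ.2⟩
      map_add' := by
        intro ψ φ
        ext x i
        change ((x j : ℤ) : ℂ) * (ψ.1 x i + φ.1 x i)
          = ((x j : ℤ) : ℂ) * ψ.1 x i + ((x j : ℤ) : ℂ) * φ.1 x i
        exact mul_add _ _ _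
      map_smul' := by
        intro c ψ
        ext x
        simp
        ring }

/-- `‖[X_j, H]‖`, the supremum of `‖X_j H ψ - H X_j ψ‖` over the vectors `ψ` of norm at most one
in the domain of the commutator. -/
noncomputable def commutatorNorm {d L : ℕ} (H : Hilb d L →L[ℂ] Hilb d L) (j : Fin d) : ℝ :=
  sSup {r : ℝ | ∃ (ψ : (position L j).domain) (h : H (ψ : Hilb d L) ∈ (position L j).domain),
    ‖(ψ : Hilb d L)‖ ≤ 1 ∧
      r = ‖position L j ⟨H (ψ : Hilb d L), h⟩ - H (position L j ψ)‖}

/-- `M = max_j ‖[X_j, H]‖`. -/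
noncomputable def maxCommutator {d L : ℕ} (H : Hilb d L →L[ℂ] Hilb d L) : ℝ :=
  ⨆ j : Fin d, commutatorNorm H j

/-- `g = ‖H⁻¹‖⁻¹`. -/
noncomputable def gap {d L : ℕ} (H : Hilb d L →L[ℂ] Hilb d L) : ℝ :=
  ‖Ring.inverse H‖⁻¹

/-- The points of the discrete torus `(ℤ/2ρℤ)^d ≅ {-ρ+1, …, ρ}^d`. -/
abbrev Torus (d ρ : ℕ) : Type := Fin d → Finset.Ioc (-(ρ : ℤ)) (ρ : ℤ)

instance instDecidableEqTorus (d ρ : ℕ) : DecidableEq (Torus d ρ) := inferInstance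

/-- The integer vector representing a point of the discrete torus. -/
def Torus.coord {d ρ : ℕ} (x : Torus d ρ) : Fin d → ℤ := fun j => (x j : ℤ)

/-- The finite-volume restriction of `H` with periodic boundary conditions:
`⟨x|H_ρ^per|y⟩ = ∑_{a ∈ ℤ^d} ⟨x|H|y + 2ρa⟩` (a finite sum for `H` of finite range). -/
noncomputable def perHam {d L : ℕ} (H : Hilb d L →L[ℂ] Hilb d L) (ρ : ℕ) :
    Matrix (Torus d ρ × Fin L) (Torus d ρ × Fin L) ℂ :=
  Matrix.of fun u v =>
    ∑ᶠ a : Fin d → ℤ, kernel H u.1.coord (v.1.coord + (2 * (ρ : ℤ)) • a) u.2 v.2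

/-- A selfadjoint irreducible representation on `ℂ^k` of the Clifford algebra with `m`
generators. -/
structure IsIrredCliffordRep {m k : ℕ} (γ : Fin m → Matrix (Fin k) (Fin k) ℂ) : Prop where
  selfadjoint : ∀ i, (γ i).IsHermitian
  clifford : ∀ i j, γ i * γ j + γ j * γ i = if i = j then 2 else 0
  nontrivial : 0 < k
  irreducible : ∀ W : Submodule ℂ (Fin k → ℂ),
    (∀ i, ∀ w ∈ W, (γ i).mulVec w ∈ W) → W = ⊥ ∨ W = ⊤

/-- The matrices `γ̂_1, …, γ̂_{d-1}` together with `γ̂_d = i 𝟏`. -/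
noncomputable def gammaHat {d k : ℕ} (γ : Fin (d - 1) → Matrix (Fin k) (Fin k) ℂ) (j : Fin d) :
    Matrix (Fin k) (Fin k) ℂ :=
  if h : (j : ℕ) < d - 1 then γ ⟨j, h⟩ else Complex.I • (1 : Matrix (Fin k) (Fin k) ℂ)

/-- `sin((π/ρ) X_j)` on `ℓ²((ℤ/2ρℤ)^d, ℂ^L)`. -/
noncomputable def sinX {d : ℕ} (L ρ : ℕ) (j : Fin d) :
    Matrix (Torus d ρ × Fin L) (Torus d ρ × Fin L) ℂ :=
  Matrix.diagonal fun u => ((Real.sin (Real.pi / ρ * (u.1.coord j : ℝ)) : ℝ) : ℂ)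

/-- `cos((π/ρ) X_j)` on `ℓ²((ℤ/2ρℤ)^d, ℂ^L)`. -/
noncomputable def cosX {d : ℕ} (L ρ : ℕ) (j : Fin d) :
    Matrix (Torus d ρ × Fin L) (Torus d ρ × Fin L) ℂ :=
  Matrix.diagonal fun u => ((Real.cos (Real.pi / ρ * (u.1.coord j : ℝ)) : ℝ) : ℂ)

/-- Index set of a basis of `(ℋ_ρ ⊕ ℋ_ρ) ⊗ ℂ^k`. -/
abbrev LocIndex (d L k ρ : ℕ) : Type :=
  ((Torus d ρ × Fin L) × Fin k) ⊕ ((Torus d ρ × Fin L) × Fin k)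

/-- The even periodic spectral localizer `L^per_{η,ρ}`. -/
noncomputable def perLocalizer {d L k : ℕ} (H : Hilb d L →L[ℂ] Hilb d L)
    (γ : Fin (d - 1) → Matrix (Fin k) (Fin k) ℂ) (η : ℝ) (ρ : ℕ) :
    Matrix (LocIndex d L k ρ) (LocIndex d L k ρ) ℂ :=
  Matrix.fromBlocks
    ((∑ j : Fin d, (1 - cosX L ρ j)) ⊗ₖ (1 : Matrix (Fin k) (Fin k) ℂ))
    (∑ j : Fin d, sinX L ρ j ⊗ₖ (gammaHat γ j).conjTranspose)
    (∑ j : Fin d, sinX L ρ j ⊗ₖ gammaHat γ j)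
    (-((∑ j : Fin d, (1 - cosX L ρ j)) ⊗ₖ (1 : Matrix (Fin k) (Fin k) ℂ)))
  + ((1 / η : ℝ) : ℂ) • Matrix.fromBlocks
    (-(perHam H ρ ⊗ₖ (1 : Matrix (Fin k) (Fin k) ℂ))) 0
    0 (perHam H ρ ⊗ₖ (1 : Matrix (Fin k) (Fin k) ℂ))

/-- The signature of a Hermitian matrix: the number of positive eigenvalues minus the number of
negative eigenvalues, counted with multiplicity. -/
noncomputable def signature {n : Type*} [Fintype n] [DecidableEq n] (A : Matrix n n ℂ)
    (hA : A.IsHermitian) : ℤ :=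
  (Nat.card {i : n // 0 < hA.eigenvalues i} : ℤ) - (Nat.card {i : n // hA.eigenvalues i < 0} : ℤ)

/-- The conditions on the parameters `(η, ρ)`, for a Hamiltonian of range `R` and periods `p`. -/
structure Admissible {d L : ℕ} (H : Hilb d L →L[ℂ] Hilb d L) (R : ℝ) (p : Fin d → ℕ)
    (η : ℝ) (ρ : ℕ) : Prop where
  rho_pos : 0 < ρ
  period_dvd : ∀ j, p j ∣ 2 * ρ
  two_range_le : 2 * R ≤ ρ
  rho_ge : 15 * 10 ^ 6 * (d : ℝ) ^ 4 * maxCommutator H * ‖H‖ ^ 3 * η ^ 2 / gap H ^ 6 ≤ ρ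
  eta_pos : 0 < η
  eta_ge : gap H / 4 ≤ η
  flatness : (1 - gap H / ‖H‖) ^ 2 + 4 * (1 - η / ‖H‖) ≤ gap H ^ 2 / (4 * d * η * ‖H‖)

section Hermitian

variable {d L : ℕ} {H : Hilb d L →L[ℂ] Hilb d L}

theorem kernel_eq_inner (x y : Fin d → ℤ) (a b : Fin L) :
    kernel H x y a b = inner ℂ (lp.single 2 x (EuclideanSpace.single a (1 : ℂ)) : Hilb d L)
      (H (lp.single 2 y (EuclideanSpace.single b (1 : ℂ)))) := by
  rw [lp.inner_single_left]
  simp [kernel, EuclideanSpace.inner_single_left]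

theorem kernel_conj (hH : IsSelfAdjoint H) (x y : Fin d → ℤ) (a b : Fin L) :
    star (kernel H x y a b) = kernel H y x b a := by
  rw [kernel_eq_inner, kernel_eq_inner]
  have h := (ContinuousLinearMap.isSelfAdjoint_iff_isSymmetric.mp hH)
    (lp.single 2 y (EuclideanSpace.single b (1 : ℂ)))
    (lp.single 2 x (EuclideanSpace.single a (1 : ℂ)))
  rw [← inner_conj_symm] at h
  simpa using h

theorem IsPeriodic.shift_single {p : Fin d → ℕ} (hp : IsPeriodic H p) (j : Fin d) (n : ℤ) :
    ∀ x y : Fin d → ℤ, kernel H (x + Pi.single j (n * (p j : ℤ)))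
      (y + Pi.single j (n * (p j : ℤ))) = kernel H x y := by
  induction n using Int.induction_on with
  | zero => intro x y; simp
  | succ n ih =>
    intro x y
    rw [add_mul, one_mul, Pi.single_add, ← add_assoc, ← add_assoc, hp, ih]
  | pred n ih =>
    intro x y
    rw [← hp, add_assoc, add_assoc, ← Pi.single_add]
    have : (-(n : ℤ) - 1) * (p j : ℤ) + p j = -(n : ℤ) * p j := by ring
    rw [this, ih]

theorem IsPeriodic.shift {p : Fin d → ℕ} (hp : IsPeriodic H p) {ρ : ℕ} (hρ : ∀ j, p j ∣ 2 * ρ)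
    (a : Fin d → ℤ) (x y : Fin d → ℤ) :
    kernel H (x + (2 * (ρ : ℤ)) • a) (y + (2 * (ρ : ℤ)) • a) = kernel H x y := by
  have key : ∀ s : Finset (Fin d), kernel H (x + ∑ j ∈ s, Pi.single j ((2 * (ρ : ℤ)) * a j))
      (y + ∑ j ∈ s, Pi.single j ((2 * (ρ : ℤ)) * a j)) = kernel H x y := by
    intro s
    induction s using Finset.induction_on with
    | empty => simp
    | insert j s hj ih =>
      rw [Finset.sum_insert hj, add_comm (Pi.single j _), ← add_assoc, ← add_assoc]
      obtain ⟨c, hc⟩ := hρ j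
      have : (2 * (ρ : ℤ)) * a j = (c * a j) * (p j : ℤ) := by
        have : (2 * (ρ : ℤ)) = p j * c := by exact_mod_cast hc
        rw [this]; ring
      rw [this, hp.shift_single, ih]
  have h := key Finset.univ
  rw [Finset.univ_sum_single] at h
  exact h

theorem perHam_isHermitian {p : Fin d → ℕ} {ρ : ℕ} (hH : IsSelfAdjoint H) (hp : IsPeriodic H p)
    (hρ : ∀ j, p j ∣ 2 * ρ) : (perHam H ρ).IsHermitian := by
  ext u v
  simp only [perHam, Matrix.conjTranspose_apply, Matrix.of_apply]
  have h1 : star (∑ᶠ a : Fin d → ℤ,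
      kernel H v.1.coord (u.1.coord + (2 * (ρ : ℤ)) • a) v.2 u.2)
      = ∑ᶠ a : Fin d → ℤ, star (kernel H v.1.coord (u.1.coord + (2 * (ρ : ℤ)) • a) v.2 u.2) :=
    (starAddEquiv (R := ℂ)).toAddMonoidHom.map_finsum_of_injective
      (starAddEquiv (R := ℂ)).injective _
  rw [h1, ← finsum_comp_equiv (Equiv.neg (Fin d → ℤ))]
  refine finsum_congr fun a => ?_
  rw [kernel_conj hH, ← hp.shift hρ a]
  simp

theorem perLocalizer_isHermitian {p : Fin d → ℕ} {ρ k : ℕ} (hH : IsSelfAdjoint H)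
    (hp : IsPeriodic H p) (hρ : ∀ j, p j ∣ 2 * ρ) (γ : Fin (d - 1) → Matrix (Fin k) (Fin k) ℂ)
    (η : ℝ) : (perLocalizer H γ η ρ).IsHermitian := by
  have hs : ∀ j, (sinX (d := d) L ρ j).conjTranspose = sinX L ρ j := by
    intro j
    simp only [sinX, Matrix.diagonal_conjTranspose]
    congr 1; funext u; simp [-Complex.ofReal_sin]
  have hc : ∀ j, (cosX (d := d) L ρ j).conjTranspose = cosX L ρ j := by
    intro j
    simp only [cosX, Matrix.diagonal_conjTranspose]
    congr 1; funext u; simp [-Complex.ofReal_cos]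
  have hh := (perHam_isHermitian hH hp hρ).eq
  unfold perLocalizer Matrix.IsHermitian
  simp [Matrix.conjTranspose_add, Matrix.fromBlocks_conjTranspose, Matrix.conjTranspose_kronecker,
    Matrix.conjTranspose_sum, Matrix.conjTranspose_smul, hs, hc, hh]

end Hermitian

end PeriodicLocalizer

open PeriodicLocalizer
open scoped ComplexOrder

/-! Write the localizer as `J (c - h) + D`, where `h = H_per / η`, the mass is `c = ∑ (1 - cos θ_j)`
and the Dirac part is `D = ∑ sin θ_j Γ_j`. As `J` squares to one and anticommutes with `D`, the
square is `(c - h)² + ∑ sin² θ_j + J [D, h]`. Pointwise `c² + ∑ sin² θ_j ≥ 2 c`, because `(1 - cos)²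
+ sin² = 2 (1 - cos)`. Moreover `c h + h c ≤ 2 ‖h‖ c` up to commutators, because `1 - cos θ = |1 -
e^{iθ}|² / 2`. Hence the square is at least `h² - 2 (‖h‖ - 1)₊ c` up to commutators of size `M / (η
ρ)`, with `h² ≥ g² / η²` and `c ≤ 2 d` (`norm_loc_sq_ge`). Admissibility makes the two losses at
most half of `g² / η²`.

For the signature, `ρ` is first kept fixed and `η` is moved to `comparisonScale H`. The gap estimate
holds on the whole segment, so nothing changes. At that scale `b = ‖H‖ / η` is small and two volumes
`ρ ≤ ρ' ≤ 2 ρ` can be compared: the small torus is placed in the large one, with `h` extended by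
zero and mass `2` on the new sites, which adds a block of signature zero
(`signature_locMat_extend`). A straight line joins the result to the localizer of the large torus.
The Hamiltonian on this line need not be gapped, but a kernel vector `ψ` satisfies `⟨w c⟩ = Re ⟨w
h⟩` for every real function `w`. The weights `c` and `c²` show that `‖c ψ‖ ≤ b ‖ψ‖` and that the
part of `ψ` on sites with `c ≥ 1/4` is of order `b^{3/2}` relative to `ψ`. The two Hamiltonians
differ only between such sites, so `ψ` feels the gap of the large torus, which contradicts the
smallness of `b` (`eq_zero_of_loc_eq_zero`). Repeated doubling reaches every larger volume.

The norm, the gap and the commutators of `H_per` are inherited from `H` by testing `H` on periodic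
extensions cut off to large boxes, the boundary error being negligible relative to the volume. -/

namespace PeriodicLocalizer

open Matrix Topology
open scoped Matrix.Norms.L2Operator

/-! ### Signature of Hermitian matrices: local constancy, reindexing, blocks. -/

section Signature

variable {n : Type*} [Fintype n] [DecidableEq n]

theorem re_inner_toEuclideanCLM_eq_sum {A : Matrix n n ℂ} (hA : A.IsHermitian)
    (v : EuclideanSpace ℂ n) :
    (inner ℂ v (toEuclideanCLM (𝕜 := ℂ) A v)).re
      = ∑ i, hA.eigenvalues i * ‖inner ℂ (hA.eigenvectorBasis i) v‖ ^ 2 := by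
  have hb : ∀ i, inner ℂ (hA.eigenvectorBasis i) (toEuclideanCLM (𝕜 := ℂ) A v)
      = (hA.eigenvalues i : ℂ) * inner ℂ (hA.eigenvectorBasis i) v := by
    intro i
    have hs : IsSelfAdjoint (toEuclideanCLM (𝕜 := ℂ) A) := by
      rw [IsSelfAdjoint, ← map_star, Matrix.star_eq_conjTranspose, hA.eq]
    have h1 := (ContinuousLinearMap.isSelfAdjoint_iff_isSymmetric.mp hs)
      (hA.eigenvectorBasis i) v
    have h2 : toEuclideanCLM (𝕜 := ℂ) A (hA.eigenvectorBasis i)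
        = (hA.eigenvalues i : ℂ) • hA.eigenvectorBasis i := by
      apply (WithLp.equiv 2 (n → ℂ)).injective
      have := hA.mulVec_eigenvectorBasis i
      simp only [WithLp.equiv_apply, ofLp_toEuclideanCLM, this]
      ext j
      simp
    have h1' : inner ℂ (toEuclideanCLM (𝕜 := ℂ) A (hA.eigenvectorBasis i)) v
      = inner ℂ (hA.eigenvectorBasis i) (toEuclideanCLM (𝕜 := ℂ) A v) := h1
    rw [← h1', h2, inner_smul_left]
    simp
  rw [← hA.eigenvectorBasis.sum_inner_mul_inner, Complex.re_sum]
  refine Finset.sum_congr rfl fun i _ => ?_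
  rw [hb, ← inner_conj_symm v, mul_left_comm, ← Complex.normSq_eq_conj_mul_self,
    ← Complex.ofReal_mul, Complex.ofReal_re, Complex.normSq_eq_norm_sq]

/-- Half of the min-max principle: a vector of `V` orthogonal to every eigenvector with `0 < σ λ`
has nonpositive form, so the coordinates along those eigenvectors determine it. The sign `σ` allows
positive and negative eigenvalues to be treated together. -/
theorem finrank_le_card_of_pos {A : Matrix n n ℂ} (hA : A.IsHermitian) (σ : ℝ)
    (V : Submodule ℂ (EuclideanSpace ℂ n))
    (hV : ∀ v ∈ V, v ≠ 0 → 0 < σ * (inner ℂ v (toEuclideanCLM (𝕜 := ℂ) A v)).re) :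
    Module.finrank ℂ V ≤ Nat.card {i : n // 0 < σ * hA.eigenvalues i} := by
  let f : V →ₗ[ℂ] ({i : n // 0 < σ * hA.eigenvalues i} → ℂ) :=
    { toFun := fun v i => inner ℂ (hA.eigenvectorBasis i) (v : EuclideanSpace ℂ n)
      map_add' := fun v w => by ext i; simp
      map_smul' := fun c v => by ext i; simp }
  have hf : Function.Injective f := by
    rw [injective_iff_map_eq_zero]
    intro v hv
    by_contra hne
    have h1 := hV v v.2 (by simpa using hne)
    rw [re_inner_toEuclideanCLM_eq_sum hA, Finset.mul_sum] at h1
    refine absurd h1 (not_lt.mpr (Finset.sum_nonpos fun i _ => ?_))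
    by_cases hi : 0 < σ * hA.eigenvalues i
    · have : inner ℂ (hA.eigenvectorBasis i) (v : EuclideanSpace ℂ n) = 0 := congrFun hv ⟨i, hi⟩
      simp [this]
    · rw [← mul_assoc]
      exact mul_nonpos_of_nonpos_of_nonneg (not_lt.mp hi) (by positivity)
  have := LinearMap.finrank_le_finrank_of_injective hf
  rwa [Module.finrank_fintype_fun_eq_card, ← Nat.card_eq_fintype_card] at this

/-- Lower semicontinuity of each count: on the span of the relevant eigenvectors of `A` the form is
at least `m ‖v‖²`, with `m` the smallest relevant `σ λ`, and a perturbation of norm below `m` keeps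
it positive there. -/
theorem exists_card_le_card {A : Matrix n n ℂ} (hA : A.IsHermitian) (σ : ℝ) (hσ : |σ| = 1) :
    ∃ ε > 0, ∀ (B : Matrix n n ℂ) (hB : B.IsHermitian), ‖B - A‖ < ε →
      Nat.card {i : n // 0 < σ * hA.eigenvalues i}
        ≤ Nat.card {i : n // 0 < σ * hB.eigenvalues i} := by
  classical
  obtain ⟨m, hm, hmin⟩ : ∃ m > 0, ∀ i, 0 < σ * hA.eigenvalues i → m ≤ σ * hA.eigenvalues i := by
    let S := Finset.univ.filter fun i => 0 < σ * hA.eigenvalues i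
    rcases S.eq_empty_or_nonempty with h | h
    · refine ⟨1, one_pos, fun i hi => ?_⟩
      have : i ∈ S := by simp [S, hi]
      simp [h] at this
    · obtain ⟨j, hj, hmin⟩ := S.exists_min_image (fun i => σ * hA.eigenvalues i) h
      exact ⟨_, (Finset.mem_filter.mp hj).2, fun i hi => hmin i (by simp [S, hi])⟩
  refine ⟨m, hm, fun B hB hBA => ?_⟩
  let e : {i : n // 0 < σ * hA.eigenvalues i} → EuclideanSpace ℂ n :=
    fun i => hA.eigenvectorBasis i
  have he : LinearIndependent ℂ e :=
    (hA.eigenvectorBasis.orthonormal.comp _ Subtype.val_injective).linearIndependent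
  rw [Nat.card_eq_fintype_card, ← finrank_span_eq_card he]
  refine finrank_le_card_of_pos hB σ _ fun v hv hne => ?_
  have hz : ∀ i, ¬ 0 < σ * hA.eigenvalues i → inner ℂ (hA.eigenvectorBasis i) v = 0 := by
    intro i hi
    induction hv using Submodule.span_induction with
    | mem x hx =>
      obtain ⟨j, rfl⟩ := hx
      refine hA.eigenvectorBasis.orthonormal.2 fun hij => hi ?_
      rw [hij]; exact j.2
    | zero => simp
    | add x y _ _ hx hy =>
      rw [inner_add_right]
      by_cases hx0 : x = 0
      · by_cases hy0 : y = 0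
        · simp [hx0, hy0]
        · simp [hx0, hy hy0]
      · by_cases hy0 : y = 0
        · simp [hy0, hx hx0]
        · simp [hx hx0, hy hy0]
    | smul c x _ hx =>
      rw [inner_smul_right]
      by_cases hx0 : x = 0
      · simp [hx0]
      · simp [hx hx0]
  have h1 : m * ‖v‖ ^ 2 ≤ σ * (inner ℂ v (toEuclideanCLM (𝕜 := ℂ) A v)).re := by
    rw [re_inner_toEuclideanCLM_eq_sum hA, ← hA.eigenvectorBasis.sum_sq_norm_inner_right v,
      Finset.mul_sum, Finset.mul_sum]
    refine Finset.sum_le_sum fun i _ => ?_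
    by_cases hi : 0 < σ * hA.eigenvalues i
    · rw [← mul_assoc]
      exact mul_le_mul_of_nonneg_right (hmin i hi) (by positivity)
    · simp [hz i hi]
  have h2 : |(inner ℂ v (toEuclideanCLM (𝕜 := ℂ) (B - A) v)).re| ≤ ‖B - A‖ * ‖v‖ ^ 2 := by
    refine (Complex.abs_re_le_norm _).trans ((norm_inner_le_norm _ _).trans ?_)
    have := (toEuclideanCLM (𝕜 := ℂ) (B - A)).le_opNorm v
    rw [l2_opNorm_toEuclideanCLM] at this
    nlinarith [norm_nonneg v]
  have h3 : toEuclideanCLM (𝕜 := ℂ) B v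
      = toEuclideanCLM (𝕜 := ℂ) A v + toEuclideanCLM (𝕜 := ℂ) (B - A) v := by
    rw [map_sub, _root_.sub_apply]; abel
  rw [h3, inner_add_right, Complex.add_re, mul_add]
  have h4 : |σ * (inner ℂ v (toEuclideanCLM (𝕜 := ℂ) (B - A) v)).re| ≤ ‖B - A‖ * ‖v‖ ^ 2 := by
    rwa [abs_mul, hσ, one_mul]
  have h5 : ‖B - A‖ * ‖v‖ ^ 2 < m * ‖v‖ ^ 2 :=
    mul_lt_mul_of_pos_right hBA (by positivity)
  linarith [neg_abs_le (σ * (inner ℂ v (toEuclideanCLM (𝕜 := ℂ) (B - A) v)).re)]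

theorem signature_eq_cards {A : Matrix n n ℂ} (hA : A.IsHermitian) :
    signature A hA = (Nat.card {i : n // 0 < (1 : ℝ) * hA.eigenvalues i} : ℤ)
      - (Nat.card {i : n // 0 < (-1 : ℝ) * hA.eigenvalues i} : ℤ) := by
  simp [signature]

theorem card_pos_add_card_neg_le {A : Matrix n n ℂ} (hA : A.IsHermitian) :
    Nat.card {i : n // 0 < (1 : ℝ) * hA.eigenvalues i}
      + Nat.card {i : n // 0 < (-1 : ℝ) * hA.eigenvalues i} ≤ Fintype.card n := by
  classical
  rw [Nat.card_eq_fintype_card, Nat.card_eq_fintype_card, Fintype.card_subtype,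
    Fintype.card_subtype, ← Finset.card_union_of_disjoint]
  · exact Finset.card_le_univ _
  · rw [Finset.disjoint_filter]
    intro i _ h1 h2
    linarith

theorem card_pos_add_card_neg_eq {A : Matrix n n ℂ} (hA : A.IsHermitian) (hdet : A.det ≠ 0) :
    Nat.card {i : n // 0 < (1 : ℝ) * hA.eigenvalues i}
      + Nat.card {i : n // 0 < (-1 : ℝ) * hA.eigenvalues i} = Fintype.card n := by
  classical
  have h0 : ∀ i, hA.eigenvalues i ≠ 0 := by
    rw [hA.det_eq_prod_eigenvalues, Finset.prod_ne_zero_iff] at hdet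
    intro i hi
    exact hdet i (Finset.mem_univ _) (by simp [hi])
  rw [Nat.card_eq_fintype_card, Nat.card_eq_fintype_card, Fintype.card_subtype,
    Fintype.card_subtype, ← Finset.card_union_of_disjoint]
  · rw [← Finset.card_univ]
    congr 1
    ext i
    simp only [Finset.mem_union, Finset.mem_filter, Finset.mem_univ, true_and, iff_true]
    rcases lt_or_gt_of_ne (h0 i) with h | h
    · right; linarith
    · left; linarith
  · rw [Finset.disjoint_filter]
    intro i _ h1 h2
    linarith

/-- The signature is constant near an invertible Hermitian matrix. -/
theorem exists_signature_eq {A : Matrix n n ℂ} (hA : A.IsHermitian) (hdet : A.det ≠ 0) :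
    ∃ ε > 0, ∀ (B : Matrix n n ℂ) (hB : B.IsHermitian), ‖B - A‖ < ε →
      signature B hB = signature A hA := by
  obtain ⟨ε₁, h₁, H₁⟩ := exists_card_le_card hA 1 (by simp)
  obtain ⟨ε₂, h₂, H₂⟩ := exists_card_le_card hA (-1) (by simp)
  refine ⟨min ε₁ ε₂, lt_min h₁ h₂, fun B hB hBA => ?_⟩
  have a1 := H₁ B hB (hBA.trans_le (min_le_left _ _))
  have a2 := H₂ B hB (hBA.trans_le (min_le_right _ _))
  -- Both counts can only grow, but for the invertible `A` they already add up to the dimension, so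
  -- neither grows.
  have a3 := card_pos_add_card_neg_eq hA hdet
  have a4 := card_pos_add_card_neg_le hB
  rw [signature_eq_cards, signature_eq_cards]
  omega

/-- The signature is constant along a continuous path of invertible Hermitian matrices. -/
theorem signature_eq_of_path (f : unitInterval → Matrix n n ℂ) (hf : Continuous f)
    (hH : ∀ t, (f t).IsHermitian) (hdet : ∀ t, (f t).det ≠ 0) :
    signature (f 0) (hH 0) = signature (f 1) (hH 1) := by
  have hloc : IsLocallyConstant fun t => signature (f t) (hH t) := by
    rw [IsLocallyConstant.iff_eventually_eq]
    intro t
    obtain ⟨ε, hε, h⟩ := exists_signature_eq (hH t) (hdet t)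
    have := (Metric.tendsto_nhds.mp (hf.tendsto t)) ε hε
    filter_upwards [this] with s hs
    exact h _ (hH s) (by rwa [← dist_eq_norm])
  exact hloc.apply_eq_of_preconnectedSpace 0 1

/-- Expressing the signature through the roots of the characteristic polynomial makes its invariance
under reindexing and its additivity over diagonal blocks immediate. -/
theorem signature_eq_countP {A : Matrix n n ℂ} (hA : A.IsHermitian) :
    signature A hA = (A.charpoly.roots.countP (fun z => 0 < z.re) : ℤ)
      - (A.charpoly.roots.countP (fun z => z.re < 0) : ℤ) := by
  classical
  rw [hA.roots_charpoly_eq_eigenvalues, Multiset.countP_map, Multiset.countP_map, signature,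
    Nat.card_eq_fintype_card, Nat.card_eq_fintype_card, Fintype.card_subtype,
    Fintype.card_subtype]
  simp [Finset.card, Finset.filter_val]

theorem signature_submatrix {m : Type*} [Fintype m] [DecidableEq m] {A : Matrix n n ℂ}
    (hA : A.IsHermitian) (e : m ≃ n) :
    signature (A.submatrix e e) (hA.submatrix e) = signature A hA := by
  rw [signature_eq_countP, signature_eq_countP]
  have : A.submatrix e e = Matrix.reindex e.symm e.symm A := rfl
  rw [this, charpoly_reindex]

theorem signature_congr {A B : Matrix n n ℂ} (h : A = B) (hA : A.IsHermitian)
    (hB : B.IsHermitian) : signature A hA = signature B hB := by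
  subst h; rfl

theorem signature_fromBlocks {m : Type*} [Fintype m] [DecidableEq m] {A : Matrix n n ℂ}
    {B : Matrix m m ℂ} (hA : A.IsHermitian) (hB : B.IsHermitian)
    (hAB : (fromBlocks A 0 0 B).IsHermitian) :
    signature (fromBlocks A 0 0 B) hAB = signature A hA + signature B hB := by
  rw [signature_eq_countP, signature_eq_countP, signature_eq_countP, charpoly_fromBlocks_zero₁₂,
    Polynomial.roots_mul (mul_ne_zero (charpoly_monic _).ne_zero (charpoly_monic _).ne_zero),
    Multiset.countP_add, Multiset.countP_add]
  push_cast
  ring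

theorem roots_charpoly_diagonal (f : n → ℂ) :
    (diagonal f).charpoly.roots = Finset.univ.val.map f := by
  rw [charpoly_diagonal]
  exact Polynomial.roots_multiset_prod_X_sub_C (Finset.univ.val.map f) ▸ by
    rw [Multiset.map_map]; rfl

theorem signature_fromBlocks_diagonal_neg (f : n → ℂ)
    (h : (fromBlocks (diagonal f) 0 0 (-diagonal f)).IsHermitian) :
    signature (fromBlocks (diagonal f) 0 0 (-diagonal f)) h = 0 := by
  have hD : (diagonal f).IsHermitian := (isHermitian_fromBlocks_iff.mp h).1
  rw [signature_fromBlocks hD hD.neg, signature_eq_countP, signature_eq_countP,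
    show -diagonal f = diagonal (fun i => -f i) from diagonal_neg f,
    roots_charpoly_diagonal, roots_charpoly_diagonal]
  simp [Multiset.countP_map]

end Signature

end PeriodicLocalizer

namespace PeriodicLocalizer

open Matrix Topology
open scoped Matrix.Norms.L2Operator

/-! ### Real quadratic forms of bounded operators. -/

section Form

variable {E : Type*} [NormedAddCommGroup E] [InnerProductSpace ℂ E]

/-- The real quadratic form `Re ⟨ψ, T ψ⟩`. -/
noncomputable def form (T : E →L[ℂ] E) (ψ : E) : ℝ := (inner ℂ ψ (T ψ)).re

theorem form_add (S T : E →L[ℂ] E) (ψ : E) : form (S + T) ψ = form S ψ + form T ψ := by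
  simp [form]

theorem form_sub (S T : E →L[ℂ] E) (ψ : E) : form (S - T) ψ = form S ψ - form T ψ := by
  simp [form]

theorem form_sum {ι : Type*} (s : Finset ι) (T : ι → E →L[ℂ] E) (ψ : E) :
    form (∑ i ∈ s, T i) ψ = ∑ i ∈ s, form (T i) ψ := by
  simp [form]

theorem form_smul (a : ℝ) (T : E →L[ℂ] E) (ψ : E) : form ((a : ℂ) • T) ψ = a * form T ψ := by
  simp [form]

theorem abs_form_le (T : E →L[ℂ] E) (ψ : E) : |form T ψ| ≤ ‖T‖ * ‖ψ‖ ^ 2 := by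
  refine (Complex.abs_re_le_norm _).trans ((norm_inner_le_norm _ _).trans ?_)
  have := T.le_opNorm ψ
  nlinarith [norm_nonneg ψ]

variable [CompleteSpace E]

theorem form_star_mul_mul (A T : E →L[ℂ] E) (ψ : E) :
    form (star A * T * A) ψ = form T (A ψ) := by
  simp only [form, mul_apply_eq_comp, ContinuousLinearMap.star_eq_adjoint]
  rw [ContinuousLinearMap.adjoint_inner_right]

theorem form_star_mul (A T : E →L[ℂ] E) (ψ : E) :
    form (star A * T) ψ = (inner ℂ (A ψ) (T ψ)).re := by
  simp only [form, mul_apply_eq_comp, ContinuousLinearMap.star_eq_adjoint]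
  rw [ContinuousLinearMap.adjoint_inner_right]

theorem form_star_mul_self (A : E →L[ℂ] E) (ψ : E) : form (star A * A) ψ = ‖A ψ‖ ^ 2 := by
  rw [form_star_mul, inner_self_eq_norm_sq_to_K]
  norm_cast

theorem form_star (T : E →L[ℂ] E) (ψ : E) : form (star T) ψ = form T ψ := by
  simp only [form, ContinuousLinearMap.star_eq_adjoint]
  rw [ContinuousLinearMap.adjoint_inner_right, ← inner_conj_symm, Complex.conj_re]

end Form

/-- Matrices over `X` represented on a Hilbert space, together with a grading `J` and
anticommuting generators `Γ` that commute with the represented matrices. -/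
structure LocalizerFrame (X E : Type*) [Fintype X] [DecidableEq X] [NormedAddCommGroup E]
    [InnerProductSpace ℂ E] [CompleteSpace E] (d : ℕ) where
  Φ : Matrix X X ℂ →⋆ₐ[ℂ] (E →L[ℂ] E)
  J : E →L[ℂ] E
  Γ : Fin d → E →L[ℂ] E
  star_J : star J = J
  J_sq : J * J = 1
  star_Γ : ∀ j, star (Γ j) = Γ j
  clifford : ∀ i j, Γ i * Γ j + Γ j * Γ i = if i = j then 2 else 0
  J_mul_Γ : ∀ j, J * Γ j = -(Γ j * J)
  J_comm : ∀ A, J * Φ A = Φ A * J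
  Γ_comm : ∀ j A, Γ j * Φ A = Φ A * Γ j

/-! ### Algebra of the localizer and the formula for its square. -/

namespace LocalizerFrame

variable {X E : Type*} [Fintype X] [DecidableEq X] [NormedAddCommGroup E]
    [InnerProductSpace ℂ E] [CompleteSpace E] {d : ℕ} (𝔽 : LocalizerFrame X E d)

/-- Multiplication by a real function. -/
noncomputable def mult (f : X → ℝ) : E →L[ℂ] E := 𝔽.Φ (diagonal fun x => (f x : ℂ))

theorem norm_Φ_le (A : Matrix X X ℂ) : ‖𝔽.Φ A‖ ≤ ‖A‖ := NonUnitalStarAlgHom.norm_apply_le 𝔽.Φ A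

theorem star_mult (f : X → ℝ) : star (𝔽.mult f) = 𝔽.mult f := by
  rw [mult, ← map_star, star_eq_conjTranspose, diagonal_conjTranspose]
  congr 2
  funext x
  simp

theorem mult_mul (f g : X → ℝ) : 𝔽.mult f * 𝔽.mult g = 𝔽.mult (f * g) := by
  rw [mult, mult, ← map_mul, diagonal_mul_diagonal, mult]
  simp

theorem mult_comm (f g : X → ℝ) : 𝔽.mult f * 𝔽.mult g = 𝔽.mult g * 𝔽.mult f := by
  rw [mult_mul, mult_mul, mul_comm]

theorem mult_add (f g : X → ℝ) : 𝔽.mult (f + g) = 𝔽.mult f + 𝔽.mult g := by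
  rw [mult, mult, mult, ← map_add, diagonal_add]
  simp

theorem mult_sub (f g : X → ℝ) : 𝔽.mult (f - g) = 𝔽.mult f - 𝔽.mult g := by
  rw [mult, mult, mult, ← map_sub, diagonal_sub]
  simp

theorem mult_sum {ι : Type*} (s : Finset ι) (f : ι → X → ℝ) :
    𝔽.mult (∑ i ∈ s, f i) = ∑ i ∈ s, 𝔽.mult (f i) := by
  classical
  induction s using Finset.induction_on with
  | empty =>
    simp only [Finset.sum_empty, mult]
    convert map_zero 𝔽.Φ
    ext i j
    simp [diagonal]
  | insert a s ha ih => rw [Finset.sum_insert ha, Finset.sum_insert ha, mult_add, ih]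

theorem mult_smul (a : ℝ) (f : X → ℝ) : 𝔽.mult (a • f) = (a : ℂ) • 𝔽.mult f := by
  rw [mult, mult, ← map_smul, ← diagonal_smul]
  congr 2
  funext x
  simp

theorem mult_one : 𝔽.mult 1 = 1 := by
  simp [mult]

theorem norm_mult_sq (f : X → ℝ) (ψ : E) : ‖𝔽.mult f ψ‖ ^ 2 = form (𝔽.mult (f * f)) ψ := by
  rw [← form_star_mul_self, star_mult, mult_mul]

theorem form_mult_nonneg {f : X → ℝ} (hf : ∀ x, 0 ≤ f x) (ψ : E) : 0 ≤ form (𝔽.mult f) ψ := by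
  have : f = (fun x => √(f x)) * fun x => √(f x) := by
    funext x; simp [Real.mul_self_sqrt (hf x)]
  rw [this, ← norm_mult_sq]
  positivity

theorem form_mult_mono {f g : X → ℝ} (hfg : ∀ x, f x ≤ g x) (ψ : E) :
    form (𝔽.mult f) ψ ≤ form (𝔽.mult g) ψ := by
  rw [← sub_nonneg, ← form_sub, ← mult_sub]
  exact 𝔽.form_mult_nonneg (fun x => sub_nonneg.mpr (hfg x)) ψ

theorem form_one (ψ : E) : form (1 : E →L[ℂ] E) ψ = ‖ψ‖ ^ 2 := by
  have := form_star_mul_self (1 : E →L[ℂ] E) ψ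
  simpa using this

theorem norm_J_le : ‖𝔽.J‖ ≤ 1 := by
  have : ‖𝔽.J‖ * ‖𝔽.J‖ ≤ 1 := by
    rw [← CStarRing.norm_star_mul_self, star_J, J_sq]
    exact ContinuousLinearMap.norm_id_le
  nlinarith [norm_nonneg 𝔽.J]

theorem Γ_sq (j : Fin d) : 𝔽.Γ j * 𝔽.Γ j = 1 := by
  have h := 𝔽.clifford j j
  simp only [if_true, ← two_mul] at h
  have h2 : (2 : ℂ) • (𝔽.Γ j * 𝔽.Γ j) = (2 : ℂ) • 1 := by
    rw [two_smul, ← two_mul, h, two_smul]; norm_num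
  exact smul_right_injective _ two_ne_zero h2

theorem norm_Γ_le (j : Fin d) : ‖𝔽.Γ j‖ ≤ 1 := by
  have : ‖𝔽.Γ j‖ * ‖𝔽.Γ j‖ ≤ 1 := by
    rw [← CStarRing.norm_star_mul_self, star_Γ, Γ_sq]
    exact ContinuousLinearMap.norm_id_le
  nlinarith [norm_nonneg (𝔽.Γ j)]

/-- The Dirac part `∑ s_j Γ_j`. -/
noncomputable def dirac (s : Fin d → X → ℝ) : E →L[ℂ] E := ∑ j, 𝔽.mult (s j) * 𝔽.Γ j

/-- The localizer `J (c - h) + ∑ s_j Γ_j`. -/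
noncomputable def loc (c : X → ℝ) (s : Fin d → X → ℝ) (h : Matrix X X ℂ) : E →L[ℂ] E :=
  𝔽.J * (𝔽.mult c - 𝔽.Φ h) + 𝔽.dirac s

theorem star_dirac (s : Fin d → X → ℝ) : star (𝔽.dirac s) = 𝔽.dirac s := by
  simp only [dirac, star_sum, star_mul, star_Γ, star_mult]
  exact Finset.sum_congr rfl fun j _ => 𝔽.Γ_comm j _

theorem J_mul_dirac (s : Fin d → X → ℝ) : 𝔽.J * 𝔽.dirac s = -(𝔽.dirac s * 𝔽.J) := by
  simp only [dirac, Finset.mul_sum, Finset.sum_mul, ← Finset.sum_neg_distrib]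
  refine Finset.sum_congr rfl fun j _ => ?_
  rw [mult, ← mul_assoc, J_comm, mul_assoc, J_mul_Γ, mul_neg, mul_assoc]

theorem mult_mul_dirac (f : X → ℝ) (s : Fin d → X → ℝ) :
    𝔽.mult f * 𝔽.dirac s = 𝔽.dirac s * 𝔽.mult f := by
  simp only [dirac, Finset.mul_sum, Finset.sum_mul]
  refine Finset.sum_congr rfl fun j _ => ?_
  have : 𝔽.Γ j * 𝔽.mult f = 𝔽.mult f * 𝔽.Γ j := 𝔽.Γ_comm j _
  rw [mul_assoc, this, ← mul_assoc, ← mul_assoc, mult_comm]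

/-- The double sum is added to itself with the indices exchanged; the anticommutators then leave
only the diagonal terms. -/
theorem dirac_sq (s : Fin d → X → ℝ) : 𝔽.dirac s * 𝔽.dirac s = 𝔽.mult (∑ j, s j * s j) := by
  have h1 : 𝔽.dirac s * 𝔽.dirac s
      = ∑ i, ∑ j, 𝔽.mult (s i) * 𝔽.mult (s j) * (𝔽.Γ i * 𝔽.Γ j) := by
    simp only [dirac, Finset.sum_mul, Finset.mul_sum]
    rw [Finset.sum_comm]
    refine Finset.sum_congr rfl fun i _ => Finset.sum_congr rfl fun j _ => ?_
    have : 𝔽.Γ i * 𝔽.mult (s j) = 𝔽.mult (s j) * 𝔽.Γ i := 𝔽.Γ_comm i _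
    rw [mul_assoc, ← mul_assoc (𝔽.Γ i), this]
    simp only [mul_assoc]
  have h2 : (2 : ℂ) • (𝔽.dirac s * 𝔽.dirac s) = (2 : ℂ) • 𝔽.mult (∑ j, s j * s j) := by
    rw [two_smul, two_smul]
    rw [congrArg₂ (· + ·) (h1.trans Finset.sum_comm) h1]
    rw [mult_sum, ← Finset.sum_add_distrib, ← Finset.sum_add_distrib]
    refine Finset.sum_congr rfl fun i _ => ?_
    rw [← Finset.sum_add_distrib]
    have : ∀ j, 𝔽.mult (s j) * 𝔽.mult (s i) * (𝔽.Γ j * 𝔽.Γ i)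
        + 𝔽.mult (s i) * 𝔽.mult (s j) * (𝔽.Γ i * 𝔽.Γ j)
        = if j = i then 𝔽.mult (s i * s i) + 𝔽.mult (s i * s i) else 0 := by
      intro j
      rw [𝔽.mult_comm (s i), ← mul_add, clifford]
      split_ifs with hij
      · subst hij
        rw [mult_mul, mul_two]
      · simp
    simp [this]
  exact smul_right_injective _ two_ne_zero h2

theorem star_loc (c : X → ℝ) (s : Fin d → X → ℝ) {h : Matrix X X ℂ} (hh : h.IsHermitian) :
    star (𝔽.loc c s h) = 𝔽.loc c s h := by
  have h1 : star (𝔽.Φ h) = 𝔽.Φ h := by rw [← map_star, star_eq_conjTranspose, hh.eq]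
  rw [loc, star_add, star_dirac, star_mul, star_sub, star_mult, h1, star_J, mul_sub, sub_mul,
    mult, J_comm, J_comm]

/-- As `J` anticommutes with `D` and commutes with `c - h`, the cross terms of the square form a
commutator of `D` with `c - h`; functions commute with `D`, so only `h` contributes. -/
theorem norm_loc_sq (c : X → ℝ) (s : Fin d → X → ℝ) {h : Matrix X X ℂ} (hh : h.IsHermitian)
    (ψ : E) :
    ‖𝔽.loc c s h ψ‖ ^ 2 = ‖(𝔽.mult c - 𝔽.Φ h) ψ‖ ^ 2 + form (𝔽.mult (∑ j, s j * s j)) ψ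
      + form (𝔽.J * (𝔽.dirac s * 𝔽.Φ h - 𝔽.Φ h * 𝔽.dirac s)) ψ := by
  have h1 : star (𝔽.Φ h) = 𝔽.Φ h := by rw [← map_star, star_eq_conjTranspose, hh.eq]
  rw [← form_star_mul_self, ← form_star_mul_self, ← form_add, ← form_add, star_loc _ _ _ hh,
    star_sub, h1, star_mult, ← dirac_sq]
  congr 1
  have hK : 𝔽.J * (𝔽.mult c - 𝔽.Φ h) = (𝔽.mult c - 𝔽.Φ h) * 𝔽.J := by
    rw [mul_sub, sub_mul, mult, J_comm, J_comm]
  have hm := 𝔽.mult_mul_dirac c s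
  have hJ := 𝔽.J_mul_dirac s
  rw [loc]
  set K := 𝔽.mult c - 𝔽.Φ h with hKdef
  set B := 𝔽.dirac s
  have e1 : 𝔽.J * K * (𝔽.J * K) = K * K := by
    nth_rewrite 1 [hK]
    rw [mul_assoc, ← mul_assoc 𝔽.J 𝔽.J, J_sq, one_mul]
  have e2 : B * (𝔽.J * K) = -(𝔽.J * (B * K)) := by
    rw [← mul_assoc, ← mul_assoc, hJ]; simp
  have e3 : K * B - B * K = B * 𝔽.Φ h - 𝔽.Φ h * B := by
    rw [hKdef, sub_mul, mul_sub, hm]; abel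
  clear_value K B
  rw [add_mul, mul_add, mul_add, e1, e2, ← e3, mul_sub, mul_assoc]
  abel

end LocalizerFrame

end PeriodicLocalizer

namespace PeriodicLocalizer

open Matrix Topology
open scoped Matrix.Norms.L2Operator

/-! ### Commutators with phases, and the gap of the localizer. -/

section Commutators

variable {X : Type*} [DecidableEq X]

/-- Multiplication by the phase `e^{iθ}`. -/
noncomputable def phase (θ : X → ℝ) : Matrix X X ℂ :=
  diagonal fun x => Complex.exp (θ x * Complex.I)

theorem diagonal_cos_eq (θ : X → ℝ) :
    (diagonal fun x => ((Real.cos (θ x) : ℝ) : ℂ)) = (1 / 2 : ℂ) • (phase θ + (phase θ)ᴴ) := by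
  rw [phase, diagonal_conjTranspose, diagonal_add, ← diagonal_smul]
  congr 1
  funext x
  simp only [Pi.smul_apply, Pi.star_apply, RCLike.star_def, ← Complex.exp_conj, smul_eq_mul,
    map_mul, Complex.conj_I, Complex.conj_ofReal]
  rw [Complex.ofReal_cos, Complex.cos]
  simp only [mul_neg, neg_mul]
  ring

theorem diagonal_sin_eq (θ : X → ℝ) :
    (diagonal fun x => ((Real.sin (θ x) : ℝ) : ℂ))
      = (-Complex.I / 2 : ℂ) • (phase θ - (phase θ)ᴴ) := by
  rw [phase, diagonal_conjTranspose, diagonal_sub, ← diagonal_smul]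
  congr 1
  funext x
  simp only [Pi.smul_apply, Pi.star_apply, RCLike.star_def, ← Complex.exp_conj, smul_eq_mul,
    map_mul, Complex.conj_I, Complex.conj_ofReal]
  rw [Complex.ofReal_sin, Complex.sin]
  simp only [mul_neg, neg_mul]
  ring

variable [Fintype X]

theorem norm_le_of_star_mul_self_eq_one {U : Matrix X X ℂ} (hU : Uᴴ * U = 1) : ‖U‖ ≤ 1 := by
  have h : ‖U‖ * ‖U‖ ≤ 1 := by
    rw [← l2_opNorm_conjTranspose_mul_self, hU, ← diagonal_one, l2_opNorm_diagonal]
    exact (pi_norm_le_iff_of_nonneg zero_le_one).mpr fun i => by simp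
  nlinarith [norm_nonneg U]

theorem phase_conjTranspose_mul_self (θ : X → ℝ) : (phase θ)ᴴ * phase θ = 1 := by
  rw [phase, diagonal_conjTranspose, diagonal_mul_diagonal, ← diagonal_one]
  congr 1
  funext x
  rw [Pi.star_apply, RCLike.star_def, ← Complex.exp_conj, ← Complex.exp_add]
  simp

theorem norm_phase_le (θ : X → ℝ) : ‖phase θ‖ ≤ 1 :=
  norm_le_of_star_mul_self_eq_one (phase_conjTranspose_mul_self θ)

theorem conjTranspose_comm {Y : Type*} [Fintype Y] {h : Matrix Y Y ℂ} (hh : h.IsHermitian)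
    (U : Matrix Y Y ℂ) :
    Uᴴ * h - h * Uᴴ = -(U * h - h * U)ᴴ := by
  rw [conjTranspose_sub, conjTranspose_mul, conjTranspose_mul, hh.eq]
  abel

theorem norm_comm_cos_le {h : Matrix X X ℂ} (hh : h.IsHermitian) (θ : X → ℝ) {ε : ℝ}
    (hε : ‖phase θ * h - h * phase θ‖ ≤ ε) :
    ‖(diagonal fun x => ((Real.cos (θ x) : ℝ) : ℂ)) * h
      - h * diagonal fun x => ((Real.cos (θ x) : ℝ) : ℂ)‖ ≤ ε := by
  have h1 : (diagonal fun x => ((Real.cos (θ x) : ℝ) : ℂ)) * h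
      - h * (diagonal fun x => ((Real.cos (θ x) : ℝ) : ℂ))
      = (1 / 2 : ℂ) • ((phase θ * h - h * phase θ) + ((phase θ)ᴴ * h - h * (phase θ)ᴴ)) := by
    rw [diagonal_cos_eq, smul_mul_assoc, mul_smul_comm, add_mul, mul_add, ← smul_sub]
    congr 1
    abel
  rw [h1, conjTranspose_comm hh, norm_smul]
  have h2 := norm_add_le (phase θ * h - h * phase θ) (-(phase θ * h - h * phase θ)ᴴ)
  rw [norm_neg, l2_opNorm_conjTranspose] at h2
  rw [show ‖(1 / 2 : ℂ)‖ = 1 / 2 by norm_num]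
  linarith

theorem norm_comm_sin_le {h : Matrix X X ℂ} (hh : h.IsHermitian) (θ : X → ℝ) {ε : ℝ}
    (hε : ‖phase θ * h - h * phase θ‖ ≤ ε) :
    ‖(diagonal fun x => ((Real.sin (θ x) : ℝ) : ℂ)) * h
      - h * diagonal fun x => ((Real.sin (θ x) : ℝ) : ℂ)‖ ≤ ε := by
  have h1 : (diagonal fun x => ((Real.sin (θ x) : ℝ) : ℂ)) * h
      - h * (diagonal fun x => ((Real.sin (θ x) : ℝ) : ℂ))
      = (-Complex.I / 2 : ℂ) •
        ((phase θ * h - h * phase θ) - ((phase θ)ᴴ * h - h * (phase θ)ᴴ)) := by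
    rw [diagonal_sin_eq, smul_mul_assoc, mul_smul_comm, sub_mul, mul_sub, ← smul_sub]
    congr 1
    abel
  rw [h1, conjTranspose_comm hh, norm_smul]
  have h2 := norm_sub_le (phase θ * h - h * phase θ) (-(phase θ * h - h * phase θ)ᴴ)
  rw [norm_neg, l2_opNorm_conjTranspose] at h2
  rw [show ‖(-Complex.I / 2 : ℂ)‖ = 1 / 2 by simp]
  linarith

end Commutators

namespace LocalizerFrame

variable {X E : Type*} [Fintype X] [DecidableEq X] [NormedAddCommGroup E]
    [InnerProductSpace ℂ E] [CompleteSpace E] {d : ℕ} (𝔽 : LocalizerFrame X E d)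

theorem dirac_comm_eq (s : Fin d → X → ℝ) (h : Matrix X X ℂ) :
    𝔽.dirac s * 𝔽.Φ h - 𝔽.Φ h * 𝔽.dirac s
      = ∑ j, 𝔽.Φ ((diagonal fun x => ((s j x : ℝ) : ℂ)) * h
          - h * diagonal fun x => ((s j x : ℝ) : ℂ)) * 𝔽.Γ j := by
  simp only [dirac, Finset.sum_mul, Finset.mul_sum, ← Finset.sum_sub_distrib, map_sub, map_mul,
    sub_mul, mult]
  refine Finset.sum_congr rfl fun j _ => ?_
  rw [mul_assoc, Γ_comm, ← mul_assoc, ← mul_assoc]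

/-- With `V = 1 - e^{iθ}` one has `1 - cos θ = V* V / 2`. Moving `V` and `V*` to the outside turns
the anticommutator into `V* h V` plus commutators with the phase, so the main term is controlled by
`1 - cos θ` itself and not merely by a constant. -/
theorem form_anticomm_one_sub_cos_le {h : Matrix X X ℂ} (hh : h.IsHermitian) (θ : X → ℝ)
    {b ε : ℝ} (hb : ‖h‖ ≤ b) (hε : ‖phase θ * h - h * phase θ‖ ≤ ε) (ψ : E) :
    form (𝔽.mult (fun x => 1 - Real.cos (θ x)) * 𝔽.Φ h
      + 𝔽.Φ h * 𝔽.mult (fun x => 1 - Real.cos (θ x))) ψ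
      ≤ 2 * b * form (𝔽.mult fun x => 1 - Real.cos (θ x)) ψ + 2 * ε * ‖ψ‖ ^ 2 := by
  set D : Matrix X X ℂ := diagonal fun x => ((1 - Real.cos (θ x) : ℝ) : ℂ) with hD
  set V : Matrix X X ℂ := 1 - phase θ with hV
  set K := phase θ * h - h * phase θ with hK
  have hDV : D = (1 / 2 : ℂ) • (Vᴴ * V) := by
    have h1 : D = 1 - (1 / 2 : ℂ) • (phase θ + (phase θ)ᴴ) := by
      rw [← diagonal_cos_eq, hD, ← diagonal_one, diagonal_sub]
      simp
    rw [h1, hV, conjTranspose_sub, conjTranspose_one, sub_mul, mul_sub, mul_sub,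
      phase_conjTranspose_mul_self]
    simp only [one_mul, mul_one, smul_sub, smul_add]
    have : (1 : Matrix X X ℂ) = (1 / 2 : ℂ) • 1 + (1 / 2 : ℂ) • 1 := by
      rw [← add_smul]; norm_num
    nth_rewrite 1 [this]
    abel
  have hVn : ‖V‖ ≤ 2 := by
    refine (norm_sub_le _ _).trans ?_
    have h1 := norm_le_of_star_mul_self_eq_one (U := (1 : Matrix X X ℂ)) (by simp)
    have h2 := norm_phase_le θ
    linarith
  have key : D * h + h * D = Vᴴ * h * V + (-1 / 2 : ℂ) • (Vᴴ * K + Kᴴ * V) := by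
    have e1 : V * h = h * V - K := by rw [hV, hK, sub_mul, mul_sub]; simp
    have e2 : h * Vᴴ = Vᴴ * h - Kᴴ := by
      have := congrArg conjTranspose e1
      rwa [conjTranspose_mul V h, conjTranspose_sub (h * V) K, conjTranspose_mul h V, hh.eq] at this
    rw [hDV, smul_mul_assoc, mul_smul_comm, mul_assoc, e1, ← mul_assoc h, e2, mul_sub, sub_mul]
    rw [← mul_assoc]
    module
  have hlhs : 𝔽.mult (fun x => 1 - Real.cos (θ x)) * 𝔽.Φ h
      + 𝔽.Φ h * 𝔽.mult (fun x => 1 - Real.cos (θ x)) = 𝔽.Φ (D * h + h * D) := by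
    rw [map_add, map_mul, map_mul]; rfl
  have hF : form (𝔽.mult fun x => 1 - Real.cos (θ x)) ψ = 1 / 2 * ‖𝔽.Φ V ψ‖ ^ 2 := by
    have : 𝔽.mult (fun x => 1 - Real.cos (θ x)) = ((1 / 2 : ℝ) : ℂ) • (star (𝔽.Φ V) * 𝔽.Φ V) := by
      rw [← map_star, ← map_mul, ← map_smul, star_eq_conjTranspose]
      simp only [mult]
      rw [← hD, hDV]
      norm_num
    rw [this, form_smul, form_star_mul_self]
  have h1 : form (𝔽.Φ (Vᴴ * h * V)) ψ ≤ b * ‖𝔽.Φ V ψ‖ ^ 2 := by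
    rw [map_mul, map_mul, ← star_eq_conjTranspose, map_star, form_star_mul_mul]
    refine (le_abs_self _).trans ((abs_form_le _ _).trans ?_)
    exact mul_le_mul_of_nonneg_right ((𝔽.norm_Φ_le h).trans hb) (by positivity)
  have h2 : form (𝔽.Φ ((-1 / 2 : ℂ) • (Vᴴ * K + Kᴴ * V))) ψ ≤ 2 * ε * ‖ψ‖ ^ 2 := by
    refine (le_abs_self _).trans ((abs_form_le _ _).trans ?_)
    refine mul_le_mul_of_nonneg_right ((𝔽.norm_Φ_le _).trans ?_) (by positivity)
    rw [norm_smul]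
    have a1 := norm_add_le (Vᴴ * K) (Kᴴ * V)
    have a2 := l2_opNorm_mul Vᴴ K
    have a3 := l2_opNorm_mul Kᴴ V
    rw [l2_opNorm_conjTranspose] at a2 a3
    have a4 : ‖V‖ * ‖K‖ ≤ 2 * ε := mul_le_mul hVn hε (norm_nonneg _) (by norm_num)
    norm_num
    linarith [mul_comm ‖V‖ ‖K‖]
  rw [hlhs, key, map_add, form_add, hF]
  linarith

/-- The square of the localizer built from angles `θ_j` is bounded below. -/
theorem norm_loc_sq_ge {h : Matrix X X ℂ} (hh : h.IsHermitian) (θ : Fin d → X → ℝ)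
    {b γ ε : ℝ} (hb : ‖h‖ ≤ b) (hγ0 : 0 ≤ γ) (hγ : ∀ ψ, γ * ‖ψ‖ ≤ ‖𝔽.Φ h ψ‖)
    (hε : ∀ j, ‖phase (θ j) * h - h * phase (θ j)‖ ≤ ε) (ψ : E) :
    (γ ^ 2 - 4 * d * max (b - 1) 0 - 3 * d * ε) * ‖ψ‖ ^ 2
      ≤ ‖𝔽.loc (∑ j, fun x => 1 - Real.cos (θ j x)) (fun j x => Real.sin (θ j x)) h ψ‖ ^ 2 := by
  set u : Fin d → X → ℝ := fun j x => 1 - Real.cos (θ j x) with hu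
  set s : Fin d → X → ℝ := fun j x => Real.sin (θ j x) with hs
  have hu0 : ∀ j x, 0 ≤ u j x := fun j x => by
    simp only [hu]; linarith [Real.cos_le_one (θ j x)]
  have hsa : star (𝔽.Φ h) = 𝔽.Φ h := by rw [← map_star, star_eq_conjTranspose, hh.eq]
  have hexp : ‖(𝔽.mult (∑ j, u j) - 𝔽.Φ h) ψ‖ ^ 2
      = form (𝔽.mult ((∑ j, u j) * ∑ j, u j)) ψ
        - ∑ j, form (𝔽.mult (u j) * 𝔽.Φ h + 𝔽.Φ h * 𝔽.mult (u j)) ψ + ‖𝔽.Φ h ψ‖ ^ 2 := by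
    rw [← form_star_mul_self, ← form_star_mul_self, ← form_sum, ← form_sub, ← form_add]
    congr 1
    rw [star_sub, hsa, star_mult, sub_mul, mul_sub, mul_sub, mult_mul, Finset.sum_add_distrib,
      ← Finset.sum_mul, ← Finset.mul_sum, ← mult_sum]
    abel
  have hcomm : |form (𝔽.J * (𝔽.dirac s * 𝔽.Φ h - 𝔽.Φ h * 𝔽.dirac s)) ψ| ≤ d * ε * ‖ψ‖ ^ 2 := by
    refine (abs_form_le _ _).trans (mul_le_mul_of_nonneg_right ?_ (by positivity))
    refine (norm_mul_le _ _).trans ?_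
    have h1 : ‖𝔽.dirac s * 𝔽.Φ h - 𝔽.Φ h * 𝔽.dirac s‖ ≤ d * ε := by
      rw [dirac_comm_eq]
      refine (norm_sum_le _ _).trans ?_
      have : ∀ j ∈ Finset.univ, ‖𝔽.Φ ((diagonal fun x => ((s j x : ℝ) : ℂ)) * h
          - h * diagonal fun x => ((s j x : ℝ) : ℂ)) * 𝔽.Γ j‖ ≤ ε := by
        intro j _
        have a1 := (𝔽.norm_Φ_le _).trans (norm_comm_sin_le hh (θ j) (hε j))
        have a2 := 𝔽.norm_Γ_le j
        refine (norm_mul_le _ _).trans ?_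
        exact (mul_le_of_le_one_right (norm_nonneg _) a2).trans a1
      refine (Finset.sum_le_sum this).trans ?_
      simp
    exact (mul_le_of_le_one_left (norm_nonneg _) 𝔽.norm_J_le).trans h1
  have hanti : ∑ j, form (𝔽.mult (u j) * 𝔽.Φ h + 𝔽.Φ h * 𝔽.mult (u j)) ψ
      ≤ 2 * b * form (𝔽.mult (∑ j, u j)) ψ + 2 * d * ε * ‖ψ‖ ^ 2 := by
    rw [mult_sum, form_sum, Finset.mul_sum]
    have : (2 * d * ε * ‖ψ‖ ^ 2 : ℝ) = ∑ _j : Fin d, 2 * ε * ‖ψ‖ ^ 2 := by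
      simp; ring
    rw [this, ← Finset.sum_add_distrib]
    exact Finset.sum_le_sum fun j _ => 𝔽.form_anticomm_one_sub_cos_le hh (θ j) hb (hε j) ψ
  have hpt : form (𝔽.mult ((2 : ℝ) • ∑ j, u j)) ψ
      ≤ form (𝔽.mult ((∑ j, u j) * ∑ j, u j)) ψ + form (𝔽.mult (∑ j, s j * s j)) ψ := by
    rw [← form_add, ← mult_add]
    refine 𝔽.form_mult_mono (fun x => ?_) ψ
    simp only [Pi.smul_apply, Pi.add_apply, Pi.mul_apply, Finset.sum_apply, smul_eq_mul]
    -- The mixed products are nonnegative and can be dropped; the remaining terms satisfy `(1 -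
    -- cos)² + sin² = 2 (1 - cos)`.
    have h1 : ∑ j, u j x ^ 2 ≤ (∑ j, u j x) ^ 2 :=
      Finset.sum_sq_le_sq_sum_of_nonneg fun j _ => hu0 j x
    have h2 : ∑ j, u j x ^ 2 + ∑ j, s j x * s j x = 2 * ∑ j, u j x := by
      rw [← Finset.sum_add_distrib, Finset.mul_sum]
      refine Finset.sum_congr rfl fun j _ => ?_
      simp only [hu, hs]
      nlinarith [Real.sin_sq_add_cos_sq (θ j x)]
    linarith [sq (∑ j, u j x)]
  rw [mult_smul, form_smul] at hpt
  have hC0 : 0 ≤ form (𝔽.mult (∑ j, u j)) ψ :=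
    𝔽.form_mult_nonneg (fun x => by
      rw [Finset.sum_apply]; exact Finset.sum_nonneg fun j _ => hu0 j x) ψ
  have hC1 : form (𝔽.mult (∑ j, u j)) ψ ≤ 2 * d * ‖ψ‖ ^ 2 := by
    have := 𝔽.form_mult_mono (f := ∑ j, u j) (g := (2 * d : ℝ) • 1) (fun x => by
      simp only [Finset.sum_apply, Pi.smul_apply, Pi.one_apply, smul_eq_mul, mul_one]
      have : ∀ j ∈ Finset.univ, u j x ≤ 2 := fun j _ => by
        simp only [hu]; linarith [Real.neg_one_le_cos (θ j x)]
      refine (Finset.sum_le_sum this).trans ?_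
      simp [mul_comm]) ψ
    rwa [mult_smul, form_smul, mult_one, form_one] at this
  have hγ2 : γ ^ 2 * ‖ψ‖ ^ 2 ≤ ‖𝔽.Φ h ψ‖ ^ 2 := by
    rw [← mul_pow]; exact pow_le_pow_left₀ (by positivity) (hγ ψ) 2
  rw [norm_loc_sq _ _ _ hh, hexp]
  -- The mass enters as `2 (1 - b) c`. It is harmless for `b ≤ 1`; otherwise `c ≤ 2 d` limits the
  -- loss to `4 d (b - 1)`. Of the loss `3 d ε`, two parts come from the anticommutators and one
  -- from `[D, h]`.
  have hm : (1 - b) * form (𝔽.mult (∑ j, u j)) ψ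
      ≥ -(max (b - 1) 0 * (2 * d * ‖ψ‖ ^ 2)) := by
    have h1 : max (b - 1) 0 * form (𝔽.mult (∑ j, u j)) ψ ≤ max (b - 1) 0 * (2 * d * ‖ψ‖ ^ 2) :=
      mul_le_mul_of_nonneg_left hC1 (le_max_right _ _)
    have h2 : (b - 1) * form (𝔽.mult (∑ j, u j)) ψ
        ≤ max (b - 1) 0 * form (𝔽.mult (∑ j, u j)) ψ :=
      mul_le_mul_of_nonneg_right (le_max_left _ _) hC0
    linarith
  have := neg_abs_le (form (𝔽.J * (𝔽.dirac s * 𝔽.Φ h - 𝔽.Φ h * 𝔽.dirac s)) ψ)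
  linarith

end LocalizerFrame

end PeriodicLocalizer

/-! ### Triviality of the kernel of an interpolated localizer. -/

namespace PeriodicLocalizer

open Matrix Topology
open scoped Matrix.Norms.L2Operator

/-- The commutator of multiplication by `f` with `h` is the sum of a part of norm at most `e`
and a part of norm at most `φ` supported on the support of `χ`. -/
def CommSplit {X : Type*} [Fintype X] [DecidableEq X] (χ f : X → ℝ) (h : Matrix X X ℂ)
    (e φ : ℝ) : Prop :=
  ∃ E F : Matrix X X ℂ, (diagonal fun x => (f x : ℂ)) * h - h * (diagonal fun x => (f x : ℂ))
    = E + (diagonal fun x => (χ x : ℂ)) * F * (diagonal fun x => (χ x : ℂ)) ∧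
    ‖E‖ ≤ e ∧ ‖F‖ ≤ φ

namespace LocalizerFrame

variable {X E : Type*} [Fintype X] [DecidableEq X] [NormedAddCommGroup E]
    [InnerProductSpace ℂ E] [CompleteSpace E] {d : ℕ} (𝔽 : LocalizerFrame X E d)

/-- Apply `w J` to the kernel equation: `w J D` is skew-adjoint, so its real expectation vanishes
and the Dirac part disappears. Suitable weights `w` then control moments of the mass in a kernel
vector. -/
theorem form_mult_of_loc_eq_zero {c : X → ℝ} {s : Fin d → X → ℝ} {h : Matrix X X ℂ}
    {ψ : E} (hψ : 𝔽.loc c s h ψ = 0) (w : X → ℝ) :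
    form (𝔽.mult (w * c)) ψ = form (𝔽.mult w * 𝔽.Φ h) ψ := by
  have h1 : form (𝔽.mult w * 𝔽.J * 𝔽.loc c s h) ψ = 0 := by
    simp [form, hψ]
  have h2 : 𝔽.mult w * 𝔽.J * 𝔽.loc c s h
      = 𝔽.mult (w * c) - 𝔽.mult w * 𝔽.Φ h + 𝔽.mult w * 𝔽.J * 𝔽.dirac s := by
    rw [loc, mul_add, ← mult_mul, mul_assoc (𝔽.mult w), ← mul_assoc 𝔽.J 𝔽.J, J_sq, one_mul,
      mul_sub]
  have h3 : star (𝔽.mult w * 𝔽.J * 𝔽.dirac s) = (-1 : ℝ) • (𝔽.mult w * 𝔽.J * 𝔽.dirac s) := by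
    have e1 : 𝔽.J * 𝔽.mult w = 𝔽.mult w * 𝔽.J := 𝔽.J_comm _
    rw [star_mul, star_mul, star_dirac, star_J, star_mult, e1, ← mul_assoc, ← mult_mul_dirac,
      mul_assoc, mul_assoc, J_mul_dirac]
    simp
  have h4 : form (𝔽.mult w * 𝔽.J * 𝔽.dirac s) ψ = 0 := by
    have := form_star (𝔽.mult w * 𝔽.J * 𝔽.dirac s) ψ
    rw [h3, ← Complex.coe_smul, form_smul] at this
    linarith
  rw [h2, form_add, form_sub, h4] at h1
  linarith

theorem form_mul_le {A T : E →L[ℂ] E} (hA : star A = A) (ψ : E) :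
    form (A * T) ψ ≤ ‖A ψ‖ * ‖T ψ‖ := by
  nth_rewrite 1 [← hA]
  rw [form_star_mul]
  exact (Complex.re_le_norm _).trans (norm_inner_le_norm _ _)

set_option maxHeartbeats 1000000 in
/-- A localizer has trivial kernel if the Hamiltonian is gapped and nearly commutes with the
position functions up to terms supported where `c` is large. -/
theorem eq_zero_of_loc_eq_zero {c χ : X → ℝ} {s : Fin d → X → ℝ} {h h₁ : Matrix X X ℂ}
    (hh : h.IsHermitian) (hd : 0 < d) (hχ : ∀ x, χ x * χ x = χ x)
    (hcχ : ∀ x, χ x ≤ 4 * c x) (hcs : ∀ x, (1 - χ x) * (c x * c x) ≤ d * ∑ j, s j x * s j x)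
    {b γ e ε : ℝ} (hb : ‖h‖ ≤ b) (hγ0 : 0 ≤ γ) (hγ : ∀ ψ, γ * ‖ψ‖ ≤ ‖𝔽.Φ h₁ ψ‖)
    {r : Matrix X X ℂ}
    (hr : h₁ - h = (diagonal fun x => (χ x : ℂ)) * r * (diagonal fun x => (χ x : ℂ)))
    (hrb : ‖r‖ ≤ 2 * b) (he : 0 ≤ e)
    (hc : CommSplit χ c h e (2 * d * b)) (hs : ∀ j, CommSplit χ (s j) h ε (2 * b))
    (hbd : 64 * d * b ≤ 1)
    (hnum : 8 * b * (b ^ 2 + e) * (1 + 32 * b ^ 2 + 32 * d ^ 2 * b) + d ^ 2 * ε < γ ^ 2 / 4)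
    {ψ : E} (hψ : 𝔽.loc c s h ψ = 0) : ψ = 0 := by
  by_contra hne
  have hN : 0 < ‖ψ‖ := norm_pos_iff.mpr hne
  have hb0 : 0 ≤ b := (norm_nonneg _).trans hb
  have hd1 : (1 : ℝ) ≤ d := by exact_mod_cast hd
  have hχ0 : ∀ x, 0 ≤ χ x := fun x => by rw [← hχ]; exact mul_self_nonneg _
  have hsa : star (𝔽.Φ h) = 𝔽.Φ h := by rw [← map_star, star_eq_conjTranspose, hh.eq]
  set N := ‖ψ‖
  set C := 𝔽.mult c
  set P := 𝔽.mult χ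
  -- Here `a` is the mass norm of `ψ`, `o` its outer part and `p` the outer part of `ψ` itself. On
  -- the support of `χ` the bound `c ≥ 1/4` yields `p ≤ 4 o`.
  set a := ‖C ψ‖ with ha
  set o := ‖P (C ψ)‖ with ho
  set p := ‖P ψ‖ with hp
  have ho2 : o ^ 2 = form (𝔽.mult (χ * (c * c))) ψ := by
    have := 𝔽.norm_mult_sq (χ * c) ψ
    rw [← mult_mul] at this
    have h1 : (χ * c) * (χ * c) = χ * (c * c) := by
      funext x
      have := hχ x
      simp only [Pi.mul_apply]
      linear_combination (c x * c x) * this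
    rwa [h1] at this
  have hp2 : p ^ 2 ≤ 16 * o ^ 2 := by
    rw [hp, 𝔽.norm_mult_sq, ho2, ← form_smul, ← mult_smul]
    refine 𝔽.form_mult_mono (fun x => ?_) ψ
    simp only [Pi.smul_apply, Pi.mul_apply, smul_eq_mul]
    have h1 := hχ x
    have h2 := hcχ x
    have h3 : χ x = 0 ∨ χ x = 1 := by
      rcases mul_eq_zero.mp (show χ x * (χ x - 1) = 0 by linarith) with h | h
      · exact Or.inl h
      · exact Or.inr (by linarith)
    rcases h3 with h3 | h3 <;> rw [h3] at h2 ⊢ <;> nlinarith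
  have hp4 : p ≤ 4 * o := by
    refine abs_le_of_sq_le_sq' (by linarith [hp2, mul_pow 4 o 2]) (by positivity) |>.2
  have hhψ : ‖𝔽.Φ h ψ‖ ≤ b * N :=
    ((𝔽.Φ h).le_opNorm ψ).trans (mul_le_mul_of_nonneg_right ((𝔽.norm_Φ_le h).trans hb) hN.le)
  -- The weight `w = c` gives `a² = Re ⟨c h⟩ ≤ a b N`.
  have hab : a ≤ b * N := by
    have h1 := 𝔽.form_mult_of_loc_eq_zero hψ c
    rw [← 𝔽.norm_mult_sq] at h1
    have h2 := form_mul_le (T := 𝔽.Φ h) (𝔽.star_mult c) ψ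
    rw [← h1] at h2
    by_contra hlt
    push Not at hlt
    have : 0 < a := lt_of_le_of_lt (by positivity) hlt
    change a ^ 2 ≤ a * _ at h2
    nlinarith
  -- The weight `w = c²`: the third moment of `c` is at least `o² / 4` and at most `b a²` plus
  -- commutator terms. The outer commutator contributes `32 d b o²` after multiplication by four,
  -- and `64 d b ≤ 1` absorbs it into half of `o²`.
  have ho : o ^ 2 ≤ 8 * b * (b ^ 2 + e) * N ^ 2 := by
    obtain ⟨G, F, hGF, hG, hF⟩ := hc
    have h1 := 𝔽.form_mult_of_loc_eq_zero hψ (c * c)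
    have h2 : 𝔽.mult (c * c) * 𝔽.Φ h
        = star C * 𝔽.Φ h * C + C * 𝔽.Φ G + star (P * C) * (𝔽.Φ F * P) := by
      have e1 : C * 𝔽.Φ h - 𝔽.Φ h * C = 𝔽.Φ G + P * 𝔽.Φ F * P := by
        have := congrArg 𝔽.Φ hGF
        rw [map_sub, map_mul, map_mul, map_add, map_mul, map_mul] at this
        exact this
      have e2 : C * 𝔽.Φ h = 𝔽.Φ h * C + (𝔽.Φ G + P * 𝔽.Φ F * P) := by rw [← e1]; abel
      have e3 : star C = C := 𝔽.star_mult c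
      have e4 : star P = P := 𝔽.star_mult χ
      calc 𝔽.mult (c * c) * 𝔽.Φ h = C * (C * 𝔽.Φ h) := by rw [← mult_mul, mul_assoc]
        _ = C * (𝔽.Φ h * C + (𝔽.Φ G + P * 𝔽.Φ F * P)) := by rw [e2]
        _ = _ := by
          rw [star_mul, e3, e4]
          simp only [mul_add, mul_assoc]
          abel
    have h3 : form (star C * 𝔽.Φ h * C) ψ ≤ b * a ^ 2 := by
      rw [form_star_mul_mul]
      refine (le_abs_self _).trans ((abs_form_le _ _).trans ?_)
      exact mul_le_mul_of_nonneg_right ((𝔽.norm_Φ_le h).trans hb) (by positivity)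
    have h4 : form (C * 𝔽.Φ G) ψ ≤ a * (e * N) := by
      refine (form_mul_le (𝔽.star_mult c) ψ).trans ?_
      refine mul_le_mul_of_nonneg_left (((𝔽.Φ G).le_opNorm ψ).trans ?_) (norm_nonneg _)
      exact mul_le_mul_of_nonneg_right ((𝔽.norm_Φ_le G).trans hG) hN.le
    have h5 : form (star (P * C) * (𝔽.Φ F * P)) ψ ≤ o * (2 * d * b * p) := by
      rw [form_star_mul]
      refine (Complex.re_le_norm _).trans ((norm_inner_le_norm _ _).trans ?_)
      refine mul_le_mul_of_nonneg_left (((𝔽.Φ F).le_opNorm (P ψ)).trans ?_) (norm_nonneg _)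
      exact mul_le_mul_of_nonneg_right ((𝔽.norm_Φ_le F).trans hF) (norm_nonneg _)
    have h6 : o ^ 2 ≤ 4 * form (𝔽.mult (c * c * c)) ψ := by
      rw [ho2, ← form_smul, ← mult_smul]
      refine 𝔽.form_mult_mono (fun x => ?_) ψ
      simp only [Pi.smul_apply, Pi.mul_apply, smul_eq_mul]
      have := mul_le_mul_of_nonneg_right (hcχ x) (mul_self_nonneg (c x))
      linarith
    rw [h1, h2, form_add, form_add] at h6
    have h7 : b * a ^ 2 ≤ b * (b * N) ^ 2 :=
      mul_le_mul_of_nonneg_left (pow_le_pow_left₀ (norm_nonneg _) hab 2) hb0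
    have h8 : a * (e * N) ≤ b * N * (e * N) :=
      mul_le_mul_of_nonneg_right hab (by positivity)
    have h9 : o * (2 * d * b * p) ≤ o * (2 * d * b * (4 * o)) := by
      have : 0 ≤ o := norm_nonneg _
      gcongr
    have h10 : 64 * d * b * o ^ 2 ≤ 1 * o ^ 2 := mul_le_mul_of_nonneg_right hbd (sq_nonneg _)
    linarith
  have hzero := 𝔽.norm_loc_sq c s hh ψ
  rw [hψ, norm_zero] at hzero
  set k := ‖(C - 𝔽.Φ h) ψ‖ with hk
  have hS : a ^ 2 - o ^ 2 ≤ d * form (𝔽.mult (∑ j, s j * s j)) ψ := by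
    rw [ho2, ha, 𝔽.norm_mult_sq, ← form_sub, ← mult_sub, ← form_smul, ← mult_smul]
    refine 𝔽.form_mult_mono (fun x => ?_) ψ
    have := hcs x
    simp only [Pi.smul_apply, Pi.mul_apply, Pi.sub_apply, smul_eq_mul, Finset.sum_apply]
    linarith
  have hcm : |form (𝔽.J * (𝔽.dirac s * 𝔽.Φ h - 𝔽.Φ h * 𝔽.dirac s)) ψ|
      ≤ d * (ε * N ^ 2 + 2 * b * p ^ 2) := by
    have : ∀ j, |form (𝔽.J * (𝔽.Φ ((diagonal fun x => ((s j x : ℝ) : ℂ)) * h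
          - h * diagonal fun x => ((s j x : ℝ) : ℂ)) * 𝔽.Γ j)) ψ|
          ≤ ε * N ^ 2 + 2 * b * p ^ 2 := by
      intro j
      obtain ⟨G, F, hGF, hG, hF⟩ := hs j
      have hP : star P = P := 𝔽.star_mult χ
      have e1 : 𝔽.J * (𝔽.Φ (G + (diagonal fun x => (χ x : ℂ)) * F
          * (diagonal fun x => (χ x : ℂ))) * 𝔽.Γ j)
          = 𝔽.J * (𝔽.Φ G * 𝔽.Γ j) + star P * (𝔽.J * (𝔽.Φ F * 𝔽.Γ j)) * P := by
        have e2 : 𝔽.J * P = P * 𝔽.J := 𝔽.J_comm _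
        have e3 : 𝔽.Γ j * P = P * 𝔽.Γ j := 𝔽.Γ_comm _ _
        have e4 : 𝔽.Φ ((diagonal fun x => (χ x : ℂ)) * F * (diagonal fun x => (χ x : ℂ)))
          = P * 𝔽.Φ F * P := by rw [map_mul, map_mul]; rfl
        rw [map_add, e4, hP, add_mul, mul_add, ← mul_assoc P, ← e2]
        simp only [mul_assoc]
        rw [e3]
      have hn : ∀ T : Matrix X X ℂ, ‖𝔽.J * (𝔽.Φ T * 𝔽.Γ j)‖ ≤ ‖T‖ := by
        intro T
        refine (norm_mul_le _ _).trans ((mul_le_of_le_one_left (norm_nonneg _)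
          𝔽.norm_J_le).trans ((norm_mul_le _ _).trans ((mul_le_of_le_one_right (norm_nonneg _)
          (𝔽.norm_Γ_le j)).trans (𝔽.norm_Φ_le T))))
      rw [hGF, e1, form_add, form_star_mul_mul]
      refine (abs_add_le _ _).trans (add_le_add ?_ ?_)
      · exact (abs_form_le _ _).trans
          (mul_le_mul_of_nonneg_right ((hn G).trans hG) (by positivity))
      · exact (abs_form_le _ _).trans
          (mul_le_mul_of_nonneg_right ((hn F).trans hF) (by positivity))
    rw [dirac_comm_eq, Finset.mul_sum, form_sum]
    refine (Finset.abs_sum_le_sum_abs _ _).trans ((Finset.sum_le_sum fun j _ => this j).trans ?_)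
    simp [mul_add]
  -- As `h₁ = -(c - h) + c + (h₁ - h)`, the gap of `h₁` forces one of three quantities to be large:
  -- the remainder `k`, the mass `a` or the outer part `p`.
  have hgap : γ * N ≤ k + a + 2 * b * p := by
    have e1 : 𝔽.Φ h₁ ψ = -((C - 𝔽.Φ h) ψ) + C ψ + P (𝔽.Φ r (P ψ)) := by
      have e2 : 𝔽.Φ h₁ = -(C - 𝔽.Φ h) + C + P * (𝔽.Φ r * P) := by
        have := congrArg 𝔽.Φ hr
        rw [map_sub, map_mul, map_mul] at this
        have e3 : 𝔽.Φ h₁ - 𝔽.Φ h = P * 𝔽.Φ r * P := this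
        rw [← mul_assoc, ← e3]; abel
      rw [e2]; rfl
    have e4 : ‖P‖ ≤ 1 := by
      have h1 : ‖P‖ * ‖P‖ = ‖P‖ := by
        rw [← CStarRing.norm_star_mul_self, 𝔽.star_mult, mult_mul]
        congr 2
        funext x
        exact hχ x
      nlinarith [norm_nonneg P]
    have e5 : ‖P (𝔽.Φ r (P ψ))‖ ≤ 2 * b * p := by
      refine (P.le_opNorm _).trans ((mul_le_of_le_one_left (norm_nonneg _) e4).trans ?_)
      refine ((𝔽.Φ r).le_opNorm _).trans ?_
      exact mul_le_mul_of_nonneg_right ((𝔽.norm_Φ_le r).trans hrb) (norm_nonneg _)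
    refine (hγ ψ).trans ?_
    rw [e1]
    refine (norm_add_le _ _).trans (add_le_add ((norm_add_le _ _).trans ?_) e5)
    rw [norm_neg]
  have hgap2 : (γ * N) ^ 2 ≤ 4 * (k ^ 2 + a ^ 2 + 2 * b ^ 2 * p ^ 2) := by
    have h1 := pow_le_pow_left₀ (by positivity) hgap 2
    linarith [sq_nonneg (k - a), sq_nonneg (k + a - 2 * b * p)]
  -- The vanishing square is multiplied by `d`, since away from `χ` the mass squared is bounded by
  -- `d` times the Dirac part squared.
  have hka : k ^ 2 + a ^ 2 ≤ o ^ 2 + d * (d * (ε * N ^ 2 + 2 * b * p ^ 2)) := by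
    have h1 := abs_le.mp hcm
    have h2 : k ^ 2 ≤ d * k ^ 2 := le_mul_of_one_le_left (sq_nonneg _) hd1
    have h3 := mul_le_mul_of_nonneg_left h1.1 (Nat.cast_nonneg (α := ℝ) d)
    have h4 : (d : ℝ) * k ^ 2 + d * form (𝔽.mult (∑ j, s j * s j)) ψ
      + d * form (𝔽.J * (𝔽.dirac s * 𝔽.Φ h - 𝔽.Φ h * 𝔽.dirac s)) ψ = 0 := by
      rw [← mul_add, ← mul_add, ← hzero]; simp
    linarith
  have h1 : (2 * b ^ 2 + 2 * d ^ 2 * b) * p ^ 2 ≤ (2 * b ^ 2 + 2 * d ^ 2 * b) * (16 * o ^ 2) :=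
    mul_le_mul_of_nonneg_left hp2 (by positivity)
  have h2 : (1 + 32 * b ^ 2 + 32 * d ^ 2 * b) * o ^ 2
      ≤ (1 + 32 * b ^ 2 + 32 * d ^ 2 * b) * (8 * b * (b ^ 2 + e) * N ^ 2) :=
    mul_le_mul_of_nonneg_left ho (by positivity)
  have h3 := mul_lt_mul_of_pos_right hnum (pow_pos hN 2)
  linarith

end LocalizerFrame

end PeriodicLocalizer

namespace PeriodicLocalizer

open Matrix Topology
open scoped Matrix.Norms.L2Operator Kronecker

/-! ### Clifford relations and the concrete matrix realization. -/

section GammaHat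

variable {d k : ℕ} {γ : Fin (d - 1) → Matrix (Fin k) (Fin k) ℂ}

/-- The last matrix `i 𝟏` is central and skew-adjoint, so its mixed terms with the selfadjoint
generators cancel once adjoints are inserted. This is what makes the off-diagonal generators of the
frame anticommute, although `i 𝟏` commutes with every generator. -/
theorem gammaHat_mul_conjTranspose_add (hγ : IsIrredCliffordRep γ) (i j : Fin d) :
    gammaHat γ i * (gammaHat γ j)ᴴ + gammaHat γ j * (gammaHat γ i)ᴴ
      = if i = j then 2 else 0 := by
  by_cases hi : (i : ℕ) < d - 1 <;> by_cases hj : (j : ℕ) < d - 1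
  · have h := hγ.clifford ⟨i, hi⟩ ⟨j, hj⟩
    simp only [gammaHat, hi, hj, dif_pos, (hγ.selfadjoint _).eq, h, Fin.ext_iff]
  · have hne : i ≠ j := by rintro rfl; exact hj hi
    simp [gammaHat, hi, hj, (hγ.selfadjoint _).eq, hne, conjTranspose_smul]
  · have hne : i ≠ j := by rintro rfl; exact hi hj
    simp [gammaHat, hi, hj, (hγ.selfadjoint _).eq, hne, conjTranspose_smul]
  · have hij : i = j := by apply Fin.ext; omega
    subst hij
    simp only [gammaHat, hi, dif_neg, not_false_eq_true, if_true, conjTranspose_smul,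
      conjTranspose_one, smul_mul_smul_comm, mul_one]
    rw [← add_smul]
    simp
    norm_num
    rw [two_smul, one_add_one_eq_two]

theorem gammaHat_conjTranspose_mul_add (hγ : IsIrredCliffordRep γ) (i j : Fin d) :
    (gammaHat γ i)ᴴ * gammaHat γ j + (gammaHat γ j)ᴴ * gammaHat γ i
      = if i = j then 2 else 0 := by
  by_cases hi : (i : ℕ) < d - 1 <;> by_cases hj : (j : ℕ) < d - 1
  · have h := hγ.clifford ⟨i, hi⟩ ⟨j, hj⟩
    simp only [gammaHat, hi, hj, dif_pos, (hγ.selfadjoint _).eq, h, Fin.ext_iff]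
  · have hne : i ≠ j := by rintro rfl; exact hj hi
    simp [gammaHat, hi, hj, (hγ.selfadjoint _).eq, hne, conjTranspose_smul]
  · have hne : i ≠ j := by rintro rfl; exact hi hj
    simp [gammaHat, hi, hj, (hγ.selfadjoint _).eq, hne, conjTranspose_smul]
  · have hij : i = j := by apply Fin.ext; omega
    subst hij
    simp only [gammaHat, hi, dif_neg, not_false_eq_true, if_true, conjTranspose_smul,
      conjTranspose_one, smul_mul_smul_comm, mul_one]
    rw [← add_smul]
    simp
    norm_num
    rw [two_smul, one_add_one_eq_two]

end GammaHat

section Concrete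

theorem neg_kronecker_eq {l m n p : Type*} (A : Matrix l m ℂ) (B : Matrix n p ℂ) :
    (-A) ⊗ₖ B = -(A ⊗ₖ B) := by
  ext i j
  simp

variable {X : Type*} [Fintype X] [DecidableEq X] {d k : ℕ}

/-- The diagonal embedding `A ↦ A ⊗ 1 ⊕ A ⊗ 1`. -/
noncomputable def doubled (X : Type*) [Fintype X] [DecidableEq X] (k : ℕ) :
    Matrix X X ℂ →⋆ₐ[ℂ] Matrix ((X × Fin k) ⊕ (X × Fin k)) ((X × Fin k) ⊕ (X × Fin k)) ℂ where
  toFun A := fromBlocks (A ⊗ₖ 1) 0 0 (A ⊗ₖ 1)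
  map_one' := by simp
  map_mul' A B := by simp [fromBlocks_multiply, ← mul_kronecker_mul]
  map_zero' := by simp
  map_add' A B := by simp [fromBlocks_add, add_kronecker]
  commutes' a := by
    rw [Algebra.algebraMap_eq_smul_one, Algebra.algebraMap_eq_smul_one, smul_kronecker,
      one_kronecker_one, ← fromBlocks_one, fromBlocks_smul]
    simp
  map_star' A := by
    simp [star_eq_conjTranspose, fromBlocks_conjTranspose, conjTranspose_kronecker]

theorem doubled_apply (A : Matrix X X ℂ) :
    doubled X k A = fromBlocks (A ⊗ₖ 1) 0 0 (A ⊗ₖ 1) := rfl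

/-- The localizer of a Hamiltonian `h` with position functions `c` and `s`. -/
noncomputable def locMat {X : Type*} [DecidableEq X] (Γ : Fin d → Matrix (Fin k) (Fin k) ℂ) (c : X → ℝ) (s : Fin d → X → ℝ)
    (h : Matrix X X ℂ) : Matrix ((X × Fin k) ⊕ (X × Fin k)) ((X × Fin k) ⊕ (X × Fin k)) ℂ :=
  fromBlocks (((diagonal fun x => (c x : ℂ)) - h) ⊗ₖ 1)
    (∑ j, (diagonal fun x => (s j x : ℂ)) ⊗ₖ (Γ j)ᴴ)
    (∑ j, (diagonal fun x => (s j x : ℂ)) ⊗ₖ Γ j)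
    (-(((diagonal fun x => (c x : ℂ)) - h) ⊗ₖ 1))

theorem locMat_isHermitian {X : Type*} [DecidableEq X] (Γ : Fin d → Matrix (Fin k) (Fin k) ℂ)
    (c : X → ℝ) (s : Fin d → X → ℝ) {h : Matrix X X ℂ} (hh : h.IsHermitian) :
    (locMat Γ c s h).IsHermitian := by
  have hf : ∀ f : X → ℝ, (diagonal fun x => (f x : ℂ))ᴴ = diagonal fun x => (f x : ℂ) := by
    intro f
    rw [diagonal_conjTranspose]
    congr 1
    funext x
    simp
  simp [locMat, Matrix.IsHermitian, fromBlocks_conjTranspose, conjTranspose_kronecker,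
    conjTranspose_sum, hf, hh.eq, conjTranspose_sub]

/-- The frame on `(ℂ^X ⊗ ℂ^k)²` associated with the matrices `γ̂`. -/
noncomputable def concreteFrame (X : Type*) [Fintype X] [DecidableEq X]
    {γ : Fin (d - 1) → Matrix (Fin k) (Fin k) ℂ} (hγ : IsIrredCliffordRep γ) :
    LocalizerFrame X (EuclideanSpace ℂ ((X × Fin k) ⊕ (X × Fin k))) d where
  Φ := (toEuclideanCLM (n := (X × Fin k) ⊕ (X × Fin k)) (𝕜 := ℂ) :
    _ →⋆ₐ[ℂ] _).comp (doubled X k)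
  J := toEuclideanCLM (𝕜 := ℂ) (fromBlocks 1 0 0 (-1))
  Γ j := toEuclideanCLM (𝕜 := ℂ)
    (fromBlocks 0 ((1 : Matrix X X ℂ) ⊗ₖ (gammaHat γ j)ᴴ) ((1 : Matrix X X ℂ) ⊗ₖ gammaHat γ j) 0)
  star_J := by
    rw [← map_star]
    simp [star_eq_conjTranspose, fromBlocks_conjTranspose]
  J_sq := by
    rw [← map_mul]
    simp [fromBlocks_multiply]
  star_Γ j := by
    rw [← map_star]
    simp [star_eq_conjTranspose, fromBlocks_conjTranspose, conjTranspose_kronecker]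
  clifford i j := by
    rw [← map_mul, ← map_mul, ← map_add]
    simp only [fromBlocks_multiply, ← mul_kronecker_mul, fromBlocks_add, mul_zero, zero_mul,
      zero_add, add_zero, mul_one, ← kronecker_add, gammaHat_mul_conjTranspose_add hγ,
      gammaHat_conjTranspose_mul_add hγ]
    split_ifs
    · have : fromBlocks ((1 : Matrix X X ℂ) ⊗ₖ (2 : Matrix (Fin k) (Fin k) ℂ)) 0 0
          ((1 : Matrix X X ℂ) ⊗ₖ (2 : Matrix (Fin k) (Fin k) ℂ)) = 2 := by
        rw [← one_add_one_eq_two, kronecker_add, one_kronecker_one, ← one_add_one_eq_two,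
          ← fromBlocks_one, fromBlocks_add]
        simp
      rw [this, map_ofNat]
    · simp
  J_mul_Γ j := by
    rw [← map_mul, ← map_mul, ← map_neg]
    congr 1
    simp [fromBlocks_multiply, fromBlocks_neg]
  J_comm A := by
    simp only [StarAlgHom.comp_apply]
    change _ * toEuclideanCLM (𝕜 := ℂ) (doubled X k A) = toEuclideanCLM (𝕜 := ℂ) (doubled X k A) * _
    rw [← map_mul, ← map_mul]
    congr 1
    simp [fromBlocks_multiply, doubled_apply]
  Γ_comm j A := by
    simp only [StarAlgHom.comp_apply]
    change _ * toEuclideanCLM (𝕜 := ℂ) (doubled X k A) = toEuclideanCLM (𝕜 := ℂ) (doubled X k A) * _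
    rw [← map_mul, ← map_mul]
    congr 1
    simp [fromBlocks_multiply, doubled_apply, ← mul_kronecker_mul]

theorem toEuclideanCLM_locMat {γ : Fin (d - 1) → Matrix (Fin k) (Fin k) ℂ}
    (hγ : IsIrredCliffordRep γ) (c : X → ℝ) (s : Fin d → X → ℝ) (h : Matrix X X ℂ) :
    toEuclideanCLM (𝕜 := ℂ) (locMat (gammaHat γ) c s h) = (concreteFrame X hγ).loc c s h := by
  have h1 : locMat (gammaHat γ) c s h
      = fromBlocks 1 0 0 (-1) * (doubled X k (diagonal fun x => (c x : ℂ)) - doubled X k h)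
        + ∑ j, doubled X k (diagonal fun x => (s j x : ℂ))
          * fromBlocks 0 ((1 : Matrix X X ℂ) ⊗ₖ (gammaHat γ j)ᴴ)
            ((1 : Matrix X X ℂ) ⊗ₖ gammaHat γ j) 0 := by
    have hsum : ∀ (B D : Fin d → Matrix (X × Fin k) (X × Fin k) ℂ) (S : Finset (Fin d)),
        ∑ j ∈ S, fromBlocks 0 (B j) (D j) 0 = fromBlocks 0 (∑ j ∈ S, B j) (∑ j ∈ S, D j) 0 := by
      intro B D S
      induction S using Finset.induction_on with
      | empty => simp
      | insert a S ha ih => rw [Finset.sum_insert ha, ih, fromBlocks_add,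
          Finset.sum_insert ha, Finset.sum_insert ha]; simp
    simp only [doubled_apply, fromBlocks_multiply, ← mul_kronecker_mul, mul_zero, zero_mul,
      zero_add, add_zero, mul_one, one_mul, sub_eq_add_neg, fromBlocks_neg, fromBlocks_add,
      hsum, locMat, neg_zero, neg_mul]
    congr 2
    · rw [add_kronecker, neg_kronecker_eq]
    · rw [add_kronecker, neg_kronecker_eq]
  rw [h1, map_add, map_mul, map_sub, map_sum]
  simp only [map_mul]
  rfl

theorem perLocalizer_eq_locMat {L : ℕ} (H : Hilb d L →L[ℂ] Hilb d L)
    (γ : Fin (d - 1) → Matrix (Fin k) (Fin k) ℂ) (η : ℝ) (ρ : ℕ) :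
    perLocalizer H γ η ρ
      = locMat (gammaHat γ)
        (∑ j, fun u : Torus d ρ × Fin L => 1 - Real.cos (Real.pi / ρ * (u.1.coord j : ℝ)))
        (fun j u => Real.sin (Real.pi / ρ * (u.1.coord j : ℝ)))
        (((1 / η : ℝ) : ℂ) • perHam H ρ) := by
  have h1 : (diagonal fun x : Torus d ρ × Fin L =>
      (((∑ j, fun u : Torus d ρ × Fin L => 1 - Real.cos (Real.pi / ρ * (u.1.coord j : ℝ))) x : ℝ)
        : ℂ)) = ∑ j : Fin d, (1 - cosX L ρ j) := by
    ext u v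
    rw [Matrix.sum_apply]
    by_cases huv : u = v
    · subst huv
      simp [cosX, Finset.sum_apply]
    · simp [cosX, huv]
  unfold perLocalizer locMat
  rw [h1, fromBlocks_smul, fromBlocks_add, smul_zero, add_zero, add_zero, sub_eq_add_neg,
    add_kronecker, neg_kronecker_eq, smul_kronecker, smul_neg, neg_add, neg_neg]
  rfl

end Concrete

end PeriodicLocalizer

namespace PeriodicLocalizer

open Matrix Topology

/-! ### Finite-range operators on the lattice and their commutators with position. -/

section InfiniteVolume

variable {d L : ℕ}

/-- The points at sup-distance at most `m` from `x`. -/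
noncomputable def cube (m : ℕ) (x : Fin d → ℤ) : Finset (Fin d → ℤ) :=
  Fintype.piFinset fun j => Finset.Icc (x j - m) (x j + m)

theorem mem_cube {m : ℕ} {x y : Fin d → ℤ} : y ∈ cube m x ↔ ∀ j, |x j - y j| ≤ m := by
  simp only [cube, Fintype.mem_piFinset, Finset.mem_Icc, abs_le]
  refine forall_congr' fun j => ?_
  constructor <;> rintro ⟨h1, h2⟩ <;> constructor <;> linarith

theorem mem_cube_comm {m : ℕ} {x y : Fin d → ℤ} : y ∈ cube m x ↔ x ∈ cube m y := by
  simp only [mem_cube, abs_sub_comm]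

theorem apply_single_eq (H : Hilb d L →L[ℂ] Hilb d L) (x y : Fin d → ℤ)
    (v : EuclideanSpace ℂ (Fin L)) :
    H (lp.single 2 y v) x = WithLp.toLp 2 (kernel H x y *ᵥ v.ofLp) := by
  have hv : v = ∑ b, v b • EuclideanSpace.single b (1 : ℂ) := by
    ext a
    simp [Finset.sum_apply, Pi.single_apply]
  have h1 : lp.single 2 y v
      = ∑ b, v b • (lp.single 2 y (EuclideanSpace.single b (1 : ℂ)) : Hilb d L) := by
    conv_lhs => rw [hv]
    rw [← lp.singleAddMonoidHom_apply, map_sum]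
    simp [lp.single_smul]
  rw [h1, map_sum]
  ext a
  simp only [map_smul, lp.coeFn_sum, Finset.sum_apply, lp.coeFn_smul, Pi.smul_apply,
    WithLp.ofLp_sum, WithLp.ofLp_smul, mulVec, dotProduct, kernel, of_apply, smul_eq_mul]
  exact Finset.sum_congr rfl fun b _ => mul_comm _ _

variable {H : Hilb d L →L[ℂ] Hilb d L} {R : ℝ}

theorem HasFiniteRange.kernel_eq_zero (hR : HasFiniteRange H R) {x y : Fin d → ℤ} {j : Fin d}
    (h : R < |(x j : ℝ) - y j|) : kernel H x y = 0 := by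
  refine hR x y (h.trans_le (Real.abs_le_sqrt ?_))
  exact Finset.single_le_sum (f := fun j => ((x j : ℝ) - (y j : ℝ)) ^ 2)
    (fun i _ => sq_nonneg _) (Finset.mem_univ j)

theorem HasFiniteRange.kernel_eq_zero_of_notMem (hR : HasFiniteRange H R) {m : ℕ} (hm : R ≤ m)
    {x y : Fin d → ℤ} (h : y ∉ cube m x) : kernel H x y = 0 := by
  simp only [mem_cube, not_forall, not_le] at h
  obtain ⟨j, hj⟩ := h
  refine hR.kernel_eq_zero (j := j) (hm.trans_lt ?_)
  exact_mod_cast hj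

theorem HasFiniteRange.apply_single_eq_zero (hR : HasFiniteRange H R) {m : ℕ} (hm : R ≤ m)
    {x y : Fin d → ℤ} (h : y ∉ cube m x) (v : EuclideanSpace ℂ (Fin L)) :
    H (lp.single 2 y v) x = 0 := by
  rw [apply_single_eq, hR.kernel_eq_zero_of_notMem hm h]
  simp

theorem hasSum_apply (H : Hilb d L →L[ℂ] Hilb d L) (ψ : Hilb d L) (x : Fin d → ℤ) :
    HasSum (fun y => H (lp.single 2 y (ψ y)) x) (H ψ x) :=
  ((lp.evalCLM ℂ (fun _ : Fin d → ℤ => EuclideanSpace ℂ (Fin L)) 2 x).comp H).hasSum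
    (lp.hasSum_single (by norm_num) ψ)

theorem HasFiniteRange.apply_eq_sum (hR : HasFiniteRange H R) {m : ℕ} (hm : R ≤ m)
    (ψ : Hilb d L) (x : Fin d → ℤ) :
    H ψ x = ∑ y ∈ cube m x, H (lp.single 2 y (ψ y)) x :=
  (hasSum_apply H ψ x).unique (hasSum_sum_of_ne_finset_zero fun _ hy =>
    hR.apply_single_eq_zero hm hy _)

theorem apply_eq_sum_support (H : Hilb d L →L[ℂ] Hilb d L) {ψ : Hilb d L}
    {S : Finset (Fin d → ℤ)} (hS : ∀ y ∉ S, ψ y = 0) (x : Fin d → ℤ) :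
    H ψ x = ∑ y ∈ S, H (lp.single 2 y (ψ y)) x :=
  (hasSum_apply H ψ x).unique (hasSum_sum_of_ne_finset_zero fun _ hy => by
    rw [hS _ hy, lp.single_zero, map_zero]; rfl)

/-- A Schur-type bound: Cauchy–Schwarz over the cube, after which the sum for each fixed offset is a
translate bounded by `‖ψ‖²`. -/
theorem norm_le_of_norm_apply_le_sum_cube {f ψ : Hilb d L} {K : ℝ} (hK : 0 ≤ K) (m : ℕ)
    (h : ∀ x, ‖f x‖ ≤ K * ∑ y ∈ cube m x, ‖ψ y‖) :
    ‖f‖ ≤ K * (cube (d := d) m 0).card * ‖ψ‖ := by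
  refine lp.norm_le_of_forall_sum_le (by norm_num) (by positivity) fun S => ?_
  simp only [ENNReal.toReal_ofNat, Real.rpow_ofNat]
  have hcube : ∀ x, ∑ y ∈ cube m x, ‖ψ y‖ = ∑ c ∈ cube m 0, ‖ψ (x + c)‖ := by
    intro x
    refine Finset.sum_bij' (fun y _ => y - x) (fun c _ => x + c) ?_ ?_ ?_ ?_ ?_
    · intro y hy
      simp only [mem_cube, Pi.sub_apply, Pi.zero_apply] at hy ⊢
      intro j
      rw [zero_sub, neg_sub]; exact hy j
    · intro c hc
      simp only [mem_cube, Pi.add_apply, Pi.zero_apply, zero_sub, abs_neg] at hc ⊢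
      intro j
      rw [sub_add_cancel_left, abs_neg]; exact hc j
    · intro y _; simp
    · intro c _; simp
    · intro y _; simp
  have h1 : ∀ x, ‖f x‖ ^ 2 ≤ K ^ 2 * ((cube (d := d) m 0).card
      * ∑ c ∈ cube m 0, ‖ψ (x + c)‖ ^ 2) := by
    intro x
    refine (pow_le_pow_left₀ (norm_nonneg _) (h x) 2).trans ?_
    rw [mul_pow, hcube]
    exact mul_le_mul_of_nonneg_left sq_sum_le_card_mul_sum_sq (sq_nonneg _)
  refine (Finset.sum_le_sum fun x _ => h1 x).trans ?_
  rw [← Finset.mul_sum, ← Finset.mul_sum, Finset.sum_comm]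
  have h2 : ∀ c ∈ cube m (0 : Fin d → ℤ), ∑ x ∈ S, ‖ψ (x + c)‖ ^ 2 ≤ ‖ψ‖ ^ 2 := by
    intro c _
    have := lp.sum_rpow_le_norm_rpow (by norm_num) ψ (S.map (addRightEmbedding c))
    simp only [ENNReal.toReal_ofNat, Real.rpow_ofNat, Finset.sum_map] at this
    exact this
  refine (mul_le_mul_of_nonneg_left (mul_le_mul_of_nonneg_left (Finset.sum_le_sum h2)
    (Nat.cast_nonneg _)) (sq_nonneg _)).trans (le_of_eq ?_)
  rw [Finset.sum_const, nsmul_eq_mul]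
  ring

theorem position_apply (j : Fin d) (ψ : (position L j).domain) (x : Fin d → ℤ) :
    (position L j ψ) x = ((x j : ℤ) : ℂ) • (ψ : Hilb d L) x := rfl

/-- A crude bound showing that the set whose supremum is `commutatorNorm` is bounded above; the real
`sSup` of an unbounded set is zero and would carry no information. -/
theorem HasFiniteRange.norm_commutator_le (hR : HasFiniteRange H R) {m : ℕ} (hm : R ≤ m)
    (j : Fin d) (ψ : (position L j).domain) (h : H (ψ : Hilb d L) ∈ (position L j).domain) :
    ‖position L j ⟨H (ψ : Hilb d L), h⟩ - H (position L j ψ)‖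
      ≤ m * ‖H‖ * (cube (d := d) m 0).card * ‖(ψ : Hilb d L)‖ := by
  refine norm_le_of_norm_apply_le_sum_cube (by positivity) m fun x => ?_
  have h1 : (position L j ⟨H (ψ : Hilb d L), h⟩ - H (position L j ψ)) x
      = ∑ y ∈ cube m x, ((x j : ℂ) - y j) • H (lp.single 2 y ((ψ : Hilb d L) y)) x := by
    rw [lp.coeFn_sub, Pi.sub_apply, position_apply, hR.apply_eq_sum hm (position L j ψ)]
    simp only [position_apply, sub_smul, lp.single_smul, map_smul, lp.coeFn_smul, Pi.smul_apply]
    rw [hR.apply_eq_sum hm (ψ : Hilb d L), Finset.smul_sum, ← Finset.sum_sub_distrib]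
  rw [h1, Finset.mul_sum]
  refine (norm_sum_le _ _).trans (Finset.sum_le_sum fun y hy => ?_)
  rw [norm_smul, mul_assoc]
  refine mul_le_mul ?_ ?_ (norm_nonneg _) (Nat.cast_nonneg _)
  · have := mem_cube.mp hy j
    rw [← Int.cast_sub, Complex.norm_intCast]
    exact_mod_cast this
  · refine (lp.norm_apply_le_norm (by norm_num) _ x).trans ((H.le_opNorm _).trans (le_of_eq ?_))
    rw [lp.norm_single (by norm_num)]

theorem HasFiniteRange.norm_commutator_le_maxCommutator (hR : HasFiniteRange H R)
    (j : Fin d) (ψ : (position L j).domain) (h : H (ψ : Hilb d L) ∈ (position L j).domain) :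
    ‖position L j ⟨H (ψ : Hilb d L), h⟩ - H (position L j ψ)‖
      ≤ maxCommutator H * ‖(ψ : Hilb d L)‖ := by
  obtain ⟨m, hm⟩ := exists_nat_ge R
  have hle : commutatorNorm H j ≤ maxCommutator H :=
    le_ciSup (Set.finite_range fun j : Fin d => commutatorNorm H j).bddAbove j
  by_cases h0 : (ψ : Hilb d L) = 0
  · have := hR.norm_commutator_le hm j ψ h
    have h00 : ‖(ψ : Hilb d L)‖ = 0 := by rw [h0, norm_zero]
    rwa [h00, mul_zero] at this ⊢
  have hn : 0 < ‖(ψ : Hilb d L)‖ := norm_pos_iff.mpr h0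
  set c : ℂ := ((‖(ψ : Hilb d L)‖⁻¹ : ℝ) : ℂ) with hc
  have hcn : ‖c‖ = ‖(ψ : Hilb d L)‖⁻¹ := by
    rw [hc, Complex.norm_real, Real.norm_of_nonneg (by positivity)]
  have hmem : H ((c • ψ : (position L j).domain) : Hilb d L) ∈ (position L j).domain := by
    rw [Submodule.coe_smul, map_smul]
    exact Submodule.smul_mem _ _ h
  have key : ‖position L j ⟨H ((c • ψ : (position L j).domain) : Hilb d L), hmem⟩
      - H (position L j (c • ψ))‖ ≤ commutatorNorm H j := by
    refine le_csSup ⟨m * ‖H‖ * (cube (d := d) m 0).card, ?_⟩ ⟨c • ψ, hmem, ?_, rfl⟩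
    · rintro r ⟨φ, hφ, hφ1, rfl⟩
      refine (hR.norm_commutator_le hm j φ hφ).trans ?_
      exact mul_le_of_le_one_right (by positivity) hφ1
    · rw [Submodule.coe_smul, norm_smul, hcn, inv_mul_cancel₀ hn.ne']
  have h2 : position L j ⟨H ((c • ψ : (position L j).domain) : Hilb d L), hmem⟩
      - H (position L j (c • ψ))
      = c • (position L j ⟨H (ψ : Hilb d L), h⟩ - H (position L j ψ)) := by
    rw [smul_sub, LinearPMap.map_smul, map_smul H]
    congr 1
    refine lp.ext (funext fun x => ?_)
    rw [lp.coeFn_smul, Pi.smul_apply, position_apply, position_apply, smul_comm]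
    simp
  rw [h2, norm_smul, hcn, inv_mul_le_iff₀ hn] at key
  rw [mul_comm]
  exact key.trans (mul_le_mul_of_nonneg_left hle hn.le)

/-- Multiplication by the phase `e^{iθ}` on `ℓ²(ℤ^d, ℂ^L)`. -/
noncomputable def modulate (L : ℕ) (θ : (Fin d → ℤ) → ℝ) : Hilb d L →ₗᵢ[ℂ] Hilb d L where
  toFun ψ := ⟨fun x => Complex.exp (θ x * Complex.I) • ψ x,
    (lp.memℓp ψ).mono' fun x => by rw [norm_smul, Complex.norm_exp_ofReal_mul_I, one_mul]⟩
  map_add' ψ φ := by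
    ext x a
    exact mul_add _ _ _
  map_smul' c ψ := by
    ext x a
    exact mul_left_comm _ _ _
  norm_map' ψ := by
    refine le_antisymm ?_ ?_
    · refine lp.norm_mono (by norm_num) fun x => ?_
      exact le_of_eq ((norm_smul _ _).trans (by rw [Complex.norm_exp_ofReal_mul_I, one_mul]))
    · refine lp.norm_mono (by norm_num) fun x => ?_
      exact le_of_eq (((norm_smul _ _).trans (by rw [Complex.norm_exp_ofReal_mul_I, one_mul])).symm)

theorem modulate_apply (θ : (Fin d → ℤ) → ℝ) (ψ : Hilb d L) (x : Fin d → ℤ) :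
    modulate L θ ψ x = Complex.exp (θ x * Complex.I) • ψ x := rfl

theorem mem_position_domain_of_finite (j : Fin d) {ψ : Hilb d L} {S : Finset (Fin d → ℤ)}
    (hS : ∀ y ∉ S, ψ y = 0) : ψ ∈ (position L j).domain := by
  refine (memℓp_zero (S.finite_toSet.subset fun x hx => ?_)).of_exponent_ge zero_le
  by_contra hxS
  exact hx (by simp [hS x hxS])

end InfiniteVolume

end PeriodicLocalizer

namespace PeriodicLocalizer

open Matrix Topology

/-! ### From the position commutator to the commutator with phases. -/

section CommutatorBound

variable {d L : ℕ} {H : Hilb d L →L[ℂ] Hilb d L} {R : ℝ}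

theorem HasFiniteRange.apply_eq_zero_of_notMem (hR : HasFiniteRange H R) {m : ℕ} (hm : R ≤ m)
    {ψ : Hilb d L} {S : Finset (Fin d → ℤ)} (hS : ∀ y ∉ S, ψ y = 0) {x : Fin d → ℤ}
    (hx : x ∉ S.biUnion (cube m)) : H ψ x = 0 := by
  rw [apply_eq_sum_support H hS]
  refine Finset.sum_eq_zero fun y hy => hR.apply_single_eq_zero hm (fun h => hx ?_) _
  exact Finset.mem_biUnion.mpr ⟨y, hy, mem_cube_comm.mp h⟩

theorem modulate_apply_eq_zero (θ : (Fin d → ℤ) → ℝ) {ψ : Hilb d L} {y : Fin d → ℤ}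
    (h : ψ y = 0) : modulate L θ ψ y = 0 := by
  rw [modulate_apply, h, smul_zero]

theorem sum_smul_single_apply (S T : Finset (Fin d → ℤ)) (f : (Fin d → ℤ) → (Fin d → ℤ) → ℂ)
    (w : (Fin d → ℤ) → (Fin d → ℤ) → EuclideanSpace ℂ (Fin L)) (x : Fin d → ℤ) :
    (∑ y ∈ S, ∑ z ∈ T, f y z • (lp.single 2 z (w y z) : Hilb d L)) x
      = if x ∈ T then ∑ y ∈ S, f y x • w y x else 0 := by
  simp only [lp.coeFn_sum, Finset.sum_apply, lp.coeFn_smul, Pi.smul_apply, lp.single_apply]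
  split_ifs with hx
  · refine Finset.sum_congr rfl fun y _ => ?_
    rw [Finset.sum_eq_single_of_mem x hx fun z _ hz => by
      rw [Pi.single_eq_of_ne hz.symm, smul_zero], Pi.single_eq_same]
  · refine Finset.sum_eq_zero fun y _ => Finset.sum_eq_zero fun z hz => ?_
    rw [Pi.single_eq_of_ne (fun h : x = z => hx (by rw [h]; exact hz)), smul_zero]

/-- The commutator of `e^{i s X_j}` with `H` is bounded by `s ‖[X_j, H]‖`. -/
theorem HasFiniteRange.norm_modulate_comm_le (hR : HasFiniteRange H R) (j : Fin d)
    {ψ : Hilb d L} {S : Finset (Fin d → ℤ)} (hS : ∀ y ∉ S, ψ y = 0) {s : ℝ} (hs : 0 ≤ s) :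
    ‖modulate L (fun x => s * x j) (H ψ) - H (modulate L (fun x => s * x j) ψ)‖
      ≤ s * maxCommutator H * ‖ψ‖ := by
  obtain ⟨m, hm⟩ := exists_nat_ge R
  set T := S.biUnion (cube m) with hT
  let w : (Fin d → ℤ) → (Fin d → ℤ) → EuclideanSpace ℂ (Fin L) :=
    fun y x => H (lp.single 2 y (ψ y)) x
  let f : ℝ → (Fin d → ℤ) → (Fin d → ℤ) → ℂ :=
    fun t y x => Complex.exp ((t : ℂ) * (((y j : ℂ) - x j) * Complex.I))
  -- This is `U_t* H U_t ψ`, written as a finite sum so that it can be differentiated term by term.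
  -- Its derivative is `-i U_t* [X_j, H] U_t ψ`, of norm at most `M ‖ψ‖`, and the mean value
  -- inequality between `0` and `s` gives the claim.
  let F : ℝ → Hilb d L := fun t => ∑ y ∈ S, ∑ x ∈ T, f t y x • (lp.single 2 x (w y x) : Hilb d L)
  let F' : ℝ → Hilb d L := fun t => ∑ y ∈ S, ∑ x ∈ T,
    (f t y x * (((y j : ℂ) - x j) * Complex.I)) • (lp.single 2 x (w y x) : Hilb d L)
  let U : ℝ → Hilb d L →ₗᵢ[ℂ] Hilb d L := fun t => modulate L (fun x => t * x j)
  have hfU : ∀ (t : ℝ) (x y : Fin d → ℤ), Complex.exp (((t * x j : ℝ) : ℂ) * Complex.I) * f t y x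
      = Complex.exp (((t * y j : ℝ) : ℂ) * Complex.I) := by
    intro t x y
    rw [← Complex.exp_add]
    congr 1
    push_cast
    ring
  have hUS : ∀ t, ∀ y ∉ S, U t ψ y = 0 := fun t y hy => modulate_apply_eq_zero _ (hS y hy)
  have hUF : ∀ t, U t (F t) = H (U t ψ) := by
    intro t
    refine lp.ext (funext fun x => ?_)
    rw [modulate_apply, sum_smul_single_apply]
    split_ifs with hx
    · rw [apply_eq_sum_support H (hUS t), Finset.smul_sum]
      refine Finset.sum_congr rfl fun y _ => ?_
      rw [smul_smul, hfU, modulate_apply, lp.single_smul, map_smul]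
      rfl
    · rw [smul_zero, hR.apply_eq_zero_of_notMem hm (hUS t) hx]
  have hderiv : ∀ t, HasDerivAt F (F' t) t := by
    intro t
    refine HasDerivAt.fun_sum fun y _ => HasDerivAt.fun_sum fun x _ => ?_
    have h1 : HasDerivAt (fun t : ℝ => f t y x) (f t y x * (((y j : ℂ) - x j) * Complex.I)) t := by
      have h2 := ((Complex.ofRealCLM.hasDerivAt (x := t)).mul_const
        (((y j : ℂ) - x j) * Complex.I)).cexp
      simpa using h2
    exact h1.smul_const _
  have hbound : ∀ t, ‖F' t‖ ≤ maxCommutator H * ‖ψ‖ := by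
    intro t
    have hφ := mem_position_domain_of_finite j (hUS t)
    have hHφ := mem_position_domain_of_finite j (S := T) (ψ := H (U t ψ))
      fun x hx => hR.apply_eq_zero_of_notMem hm (hUS t) hx
    have h1 := hR.norm_commutator_le_maxCommutator j ⟨U t ψ, hφ⟩ hHφ
    have h2 : U t (F' t) = (-Complex.I) • (position L j ⟨H (U t ψ), hHφ⟩
        - H (position L j ⟨U t ψ, hφ⟩)) := by
      refine lp.ext (funext fun x => ?_)
      have hXS : ∀ y ∉ S, position L j ⟨U t ψ, hφ⟩ y = 0 := fun y hy => by
        rw [position_apply]; simp [hUS t y hy]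
      rw [modulate_apply, sum_smul_single_apply, lp.coeFn_smul, Pi.smul_apply, lp.coeFn_sub,
        Pi.sub_apply, position_apply]
      simp only
      split_ifs with hx
      · rw [apply_eq_sum_support H (hUS t), apply_eq_sum_support H hXS, Finset.smul_sum,
          Finset.smul_sum, ← Finset.sum_sub_distrib, Finset.smul_sum]
        refine Finset.sum_congr rfl fun y _ => ?_
        rw [position_apply, smul_smul, ← mul_assoc, hfU, lp.single_smul, map_smul]
        simp only
        rw [modulate_apply, lp.single_smul, map_smul]
        simp only [lp.coeFn_smul, Pi.smul_apply]
        rw [smul_smul, smul_smul, ← sub_smul, smul_smul]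
        congr 1
        push_cast
        ring
      · rw [hR.apply_eq_zero_of_notMem hm (hUS t) hx, hR.apply_eq_zero_of_notMem hm hXS hx]
        simp
    have h3 := congrArg norm h2
    rw [(U t).norm_map, norm_smul, norm_neg, Complex.norm_I, one_mul] at h3
    rw [h3]
    refine h1.trans (le_of_eq ?_)
    rw [(U t).norm_map]
  have hmv := norm_image_sub_le_of_norm_deriv_le_segment' (a := 0) (b := s)
    (fun t _ => (hderiv t).hasDerivWithinAt) (fun t _ => hbound t) s ⟨hs, le_rfl⟩
  have hF0 : F 0 = H ψ := by
    have hU0 : ∀ φ, U 0 φ = φ := fun φ => lp.ext (funext fun x => by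
      rw [modulate_apply]; simp)
    have := hUF 0
    rwa [hU0, hU0] at this
  change ‖U s (H ψ) - H (U s ψ)‖ ≤ _
  rw [← hUF, ← hF0, ← map_sub, (U s).norm_map, norm_sub_rev]
  linarith

end CommutatorBound

end PeriodicLocalizer

namespace PeriodicLocalizer

open Matrix Topology
open scoped Matrix.Norms.L2Operator

/-! ### Cells of the lattice over the torus, and periodic extension. -/

section Cells

variable {d L ρ : ℕ}

/-- The point of `ℤ^d` lying over `u` in the cell with index `a`. -/
def cell (u : Torus d ρ) (a : Fin d → ℤ) : Fin d → ℤ := u.coord + (2 * (ρ : ℤ)) • a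

theorem cell_apply (u : Torus d ρ) (a : Fin d → ℤ) (j : Fin d) :
    cell u a j = u.coord j + 2 * ρ * a j := by
  simp [cell]

theorem coord_mem (u : Torus d ρ) (j : Fin d) : -(ρ : ℤ) < u.coord j ∧ u.coord j ≤ ρ :=
  Finset.mem_Ioc.mp (u j).2

theorem coord_injective : Function.Injective (Torus.coord (d := d) (ρ := ρ)) := by
  intro u v h
  funext j
  exact Subtype.ext (congrFun h j)

theorem cell_inj (hρ : 0 < ρ) {u v : Torus d ρ} {a b : Fin d → ℤ} (h : cell u a = cell v b) :
    u = v ∧ a = b := by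
  have hab : a = b := by
    funext j
    have h1 := congrFun h j
    rw [cell_apply, cell_apply] at h1
    have hu := coord_mem u j
    have hv := coord_mem v j
    have hρ' : (0 : ℤ) < ρ := by exact_mod_cast hρ
    by_contra hne
    rcases lt_or_gt_of_ne hne with hlt | hlt
    · nlinarith
    · nlinarith
  subst hab
  exact ⟨coord_injective (add_right_cancel h), rfl⟩

theorem exists_cell (hρ : 0 < ρ) (x : Fin d → ℤ) :
    ∃ (u : Torus d ρ) (a : Fin d → ℤ), cell u a = x := by
  have hρ' : (0 : ℤ) < 2 * ρ := by exact_mod_cast (by omega : 0 < 2 * ρ)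
  have h : ∀ j, ∃ c : ℤ, x j - 2 * ρ * c ∈ Finset.Ioc (-(ρ : ℤ)) ρ := by
    intro j
    -- The shift by `ρ - 1` makes the remainders run through `-ρ + 1, …, ρ`.
    refine ⟨(x j + ρ - 1) / (2 * ρ), ?_⟩
    have h1 := Int.emod_add_mul_ediv (x j + ρ - 1) (2 * ρ)
    have h2 := Int.emod_nonneg (x j + ρ - 1) hρ'.ne'
    have h3 := Int.emod_lt_of_pos (x j + ρ - 1) hρ'
    rw [Finset.mem_Ioc]
    constructor <;> linarith
  choose c hc using h
  refine ⟨fun j => ⟨_, hc j⟩, c, funext fun j => ?_⟩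
  rw [cell_apply]
  simp [Torus.coord]

/-- The points in the cells with index in `Q`. -/
noncomputable def cells (ρ : ℕ) (Q : Finset (Fin d → ℤ)) : Finset (Fin d → ℤ) := by
  classical
  exact (Q ×ˢ (Finset.univ : Finset (Torus d ρ))).image fun q => cell q.2 q.1

theorem cell_mem_cells (hρ : 0 < ρ) {Q : Finset (Fin d → ℤ)} {u : Torus d ρ} {a : Fin d → ℤ} :
    cell u a ∈ cells ρ Q ↔ a ∈ Q := by
  classical
  simp only [cells, Finset.mem_image, Finset.mem_product, Finset.mem_univ, and_true]
  constructor
  · rintro ⟨⟨b, v⟩, hb, h⟩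
    rwa [← (cell_inj hρ h).2]
  · intro h
    exact ⟨⟨a, u⟩, h, rfl⟩

theorem sum_cells (hρ : 0 < ρ) {α : Type*} [AddCommMonoid α] (Q : Finset (Fin d → ℤ))
    (f : (Fin d → ℤ) → α) :
    ∑ x ∈ cells ρ Q, f x = ∑ a ∈ Q, ∑ u : Torus d ρ, f (cell u a) := by
  classical
  rw [cells, Finset.sum_image, Finset.sum_product]
  rintro ⟨a, u⟩ _ ⟨b, v⟩ _ h
  obtain ⟨h1, h2⟩ := cell_inj hρ h
  exact Prod.ext h2 h1

theorem norm_sq_eq_sum_cells (hρ : 0 < ρ) {Q : Finset (Fin d → ℤ)} {φ : Hilb d L}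
    (hφ : ∀ x ∉ cells ρ Q, φ x = 0) :
    ‖φ‖ ^ 2 = ∑ a ∈ Q, ∑ u : Torus d ρ, ‖φ (cell u a)‖ ^ 2 := by
  have h1 : φ = ∑ x ∈ cells ρ Q, lp.single 2 x (φ x) :=
    (lp.hasSum_single (by norm_num) φ).unique (hasSum_sum_of_ne_finset_zero fun _ hx => by
      rw [hφ _ hx, lp.single_zero])
  have h2 := lp.norm_sum_single (p := 2) (by norm_num) (fun x => φ x) (cells ρ Q)
  rw [← h1] at h2
  simp only [ENNReal.toReal_ofNat, Real.rpow_ofNat] at h2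
  rw [h2, sum_cells hρ]

/-- The component of `ψ` at the site `u`. -/
noncomputable def fiber (ψ : EuclideanSpace ℂ (Torus d ρ × Fin L)) (u : Torus d ρ) :
    EuclideanSpace ℂ (Fin L) := WithLp.toLp 2 fun b => ψ (u, b)

theorem norm_sq_eq_sum_fiber (ψ : EuclideanSpace ℂ (Torus d ρ × Fin L)) :
    ‖ψ‖ ^ 2 = ∑ u, ‖fiber ψ u‖ ^ 2 := by
  simp only [EuclideanSpace.norm_sq_eq, fiber]
  rw [Fintype.sum_prod_type]

/-- The restriction to the cells in `Q` of the periodic extension of `ψ`. -/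
noncomputable def periodize (Q : Finset (Fin d → ℤ))
    (ψ : EuclideanSpace ℂ (Torus d ρ × Fin L)) : Hilb d L :=
  ∑ a ∈ Q, ∑ u : Torus d ρ, lp.single 2 (cell u a) (fiber ψ u)

open Classical in
theorem periodize_apply (hρ : 0 < ρ) (Q : Finset (Fin d → ℤ))
    (ψ : EuclideanSpace ℂ (Torus d ρ × Fin L)) (u : Torus d ρ) (a : Fin d → ℤ) :
    periodize Q ψ (cell u a) = if a ∈ Q then fiber ψ u else 0 := by
  simp only [periodize, lp.coeFn_sum, Finset.sum_apply]
  have h0 : ∀ (b : Fin d → ℤ) (v : Torus d ρ), (b ≠ a ∨ v ≠ u) →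
      (lp.single 2 (cell v b) (fiber ψ v) : Hilb d L) (cell u a) = 0 := by
    intro b v h
    refine lp.single_apply_ne _ _ _ (fun h' => ?_)
    obtain ⟨h1, h2⟩ := cell_inj hρ h'
    rcases h with h | h
    · exact h h2.symm
    · exact h h1.symm
  split_ifs with ha
  · rw [Finset.sum_eq_single_of_mem a ha fun b _ hb => Finset.sum_eq_zero fun v _ =>
      h0 b v (Or.inl hb), Finset.sum_eq_single_of_mem u (Finset.mem_univ _) fun v _ hv =>
      h0 a v (Or.inr hv), lp.single_apply_self]
  · exact Finset.sum_eq_zero fun b hb => Finset.sum_eq_zero fun v _ =>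
      h0 b v (Or.inl fun h => ha (h ▸ hb))

theorem periodize_eq_zero (hρ : 0 < ρ) {Q : Finset (Fin d → ℤ)}
    (ψ : EuclideanSpace ℂ (Torus d ρ × Fin L)) : ∀ x ∉ cells ρ Q, periodize Q ψ x = 0 := by
  intro x hx
  obtain ⟨u, a, rfl⟩ := exists_cell hρ x
  rw [cell_mem_cells hρ] at hx
  rw [periodize_apply hρ, if_neg hx]

theorem norm_periodize_sq (hρ : 0 < ρ) (Q : Finset (Fin d → ℤ))
    (ψ : EuclideanSpace ℂ (Torus d ρ × Fin L)) :
    ‖periodize Q ψ‖ ^ 2 = Q.card * ‖ψ‖ ^ 2 := by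
  rw [norm_sq_eq_sum_cells hρ (periodize_eq_zero hρ ψ), norm_sq_eq_sum_fiber]
  rw [Finset.sum_congr rfl fun a ha => Finset.sum_congr rfl fun u _ => by
    rw [periodize_apply hρ, if_pos ha]]
  simp

theorem norm_periodize (hρ : 0 < ρ) (Q : Finset (Fin d → ℤ))
    (ψ : EuclideanSpace ℂ (Torus d ρ × Fin L)) :
    ‖periodize Q ψ‖ = √Q.card * ‖ψ‖ := by
  rw [← Real.sqrt_sq (norm_nonneg (periodize Q ψ)), norm_periodize_sq hρ,
    Real.sqrt_mul (Nat.cast_nonneg _), Real.sqrt_sq (norm_nonneg _)]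

theorem periodize_sub (hρ : 0 < ρ) (Q : Finset (Fin d → ℤ))
    (ψ φ : EuclideanSpace ℂ (Torus d ρ × Fin L)) :
    periodize Q (ψ - φ) = periodize Q ψ - periodize Q φ := by
  refine lp.ext (funext fun x => ?_)
  obtain ⟨u, a, rfl⟩ := exists_cell hρ x
  rw [lp.coeFn_sub, Pi.sub_apply, periodize_apply hρ, periodize_apply hρ, periodize_apply hρ]
  split_ifs
  · rfl
  · simp

variable {H : Hilb d L →L[ℂ] Hilb d L} {R : ℝ} {p : Fin d → ℕ}

theorem apply_single_cell (hp : IsPeriodic H p) (hdvd : ∀ j, p j ∣ 2 * ρ) (u v : Torus d ρ)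
    (a b : Fin d → ℤ) (w : EuclideanSpace ℂ (Fin L)) :
    H (lp.single 2 (cell v b) w) (cell u a) = H (lp.single 2 (cell v (b - a)) w) u.coord := by
  rw [apply_single_eq, apply_single_eq, ← hp.shift hdvd a u.coord]
  congr 3
  simp only [cell, smul_sub]
  abel

/-- Representatives differ by less than `2 ρ` in each coordinate, so a cell index beyond `m + 1`
separates the points by more than `m`. Hence the `finsum` in `perHam` has finite support and does
not take its default value zero. -/
theorem kernel_cell_eq_zero (hρ : 0 < ρ) (hR : HasFiniteRange H R) {m : ℕ} (hm : R ≤ m)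
    (u v : Torus d ρ) {c : Fin d → ℤ} (hc : c ∉ cube (m + 1) 0) :
    kernel H u.coord (cell v c) = 0 := by
  refine hR.kernel_eq_zero_of_notMem hm fun h => hc ?_
  rw [mem_cube] at h ⊢
  intro j
  have h1 := h j
  rw [cell_apply] at h1
  have hu := coord_mem u j
  have hv := coord_mem v j
  have hρ' : (1 : ℤ) ≤ ρ := by exact_mod_cast hρ
  simp only [Pi.zero_apply, zero_sub, abs_neg]
  push_cast
  rw [abs_le] at h1 ⊢
  constructor
  · by_contra hlt
    push Not at hlt
    nlinarith
  · by_contra hlt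
    push Not at hlt
    nlinarith

theorem fiber_perHam (hρ : 0 < ρ) (hR : HasFiniteRange H R) {m : ℕ} (hm : R ≤ m)
    (ψ : EuclideanSpace ℂ (Torus d ρ × Fin L)) (u : Torus d ρ) :
    fiber (toEuclideanCLM (𝕜 := ℂ) (perHam H ρ) ψ) u
      = ∑ c ∈ cube (m + 1) 0, ∑ v, H (lp.single 2 (cell v c) (fiber ψ v)) u.coord := by
  ext i
  simp only [fiber, ofLp_toEuclideanCLM, mulVec, dotProduct, WithLp.ofLp_sum, Finset.sum_apply,
    apply_single_eq]
  rw [Fintype.sum_prod_type]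
  conv_rhs => rw [Finset.sum_comm]
  refine Finset.sum_congr rfl fun v _ => ?_
  conv_rhs => rw [Finset.sum_comm]
  refine Finset.sum_congr rfl fun b _ => ?_
  rw [← Finset.sum_mul]
  congr 1
  simp only [perHam, of_apply]
  refine finsum_eq_finsetSum_of_support_subset _ fun c hc => ?_
  by_contra hcc
  refine hc ?_
  change kernel H u.coord (cell v c) i b = 0
  rw [kernel_cell_eq_zero hρ hR hm u v hcc]
  rfl

-- By periodicity only the relative cell index `c` matters. The result differs from the extension of
-- `perHam` applied to `ψ` only through the cells `a + c` on the other side of the boundary of `Q`.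
open Classical in
theorem apply_periodize_cell (hρ : 0 < ρ) (hR : HasFiniteRange H R) (hp : IsPeriodic H p)
    (hdvd : ∀ j, p j ∣ 2 * ρ) {m : ℕ} (hm : R ≤ m) (Q : Finset (Fin d → ℤ))
    (ψ : EuclideanSpace ℂ (Torus d ρ × Fin L)) (u : Torus d ρ) (a : Fin d → ℤ) :
    H (periodize Q ψ) (cell u a) = ∑ c ∈ cube (m + 1) 0,
      if a + c ∈ Q then ∑ v, H (lp.single 2 (cell v c) (fiber ψ v)) u.coord else 0 := by
  rw [apply_eq_sum_support H (periodize_eq_zero hρ ψ), sum_cells hρ, ← Finset.sum_filter]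
  rw [Finset.sum_congr rfl fun b hb => Finset.sum_congr rfl fun v _ => by
    rw [periodize_apply hρ, if_pos hb, apply_single_cell hp hdvd]]
  rw [← Finset.sum_filter_of_ne (s := Q) (p := fun b => b - a ∈ cube (m + 1) 0)]
  · refine Finset.sum_bij' (fun b _ => b - a) (fun c _ => a + c) ?_ ?_ ?_ ?_ ?_
    · intro b hb
      rw [Finset.mem_filter] at hb ⊢
      exact ⟨hb.2, by rw [add_sub_cancel]; exact hb.1⟩
    · intro c hc
      rw [Finset.mem_filter] at hc ⊢
      exact ⟨hc.2, by rw [add_sub_cancel_left]; exact hc.1⟩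
    · intro b _; exact add_sub_cancel _ _
    · intro c _; exact add_sub_cancel_left _ _
    · intro b _; rfl
  · intro b _ hne
    by_contra hb
    refine hne (Finset.sum_eq_zero fun v _ => ?_)
    rw [apply_single_eq, kernel_cell_eq_zero hρ hR hm u v hb]
    simp

/-- The cells with indices in `[0, N)^d`. -/
noncomputable def box (d N : ℕ) : Finset (Fin d → ℤ) := Fintype.piFinset fun _ => Finset.Ico 0 (N : ℤ)

theorem card_box (d N : ℕ) : (box d N).card = N ^ d := by
  simp [box]

/-- The cells close to the boundary of `box d N`. -/
noncomputable def shell (d m N : ℕ) : Finset (Fin d → ℤ) := by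
  classical
  exact (Fintype.piFinset fun _ => Finset.Ico (-(m : ℤ)) (N + m)) \
    (Fintype.piFinset fun _ => Finset.Ico (m : ℤ) (N - m))

theorem card_shell {d m N : ℕ} (h : 2 * m ≤ N) :
    ((shell d m N).card : ℝ) = ((N : ℝ) + 2 * m) ^ d - ((N : ℝ) - 2 * m) ^ d := by
  classical
  rw [shell, Finset.card_sdiff_of_subset]
  · rw [Nat.cast_sub]
    · simp only [Fintype.card_piFinset, Int.card_Ico, Finset.prod_const, Finset.card_univ,
        Fintype.card_fin]
      have e1 : ((N : ℤ) + m - -m).toNat = N + 2 * m := by omega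
      have e2 : ((N : ℤ) - m - m).toNat = N - 2 * m := by omega
      rw [e1, e2]
      push_cast [Nat.cast_sub h]
      ring
    · refine Finset.card_le_card (Fintype.piFinset_subset _ _ fun _ => ?_)
      exact Finset.Ico_subset_Ico (by omega) (by omega)
  · refine Fintype.piFinset_subset _ _ fun _ => ?_
    exact Finset.Ico_subset_Ico (by omega) (by omega)

theorem mem_box_iff_of_notMem_shell {m N : ℕ} {a c : Fin d → ℤ} (ha : a ∉ shell d m N)
    (hc : c ∈ cube m 0) : a + c ∈ box d N ↔ a ∈ box d N := by
  classical
  simp only [shell, Finset.mem_sdiff, not_and_not_right, Fintype.mem_piFinset, Finset.mem_Ico]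
    at ha
  simp only [box, Fintype.mem_piFinset, Finset.mem_Ico, Pi.add_apply]
  have hc' : ∀ j, -(m : ℤ) ≤ c j ∧ c j ≤ m := fun j => by
    have := mem_cube.mp hc j
    simpa [abs_le] using this
  constructor
  · intro h
    have h2 := ha fun j => ⟨by linarith [h j, hc' j], by linarith [h j, hc' j]⟩
    exact fun j => ⟨by linarith [h2 j], by linarith [h2 j]⟩
  · intro h
    have h2 := ha fun j => ⟨by linarith [h j], by linarith [h j]⟩
    exact fun j => ⟨by linarith [h2 j, hc' j], by linarith [h2 j, hc' j]⟩

end Cells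

end PeriodicLocalizer

namespace PeriodicLocalizer

open Matrix Topology Filter
open scoped Matrix.Norms.L2Operator

/-! ### Norm, gap and commutators of the periodic Hamiltonian by exhaustion with boxes. -/

section Periodization

variable {d L ρ : ℕ} {H : Hilb d L →L[ℂ] Hilb d L} {R : ℝ} {p : Fin d → ℕ}

/-- Where all neighbouring cells lie on the same side of the box boundary, the two vectors agree.
The difference lives on the shell, and each shell cell contributes an amount bounded independently
of `N`. -/
theorem exists_norm_sq_apply_periodize_sub_le (hρ : 0 < ρ) (hR : HasFiniteRange H R)
    (hp : IsPeriodic H p) (hdvd : ∀ j, p j ∣ 2 * ρ)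
    (ψ : EuclideanSpace ℂ (Torus d ρ × Fin L)) :
    ∃ (m : ℕ) (K : ℝ), ∀ N, ‖H (periodize (box d N) ψ)
      - periodize (box d N) (toEuclideanCLM (𝕜 := ℂ) (perHam H ρ) ψ)‖ ^ 2
        ≤ K * (shell d m N).card := by
  classical
  obtain ⟨m, hm⟩ := exists_nat_ge R
  let τ : (Fin d → ℤ) → Torus d ρ → EuclideanSpace ℂ (Fin L) :=
    fun c u => ∑ v, H (lp.single 2 (cell v c) (fiber ψ v)) u.coord
  refine ⟨m + 1, ∑ u : Torus d ρ, (∑ c ∈ cube (m + 1) 0, ‖τ c u‖) ^ 2, fun N => ?_⟩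
  set Q := box d N
  have hval : ∀ (u : Torus d ρ) (a : Fin d → ℤ), (H (periodize Q ψ)
      - periodize Q (toEuclideanCLM (𝕜 := ℂ) (perHam H ρ) ψ)) (cell u a)
      = ∑ c ∈ cube (m + 1) 0, ((if a + c ∈ Q then τ c u else 0) - if a ∈ Q then τ c u else 0) := by
    intro u a
    rw [lp.coeFn_sub, Pi.sub_apply, apply_periodize_cell hρ hR hp hdvd hm, periodize_apply hρ,
      fiber_perHam hρ hR hm, Finset.sum_sub_distrib]
    congr 1
    split_ifs
    · rfl
    · simp
  have hzero : ∀ x ∉ cells ρ (shell d (m + 1) N), (H (periodize Q ψ)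
      - periodize Q (toEuclideanCLM (𝕜 := ℂ) (perHam H ρ) ψ)) x = 0 := by
    intro x hx
    obtain ⟨u, a, rfl⟩ := exists_cell hρ x
    rw [cell_mem_cells hρ] at hx
    rw [hval]
    refine Finset.sum_eq_zero fun c hc => ?_
    rw [if_congr (mem_box_iff_of_notMem_shell hx hc) rfl rfl, sub_self]
  rw [norm_sq_eq_sum_cells hρ hzero]
  have hle : ∀ (a : Fin d → ℤ) (u : Torus d ρ), ‖(H (periodize Q ψ)
      - periodize Q (toEuclideanCLM (𝕜 := ℂ) (perHam H ρ) ψ)) (cell u a)‖ ^ 2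
      ≤ (∑ c ∈ cube (m + 1) 0, ‖τ c u‖) ^ 2 := by
    intro a u
    refine pow_le_pow_left₀ (norm_nonneg _) ?_ 2
    rw [hval]
    refine (norm_sum_le _ _).trans (Finset.sum_le_sum fun c _ => ?_)
    split_ifs <;> simp
  refine (Finset.sum_le_sum fun a _ => Finset.sum_le_sum fun u _ => hle a u).trans ?_
  rw [Finset.sum_const, nsmul_eq_mul, mul_comm]

theorem tendsto_card_shell_div (d m : ℕ) :
    Tendsto (fun N : ℕ => ((shell d m N).card : ℝ) / (N : ℝ) ^ d) atTop (𝓝 0) := by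
  have h1 : Tendsto (fun N : ℕ => 2 * (m : ℝ) / (N : ℝ)) atTop (𝓝 0) :=
    tendsto_const_div_atTop_nhds_zero_nat _
  have h2 : Tendsto (fun N : ℕ => (1 + 2 * (m : ℝ) / (N : ℝ)) ^ d - (1 - 2 * (m : ℝ) / (N : ℝ)) ^ d)
      atTop (𝓝 ((1 + 0) ^ d - (1 - 0) ^ d)) :=
    ((h1.const_add 1).pow d).sub ((h1.const_sub 1).pow d)
  simp only [add_zero, sub_zero, sub_self] at h2
  refine h2.congr' ?_
  filter_upwards [eventually_ge_atTop (2 * m), eventually_gt_atTop 0] with N hN hN0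
  have hN' : (N : ℝ) ≠ 0 := by positivity
  rw [card_shell hN, sub_div, ← div_pow, ← div_pow, add_div, sub_div, div_self hN']

theorem eventually_norm_apply_periodize_sub_le (hρ : 0 < ρ) (hR : HasFiniteRange H R)
    (hp : IsPeriodic H p) (hdvd : ∀ j, p j ∣ 2 * ρ)
    (ψ : EuclideanSpace ℂ (Torus d ρ × Fin L)) {ε : ℝ} (hε : 0 < ε) :
    ∀ᶠ N in atTop, ‖H (periodize (box d N) ψ)
      - periodize (box d N) (toEuclideanCLM (𝕜 := ℂ) (perHam H ρ) ψ)‖ ≤ ε * √(box d N).card := by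
  obtain ⟨m, K, hK⟩ := exists_norm_sq_apply_periodize_sub_le hρ hR hp hdvd ψ
  have h1 := (tendsto_card_shell_div d m).const_mul K
  rw [mul_zero] at h1
  filter_upwards [h1.eventually (gt_mem_nhds (pow_pos hε 2)), eventually_gt_atTop 0] with N hN hN0
  have hNd : (0 : ℝ) < (N : ℝ) ^ d := by positivity
  refine abs_le_of_sq_le_sq' ?_ (by positivity) |>.2
  rw [mul_pow, Real.sq_sqrt (Nat.cast_nonneg _), card_box]
  refine (hK N).trans ?_
  rw [← mul_div_assoc, div_lt_iff₀ hNd] at hN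
  push_cast
  exact hN.le

theorem sqrt_card_box_pos {N : ℕ} (hN : 0 < N) : 0 < √((box d N).card : ℝ) := by
  rw [card_box]
  positivity

/-- The periodized vector has norm `√(N^d) ‖ψ‖`, while the boundary error is `o(√(N^d))`; dividing
by `√(N^d)` transfers the bound for `H` to the torus. The gap and the phase commutators are
transferred in the same way. -/
theorem norm_perHam_apply_le (hρ : 0 < ρ) (hR : HasFiniteRange H R)
    (hp : IsPeriodic H p) (hdvd : ∀ j, p j ∣ 2 * ρ)
    (ψ : EuclideanSpace ℂ (Torus d ρ × Fin L)) :
    ‖toEuclideanCLM (𝕜 := ℂ) (perHam H ρ) ψ‖ ≤ ‖H‖ * ‖ψ‖ := by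
  refine le_of_forall_pos_le_add fun ε hε => ?_
  obtain ⟨N, hN, hN0⟩ := ((eventually_norm_apply_periodize_sub_le hρ hR hp hdvd ψ hε).and
    (eventually_gt_atTop 0)).exists
  have hs := sqrt_card_box_pos (d := d) hN0
  have h1 := H.le_opNorm (periodize (box d N) ψ)
  have h2 := norm_sub_norm_le
    (periodize (box d N) (toEuclideanCLM (𝕜 := ℂ) (perHam H ρ) ψ)) (H (periodize (box d N) ψ))
  rw [norm_sub_rev] at h2
  rw [norm_periodize hρ] at h1 h2
  refine le_of_mul_le_mul_left ?_ hs
  linarith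

theorem norm_perHam_le (hρ : 0 < ρ) (hR : HasFiniteRange H R)
    (hp : IsPeriodic H p) (hdvd : ∀ j, p j ∣ 2 * ρ) : ‖perHam H ρ‖ ≤ ‖H‖ :=
  ContinuousLinearMap.opNorm_le_bound _ (norm_nonneg _) (norm_perHam_apply_le hρ hR hp hdvd)

theorem mul_norm_le_norm_perHam_apply (hρ : 0 < ρ) (hR : HasFiniteRange H R)
    (hp : IsPeriodic H p) (hdvd : ∀ j, p j ∣ 2 * ρ) {g : ℝ} (hg : ∀ φ, g * ‖φ‖ ≤ ‖H φ‖)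
    (ψ : EuclideanSpace ℂ (Torus d ρ × Fin L)) :
    g * ‖ψ‖ ≤ ‖toEuclideanCLM (𝕜 := ℂ) (perHam H ρ) ψ‖ := by
  refine le_of_forall_pos_le_add fun ε hε => ?_
  obtain ⟨N, hN, hN0⟩ := ((eventually_norm_apply_periodize_sub_le hρ hR hp hdvd ψ hε).and
    (eventually_gt_atTop 0)).exists
  have hs := sqrt_card_box_pos (d := d) hN0
  have h1 := hg (periodize (box d N) ψ)
  have h2 := norm_sub_norm_le (H (periodize (box d N) ψ))
    (periodize (box d N) (toEuclideanCLM (𝕜 := ℂ) (perHam H ρ) ψ))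
  rw [norm_periodize hρ] at h1 h2
  refine le_of_mul_le_mul_left ?_ hs
  linarith

/-- The angle `π x_j / ρ` on the torus. -/
noncomputable def angle (L : ℕ) (j : Fin d) (u : Torus d ρ × Fin L) : ℝ :=
  Real.pi / ρ * (u.1.coord j : ℝ)

/-- The phase `e^{iπx/ρ}` is `2ρ`-periodic, which is why trigonometric functions of position, unlike
position itself, pass between the lattice and the torus. -/
theorem periodize_phase (hρ : 0 < ρ) (Q : Finset (Fin d → ℤ)) (j : Fin d)
    (ψ : EuclideanSpace ℂ (Torus d ρ × Fin L)) :
    periodize Q (toEuclideanCLM (𝕜 := ℂ) (phase (angle L j)) ψ)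
      = modulate L (fun x => Real.pi / ρ * x j) (periodize Q ψ) := by
  classical
  refine lp.ext (funext fun x => ?_)
  obtain ⟨u, a, rfl⟩ := exists_cell hρ x
  rw [modulate_apply, periodize_apply hρ, periodize_apply hρ, smul_ite, smul_zero]
  refine if_congr Iff.rfl ?_ rfl
  have hexp : Complex.exp (((Real.pi / ρ * (cell u a j : ℝ) : ℝ) : ℂ) * Complex.I)
      = Complex.exp (((Real.pi / ρ * (u.coord j : ℝ) : ℝ) : ℂ) * Complex.I) := by
    rw [Complex.exp_eq_exp_iff_exists_int]
    refine ⟨a j, ?_⟩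
    have : (ρ : ℂ) ≠ 0 := by exact_mod_cast hρ.ne'
    rw [cell_apply]
    push_cast
    field_simp
  rw [hexp]
  ext i
  simp [fiber, phase, angle, mulVec_diagonal]

theorem maxCommutator_nonneg (H : Hilb d L →L[ℂ] Hilb d L) : 0 ≤ maxCommutator H :=
  Real.iSup_nonneg fun _ => Real.sSup_nonneg (by rintro _ ⟨ψ, h, -, rfl⟩; exact norm_nonneg _)

theorem norm_phase_comm_perHam_le (hρ : 0 < ρ) (hR : HasFiniteRange H R)
    (hp : IsPeriodic H p) (hdvd : ∀ j, p j ∣ 2 * ρ) (j : Fin d) :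
    ‖phase (angle L j) * perHam H ρ - perHam H ρ * phase (angle L j)‖
      ≤ Real.pi / ρ * maxCommutator H := by
  have key : ∀ ψ : EuclideanSpace ℂ (Torus d ρ × Fin L),
      ‖toEuclideanCLM (𝕜 := ℂ) (phase (angle L j) * perHam H ρ - perHam H ρ * phase (angle L j)) ψ‖
        ≤ Real.pi / ρ * maxCommutator H * ‖ψ‖ := by
    intro ψ
    set A := toEuclideanCLM (𝕜 := ℂ) (perHam H ρ) with hA
    set U := toEuclideanCLM (𝕜 := ℂ) (phase (angle (ρ := ρ) L j)) with hU
    have h0 : toEuclideanCLM (𝕜 := ℂ) (phase (angle L j) * perHam H ρ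
        - perHam H ρ * phase (angle L j)) ψ = U (A ψ) - A (U ψ) := by
      rw [map_sub, map_mul, map_mul]; rfl
    rw [h0]
    refine le_of_forall_pos_le_add fun ε hε => ?_
    obtain ⟨N, ⟨hN1, hN2⟩, hN0⟩ := (((eventually_norm_apply_periodize_sub_le hρ hR hp hdvd ψ
      (half_pos hε)).and (eventually_norm_apply_periodize_sub_le hρ hR hp hdvd (U ψ)
      (half_pos hε))).and (eventually_gt_atTop 0)).exists
    have hs := sqrt_card_box_pos (d := d) hN0
    set Q := box d N
    set W := modulate (d := d) L (fun x => Real.pi / ρ * x j) with hW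
    have h1 := hR.norm_modulate_comm_le j (periodize_eq_zero hρ ψ (Q := Q))
      (s := Real.pi / ρ) (by positivity)
    -- Two boundary errors, each at most `ε / 2` per root of the volume, surround the commutator on
    -- the lattice.
    have h2 : periodize Q (U (A ψ) - A (U ψ))
        = -(W (H (periodize Q ψ) - periodize Q (A ψ)))
          + (W (H (periodize Q ψ)) - H (W (periodize Q ψ)))
          + (H (periodize Q (U ψ)) - periodize Q (A (U ψ))) := by
      rw [periodize_sub hρ, hU, periodize_phase hρ, periodize_phase hρ, map_sub]
      abel
    have h3 := congrArg norm h2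
    rw [norm_periodize hρ] at h3
    have h4 := norm_add₃_le (a := -(W (H (periodize Q ψ) - periodize Q (A ψ))))
      (b := W (H (periodize Q ψ)) - H (W (periodize Q ψ)))
      (c := H (periodize Q (U ψ)) - periodize Q (A (U ψ)))
    rw [norm_neg, W.norm_map] at h4
    rw [norm_periodize hρ] at h1
    refine le_of_mul_le_mul_left ?_ hs
    linarith
  have := maxCommutator_nonneg H
  exact ContinuousLinearMap.opNorm_le_bound _ (by positivity) key

end Periodization

end PeriodicLocalizer

namespace PeriodicLocalizer

open Matrix Topology
open scoped Matrix.Norms.L2Operator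

/-! ### The spectral gap, and lower bounds for matrices. -/

section Gap

variable {d L : ℕ} {H : Hilb d L →L[ℂ] Hilb d L}

theorem nontrivial_hilb (hL : 0 < L) : Nontrivial (Hilb d L) := by
  refine ⟨⟨lp.single 2 0 (EuclideanSpace.single ⟨0, hL⟩ 1), 0, fun h => ?_⟩⟩
  have := congrArg norm h
  rw [lp.norm_single (by norm_num)] at this
  simp at this

theorem inverse_mul_self (h0 : (0 : ℂ) ∉ spectrum ℂ H) : Ring.inverse H * H = 1 :=
  Ring.inverse_mul_cancel _ ((spectrum.zero_notMem_iff ℂ).mp h0)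

theorem norm_inverse_pos (hL : 0 < L) (h0 : (0 : ℂ) ∉ spectrum ℂ H) : 0 < ‖Ring.inverse H‖ := by
  have := nontrivial_hilb (d := d) hL
  rw [norm_pos_iff]
  intro h
  have h1 := inverse_mul_self h0
  rw [h, zero_mul] at h1
  exact zero_ne_one h1

theorem gap_pos (hL : 0 < L) (h0 : (0 : ℂ) ∉ spectrum ℂ H) : 0 < gap H :=
  inv_pos.mpr (norm_inverse_pos hL h0)

theorem gap_mul_norm_le (hL : 0 < L) (h0 : (0 : ℂ) ∉ spectrum ℂ H) (φ : Hilb d L) :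
    gap H * ‖φ‖ ≤ ‖H φ‖ := by
  have h1 : Ring.inverse H (H φ) = φ := congrArg (fun T => T φ) (inverse_mul_self h0)
  have h2 := (Ring.inverse H).le_opNorm (H φ)
  rw [h1] at h2
  rw [gap, inv_mul_le_iff₀ (norm_inverse_pos hL h0)]
  exact h2

theorem gap_le_norm (hL : 0 < L) (h0 : (0 : ℂ) ∉ spectrum ℂ H) : gap H ≤ ‖H‖ := by
  have := nontrivial_hilb (d := d) hL
  obtain ⟨φ, hφ⟩ := exists_ne (0 : Hilb d L)
  exact le_of_mul_le_mul_right ((gap_mul_norm_le hL h0 φ).trans (H.le_opNorm φ))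
    (norm_pos_iff.mpr hφ)

end Gap

section LowerBound

variable {X : Type*} [Fintype X] [DecidableEq X]

theorem det_ne_zero_of_injective {A : Matrix X X ℂ}
    (h : ∀ ψ, toEuclideanCLM (𝕜 := ℂ) A ψ = 0 → ψ = 0) : A.det ≠ 0 := by
  intro hdet
  obtain ⟨v, hv, hA⟩ := exists_mulVec_eq_zero_iff.mpr hdet
  refine hv ?_
  have := h (WithLp.toLp 2 v) (by ext i; rw [ofLp_toEuclideanCLM, hA]; rfl)
  simpa using congrArg WithLp.ofLp this

theorem posSemidef_sq_sub_smul_one {A : Matrix X X ℂ} (hA : A.IsHermitian) {c : ℝ}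
    (h : ∀ ψ, c * ‖ψ‖ ^ 2 ≤ ‖toEuclideanCLM (𝕜 := ℂ) A ψ‖ ^ 2) :
    (A ^ 2 - (c : ℂ) • (1 : Matrix X X ℂ)).PosSemidef := by
  have hc : ((c : ℂ) • (1 : Matrix X X ℂ)).IsHermitian := by
    simp [Matrix.IsHermitian, conjTranspose_smul]
  have hB : (A ^ 2 - (c : ℂ) • (1 : Matrix X X ℂ)).IsHermitian := (hA.pow 2).sub hc
  refine hB.posSemidef_iff_eigenvalues_nonneg.mpr fun i => ?_
  set v := hB.eigenvectorBasis i
  have h1 := h v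
  have h2 := re_inner_toEuclideanCLM_eq_sum hB v
  have h3 : toEuclideanCLM (𝕜 := ℂ) (A ^ 2 - (c : ℂ) • (1 : Matrix X X ℂ))
      = star (toEuclideanCLM (𝕜 := ℂ) A) * toEuclideanCLM (𝕜 := ℂ) A
        - (c : ℂ) • (1 : EuclideanSpace ℂ X →L[ℂ] EuclideanSpace ℂ X) := by
    rw [← map_star, star_eq_conjTranspose, hA.eq, map_sub, map_smul, map_one, pow_two, map_mul]
  have h4 : form (toEuclideanCLM (𝕜 := ℂ) (A ^ 2 - (c : ℂ) • (1 : Matrix X X ℂ))) v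
      = ‖toEuclideanCLM (𝕜 := ℂ) A v‖ ^ 2 - c * ‖v‖ ^ 2 := by
    rw [h3, form_sub, form_star_mul_self, form_smul, LocalizerFrame.form_one]
  rw [form, h2, Finset.sum_eq_single i] at h4
  · have h5 : inner ℂ (hB.eigenvectorBasis i) v = 1 := by simp [v]
    rw [h5] at h4
    simp only [norm_one, one_pow, mul_one] at h4
    simp only [Pi.zero_apply]
    linarith
  · intro j _ hj
    rw [hB.eigenvectorBasis.inner_eq_zero hj]
    simp
  · simp

/-- The lower bound is the same as `‖h⁻¹‖ ≤ 1 / γ`, and in this form it survives the contractive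
unital homomorphism `Φ`. -/
theorem LocalizerFrame.mul_norm_le_norm_Φ_apply {E : Type*} [NormedAddCommGroup E]
    [InnerProductSpace ℂ E] [CompleteSpace E] {d : ℕ} (𝔽 : LocalizerFrame X E d)
    {h : Matrix X X ℂ} {γ : ℝ} (hγ0 : 0 < γ)
    (hγ : ∀ ψ, γ * ‖ψ‖ ≤ ‖toEuclideanCLM (𝕜 := ℂ) h ψ‖) (ψ : E) :
    γ * ‖ψ‖ ≤ ‖𝔽.Φ h ψ‖ := by
  have hdet : h.det ≠ 0 := det_ne_zero_of_injective fun φ hφ => by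
    have := hγ φ
    rw [hφ, norm_zero] at this
    exact norm_le_zero_iff.mp (le_of_mul_le_mul_left (by simpa using this) hγ0)
  have hunit : IsUnit h.det := isUnit_iff_ne_zero.mpr hdet
  have hinv : ‖h⁻¹‖ ≤ γ⁻¹ := by
    refine ContinuousLinearMap.opNorm_le_bound
      (toEuclideanCLM (𝕜 := ℂ) h⁻¹) (inv_nonneg.mpr hγ0.le) fun φ => ?_
    have h1 := hγ (toEuclideanCLM (𝕜 := ℂ) h⁻¹ φ)
    rw [← mul_apply_eq_comp, ← map_mul, mul_nonsing_inv _ hunit, map_one] at h1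
    rw [inv_mul_eq_div, le_div_iff₀ hγ0, mul_comm]
    exact h1
  have h1 : 𝔽.Φ h⁻¹ (𝔽.Φ h ψ) = ψ := by
    rw [← mul_apply_eq_comp, ← map_mul, nonsing_inv_mul _ hunit, map_one]
    rfl
  have h2 := (𝔽.Φ h⁻¹).le_of_opNorm_le ((𝔽.norm_Φ_le _).trans hinv) (𝔽.Φ h ψ)
  rw [h1, inv_mul_eq_div, le_div_iff₀ hγ0, mul_comm] at h2
  exact h2

end LowerBound

/-! ### The gap of the periodic localizer at fixed volume. -/

section PerLocalizer

variable {d L k ρ : ℕ} {H : Hilb d L →L[ℂ] Hilb d L} {R : ℝ} {p : Fin d → ℕ}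
  {γ : Fin (d - 1) → Matrix (Fin k) (Fin k) ℂ} {η : ℝ}

theorem norm_smul_perHam_le (hρ : 0 < ρ) (hR : HasFiniteRange H R) (hp : IsPeriodic H p)
    (hdvd : ∀ j, p j ∣ 2 * ρ) (hη : 0 < η) :
    ‖((1 / η : ℝ) : ℂ) • perHam H ρ‖ ≤ ‖H‖ / η := by
  rw [norm_smul, Complex.norm_real, Real.norm_of_nonneg (by positivity), one_div_mul_eq_div]
  gcongr
  exact norm_perHam_le hρ hR hp hdvd

theorem norm_phase_comm_smul_perHam_le (hρ : 0 < ρ) (hR : HasFiniteRange H R)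
    (hp : IsPeriodic H p) (hdvd : ∀ j, p j ∣ 2 * ρ) (hη : 0 < η) (j : Fin d) :
    ‖phase (angle L j) * (((1 / η : ℝ) : ℂ) • perHam H ρ)
      - (((1 / η : ℝ) : ℂ) • perHam H ρ) * phase (angle L j)‖
      ≤ Real.pi * (maxCommutator H / (η * ρ)) := by
  rw [mul_smul_comm, smul_mul_assoc, ← smul_sub, norm_smul, Complex.norm_real,
    Real.norm_of_nonneg (by positivity)]
  calc 1 / η * _ ≤ 1 / η * (Real.pi / ρ * maxCommutator H) := by
        gcongr
        exact norm_phase_comm_perHam_le hρ hR hp hdvd j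
    _ = _ := by field_simp

theorem mul_norm_le_norm_smul_perHam_apply (hL : 0 < L) (h0 : (0 : ℂ) ∉ spectrum ℂ H)
    (hρ : 0 < ρ) (hR : HasFiniteRange H R)
    (hp : IsPeriodic H p) (hdvd : ∀ j, p j ∣ 2 * ρ) (hη : 0 < η)
    (ψ : EuclideanSpace ℂ (Torus d ρ × Fin L)) :
    gap H / η * ‖ψ‖ ≤ ‖toEuclideanCLM (𝕜 := ℂ) (((1 / η : ℝ) : ℂ) • perHam H ρ) ψ‖ := by
  have h1 := mul_norm_le_norm_perHam_apply hρ hR hp hdvd (gap_mul_norm_le hL h0) ψ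
  rw [map_smul, _root_.smul_apply, norm_smul, Complex.norm_real,
    Real.norm_of_nonneg (by positivity), one_div_mul_eq_div, div_mul_eq_mul_div]
  gcongr

theorem smul_perHam_isHermitian (hH : IsSelfAdjoint H) (hp : IsPeriodic H p)
    (hdvd : ∀ j, p j ∣ 2 * ρ) : (((1 / η : ℝ) : ℂ) • perHam H ρ).IsHermitian := by
  rw [Matrix.IsHermitian, conjTranspose_smul, (perHam_isHermitian hH hp hdvd).eq]
  simp

/-- The periodic localizer is bounded below by `g / (√2 η)`. -/
theorem norm_perLocalizer_apply_sq_ge (hL : 0 < L) (hH : IsSelfAdjoint H)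
    (h0 : (0 : ℂ) ∉ spectrum ℂ H) (hR : HasFiniteRange H R) (hp : IsPeriodic H p)
    (hγ : IsIrredCliffordRep γ) (hρ : 0 < ρ) (hdvd : ∀ j, p j ∣ 2 * ρ) (hη : 0 < η)
    (hflat : 16 * d * (η * (‖H‖ - η)) ≤ gap H ^ 2)
    (hsize : 40 * d * maxCommutator H * η ≤ gap H ^ 2 * ρ)
    (ψ : EuclideanSpace ℂ (LocIndex d L k ρ)) :
    gap H ^ 2 / (2 * η ^ 2) * ‖ψ‖ ^ 2
      ≤ ‖toEuclideanCLM (𝕜 := ℂ) (perLocalizer H γ η ρ) ψ‖ ^ 2 := by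
  have hg := gap_pos hL h0
  have hM := maxCommutator_nonneg H
  have hρ' : (0 : ℝ) < ρ := by exact_mod_cast hρ
  have hΦ := (concreteFrame (Torus d ρ × Fin L) hγ).mul_norm_le_norm_Φ_apply (div_pos hg hη)
    (mul_norm_le_norm_smul_perHam_apply hL h0 hρ hR hp hdvd hη)
  have h1 := (concreteFrame (Torus d ρ × Fin L) hγ).norm_loc_sq_ge
    (smul_perHam_isHermitian (η := η) hH hp hdvd) (fun j => angle L j)
    (norm_smul_perHam_le hρ hR hp hdvd hη) (div_pos hg hη).le hΦ
    (norm_phase_comm_smul_perHam_le hρ hR hp hdvd hη) ψ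
  rw [perLocalizer_eq_locMat, toEuclideanCLM_locMat hγ]
  refine le_trans ?_ h1
  gcongr
  -- Half of `g² / η²` is given away: a quarter to the excess of `‖H‖ / η` over one, a quarter to
  -- the commutators, where `12 π < 40`.
  have h2 : 4 * d * max (‖H‖ / η - 1) 0 ≤ gap H ^ 2 / η ^ 2 / 4 := by
    rcases max_cases (‖H‖ / η - 1) 0 with ⟨h, -⟩ | ⟨h, -⟩
    · rw [h, div_div, le_div_iff₀ (by positivity)]
      calc 4 * d * (‖H‖ / η - 1) * (η ^ 2 * 4) = 16 * d * (η * (‖H‖ - η)) := by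
            field_simp
            ring
        _ ≤ _ := hflat
    · rw [h, mul_zero]; positivity
  have h3 : 3 * d * (Real.pi * (maxCommutator H / (η * ρ))) ≤ gap H ^ 2 / η ^ 2 / 4 := by
    rw [div_div, le_div_iff₀ (by positivity)]
    calc 3 * d * (Real.pi * (maxCommutator H / (η * ρ))) * (η ^ 2 * 4)
        = 12 * Real.pi * (d * maxCommutator H * η / ρ) := by
          field_simp
          ring
      _ ≤ 40 * (d * maxCommutator H * η / ρ) := by
          gcongr
          linarith [Real.pi_lt_d2]
      _ = 40 * d * maxCommutator H * η / ρ := by ring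
      _ ≤ _ := by rw [div_le_iff₀ hρ']; exact hsize
  have h4 : gap H ^ 2 / (2 * η ^ 2) = gap H ^ 2 / η ^ 2 / 2 := by
    field_simp
  rw [h4, div_pow]
  linarith

theorem det_perLocalizer_ne_zero (hL : 0 < L) (hH : IsSelfAdjoint H)
    (h0 : (0 : ℂ) ∉ spectrum ℂ H) (hR : HasFiniteRange H R) (hp : IsPeriodic H p)
    (hγ : IsIrredCliffordRep γ) (hρ : 0 < ρ) (hdvd : ∀ j, p j ∣ 2 * ρ) (hη : 0 < η)
    (hflat : 16 * d * (η * (‖H‖ - η)) ≤ gap H ^ 2)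
    (hsize : 40 * d * maxCommutator H * η ≤ gap H ^ 2 * ρ) :
    (perLocalizer H γ η ρ).det ≠ 0 := by
  refine det_ne_zero_of_injective fun ψ hψ => ?_
  have h1 := norm_perLocalizer_apply_sq_ge hL hH h0 hR hp hγ hρ hdvd hη hflat hsize ψ
  have hg := gap_pos hL h0
  rw [hψ, norm_zero, zero_pow two_ne_zero] at h1
  have h2 : 0 < gap H ^ 2 / (2 * η ^ 2) := by positivity
  have h3 : ‖ψ‖ ^ 2 ≤ 0 := le_of_mul_le_mul_left (by simpa using h1) h2
  exact norm_eq_zero.mp (pow_eq_zero_iff two_ne_zero |>.mp (le_antisymm h3 (sq_nonneg _)))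

/-- The signature does not depend on `η` as long as the lower bound holds along a segment. -/
theorem signature_perLocalizer_eq_of_segment (hL : 0 < L) (hH : IsSelfAdjoint H)
    (h0 : (0 : ℂ) ∉ spectrum ℂ H) (hR : HasFiniteRange H R) (hp : IsPeriodic H p)
    (hγ : IsIrredCliffordRep γ) (hρ : 0 < ρ) (hdvd : ∀ j, p j ∣ 2 * ρ) {η' : ℝ}
    (hη : ∀ t ∈ segment ℝ η η', 0 < t ∧ 16 * d * (t * (‖H‖ - t)) ≤ gap H ^ 2 ∧
      40 * d * maxCommutator H * t ≤ gap H ^ 2 * ρ) :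
    signature (perLocalizer H γ η ρ) (perLocalizer_isHermitian hH hp hdvd γ η)
      = signature (perLocalizer H γ η' ρ) (perLocalizer_isHermitian hH hp hdvd γ η') := by
  have hmem : ∀ t : unitInterval, AffineMap.lineMap η η' (t : ℝ) ∈ segment ℝ η η' := fun t => by
    rw [segment_eq_image_lineMap]
    exact ⟨t, t.2, rfl⟩
  have hpath := signature_eq_of_path
    (fun t : unitInterval => perLocalizer H γ (AffineMap.lineMap η η' (t : ℝ)) ρ) ?_
    (fun t => perLocalizer_isHermitian hH hp hdvd γ _)
    (fun t => det_perLocalizer_ne_zero hL hH h0 hR hp hγ hρ hdvd (hη _ (hmem t)).1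
      (hη _ (hmem t)).2.1 (hη _ (hmem t)).2.2)
  · simpa using hpath
  · unfold perLocalizer
    have h1 : Continuous fun t : unitInterval =>
        (((1 / (AffineMap.lineMap η η' (t : ℝ) : ℝ) : ℝ)) : ℂ) := by
      refine Complex.continuous_ofReal.comp (continuous_const.div ?_ fun t => (hη _ (hmem t)).1.ne')
      exact AffineMap.lineMap_continuous.comp continuous_subtype_val
    exact continuous_const.add (h1.smul continuous_const)

end PerLocalizer

end PeriodicLocalizer

namespace PeriodicLocalizer

open Matrix Topology
open scoped Matrix.Norms.L2Operator

/-! ### Extension of a localizer to a larger set of sites. -/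

section Extension

variable {X X' : Type*} [Fintype X] [DecidableEq X] [Fintype X'] [DecidableEq X']

set_option linter.unusedSectionVars false

/-- The isometry `ℂ^X → ℂ^X'` induced by an injection. -/
def inclusion (ι : X → X') : Matrix X' X ℂ := of fun u x => if u = ι x then 1 else 0

theorem inclusion_conjTranspose_mul_self {ι : X → X'} (hι : Function.Injective ι) :
    (inclusion ι)ᴴ * inclusion ι = 1 := by
  ext x y
  simp [mul_apply, inclusion, one_apply, hι.eq_iff, eq_comm]

theorem norm_inclusion_le {ι : X → X'} (hι : Function.Injective ι) : ‖inclusion ι‖ ≤ 1 := by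
  have h1 := l2_opNorm_conjTranspose_mul_self (inclusion ι)
  rw [inclusion_conjTranspose_mul_self hι] at h1
  have h2 : ‖(1 : Matrix X X ℂ)‖ ≤ 1 := norm_le_of_star_mul_self_eq_one (by simp)
  nlinarith [norm_nonneg (inclusion ι)]

theorem diagonal_mul_inclusion (ι : X → X') (f : X' → ℂ) :
    diagonal f * inclusion ι = inclusion ι * diagonal (f ∘ ι) := by
  ext u x
  simp only [diagonal_mul, mul_diagonal, inclusion, of_apply, Function.comp_apply]
  split_ifs with h
  · subst h; ring
  · ring

theorem inclusion_conjTranspose_mul_diagonal (ι : X → X') (f : X' → ℂ) :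
    (inclusion ι)ᴴ * diagonal f = diagonal (f ∘ ι) * (inclusion ι)ᴴ := by
  ext x u
  simp only [diagonal_mul, mul_diagonal, inclusion, conjTranspose_apply, of_apply,
    Function.comp_apply]
  split_ifs with h
  · subst h; ring
  · simp

/-- The extension of a matrix by zero along an injection. -/
def extendZero (ι : X → X') (h : Matrix X X ℂ) : Matrix X' X' ℂ :=
  inclusion ι * h * (inclusion ι)ᴴ

theorem norm_extendZero_le {ι : X → X'} (hι : Function.Injective ι) (h : Matrix X X ℂ) :
    ‖extendZero ι h‖ ≤ ‖h‖ := by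
  have h1 := norm_inclusion_le hι
  have h2 := l2_opNorm_mul (inclusion ι * h) (inclusion ι)ᴴ
  have h3 := l2_opNorm_mul (inclusion ι) h
  rw [l2_opNorm_conjTranspose] at h2
  refine h2.trans ?_
  calc _ ≤ (1 * ‖h‖) * 1 := by gcongr; exact h3.trans (by gcongr)
    _ = ‖h‖ := by ring

theorem extendZero_isHermitian (ι : X → X') {h : Matrix X X ℂ} (hh : h.IsHermitian) :
    (extendZero ι h).IsHermitian := by
  simp [extendZero, Matrix.IsHermitian, conjTranspose_mul, hh.eq, Matrix.mul_assoc]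

theorem extendZero_apply {ι : X → X'} (hι : Function.Injective ι) (h : Matrix X X ℂ) (x y : X) :
    extendZero ι h (ι x) (ι y) = h x y := by
  simp [extendZero, inclusion, mul_apply, hι.eq_iff]

theorem extendZero_apply_of_left {ι : X → X'} (h : Matrix X X ℂ) {u : X'}
    (hu : u ∉ Set.range ι) (v : X') : extendZero ι h u v = 0 := by
  have : ∀ x, u ≠ ι x := fun x hx => hu ⟨x, hx.symm⟩
  simp [extendZero, inclusion, mul_apply, this]

theorem extendZero_apply_of_right {ι : X → X'} (h : Matrix X X ℂ) (u : X') {v : X'}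
    (hv : v ∉ Set.range ι) : extendZero ι h u v = 0 := by
  have : ∀ x, v ≠ ι x := fun x hx => hv ⟨x, hx.symm⟩
  simp [extendZero, inclusion, mul_apply, this]

theorem diagonal_comm_extendZero (ι : X → X') (h : Matrix X X ℂ) (f : X' → ℂ) :
    diagonal f * extendZero ι h - extendZero ι h * diagonal f
      = extendZero ι (diagonal (f ∘ ι) * h - h * diagonal (f ∘ ι)) := by
  rw [extendZero, extendZero, Matrix.mul_assoc (inclusion ι * h),
    inclusion_conjTranspose_mul_diagonal, ← Matrix.mul_assoc, ← Matrix.mul_assoc,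
    diagonal_mul_inclusion, Matrix.mul_sub, Matrix.sub_mul]
  simp only [Matrix.mul_assoc]

variable {d k : ℕ}

/-- Extending a localizer by constant positive mass does not change the signature. -/
theorem signature_locMat_extend (Γ : Fin d → Matrix (Fin k) (Fin k) ℂ) {ι : X → X'}
    (hι : Function.Injective ι) (c : X → ℝ) (s : Fin d → X → ℝ) {h : Matrix X X ℂ}
    (hh : h.IsHermitian) :
    signature (locMat Γ (Function.extend ι c fun _ => 2) (fun j => Function.extend ι (s j) 0)
        (extendZero ι h)) (locMat_isHermitian Γ _ _ (extendZero_isHermitian ι hh))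
      = signature (locMat Γ c s h) (locMat_isHermitian Γ c s hh) := by
  classical
  let Y := {u : X' // u ∉ Set.range ι}
  let e : X ⊕ Y ≃ X' :=
    (Equiv.sumCongr (Equiv.ofInjective ι hι) (Equiv.refl _)).trans (Equiv.sumCompl _)
  let e' : (((X × Fin k) ⊕ (X × Fin k)) ⊕ ((Y × Fin k) ⊕ (Y × Fin k)))
      ≃ ((X' × Fin k) ⊕ (X' × Fin k)) :=
    (Equiv.sumSumSumComm _ _ _ _).trans
      (Equiv.sumCongr ((Equiv.sumProdDistrib _ _ _).symm.trans (Equiv.prodCongr e (Equiv.refl _)))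
        ((Equiv.sumProdDistrib _ _ _).symm.trans (Equiv.prodCongr e (Equiv.refl _))))
  have e1 : ∀ x i, e' (Sum.inl (Sum.inl (x, i))) = Sum.inl (ι x, i) := fun _ _ => rfl
  have e2 : ∀ x i, e' (Sum.inl (Sum.inr (x, i))) = Sum.inr (ι x, i) := fun _ _ => rfl
  have e3 : ∀ y i, e' (Sum.inr (Sum.inl (y, i))) = Sum.inl (y.1, i) := fun _ _ => rfl
  have e4 : ∀ y i, e' (Sum.inr (Sum.inr (y, i))) = Sum.inr (y.1, i) := fun _ _ => rfl
  have hne : ∀ (x : X) (y : Y), ι x ≠ y.1 := fun x y hxy => y.2 ⟨x, hxy⟩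
  have hne' : ∀ (x : X) (y : Y), y.1 ≠ ι x := fun x y => (hne x y).symm
  have hl : ∀ (y : Y) (v : X'), extendZero ι h y.1 v = 0 := fun y =>
    extendZero_apply_of_left h y.2
  have hr : ∀ (u : X') (y : Y), extendZero ι h u y.1 = 0 := fun u y =>
    extendZero_apply_of_right h u y.2
  -- On the new sites the Hamiltonian and the sines vanish and the mass is `2`, so they decouple
  -- with as many eigenvalues `2` as `-2`.
  have hsub : (locMat Γ (Function.extend ι c fun _ => 2) (fun j => Function.extend ι (s j) 0)
      (extendZero ι h)).submatrix e' e' = fromBlocks (locMat Γ c s h) 0 0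
        (fromBlocks (diagonal fun _ : Y × Fin k => (2 : ℂ)) 0 0 (-diagonal fun _ : Y × Fin k => (2 : ℂ))) := by
    ext a b
    rcases a with (⟨x, i⟩ | ⟨x, i⟩) | (⟨x, i⟩ | ⟨x, i⟩) <;>
    rcases b with (⟨y, l⟩ | ⟨y, l⟩) | (⟨y, l⟩ | ⟨y, l⟩) <;>
    simp [e1, e2, e3, e4, locMat, kroneckerMap_apply, diagonal_apply, hι.eq_iff,
      hι.extend_apply, extendZero_apply hι, hne, hne', Matrix.sum_apply, hl, hr, one_apply]
    all_goals
      by_cases hxy : x = y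
      · subst hxy; by_cases hil : i = l <;> simp [hil]
      · have : x.1 ≠ y.1 := fun h => hxy (Subtype.ext h)
        simp [hxy, this]
  have hD : (fromBlocks (diagonal fun _ : Y × Fin k => (2 : ℂ)) 0 0
      (-diagonal fun _ : Y × Fin k => (2 : ℂ))).IsHermitian := by
    have : (diagonal fun _ : Y × Fin k => (2 : ℂ)).IsHermitian := by
      simp [Matrix.IsHermitian, diagonal_conjTranspose, Pi.star_def]
    exact isHermitian_fromBlocks_iff.mpr ⟨this, by simp, by simp, this.neg⟩
  have hH0 := locMat_isHermitian Γ (Function.extend ι c fun _ => 2)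
    (fun j => Function.extend ι (s j) 0) (extendZero_isHermitian ι hh)
  rw [← signature_submatrix hH0 e', signature_congr hsub (hH0.submatrix e')
    (isHermitian_fromBlocks_iff.mpr ⟨locMat_isHermitian Γ c s hh, by simp, by simp, hD⟩),
    signature_fromBlocks (locMat_isHermitian Γ c s hh) hD,
    signature_fromBlocks_diagonal_neg _ hD, add_zero]

end Extension

/-! ### Straight-line interpolation between two localizers. -/

section Interpolation

variable {X : Type*} [Fintype X] [DecidableEq X] {d k : ℕ}

theorem norm_diagonal_le {f : X → ℝ} {a : ℝ} (ha : 0 ≤ a) (hf : ∀ x, |f x| ≤ a) :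
    ‖diagonal fun x => (f x : ℂ)‖ ≤ a := by
  rw [l2_opNorm_diagonal, pi_norm_le_iff_of_nonneg ha]
  intro x
  rw [Complex.norm_real]
  exact hf x

/-- By bilinearity the commutator on the segment is the interpolation of the endpoint commutators
plus `t (1 - t) [f₀ - f₁, h₁ - h₀]`. The last term inherits the support of `h₁ - h₀`, and `t (1 - t)
≤ 1/4` cancels the factor four in its norm bound `4 a b`. -/
theorem commSplit_interpolation {χ f₀ f₁ : X → ℝ} {h₀ h₁ : Matrix X X ℂ} {a b e t : ℝ}
    (ht : t ∈ Set.Icc (0 : ℝ) 1) (ha : 0 ≤ a) (hf : ∀ x, |f₀ x - f₁ x| ≤ a)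
    (h0 : ‖(diagonal fun x => (f₀ x : ℂ)) * h₀ - h₀ * diagonal fun x => (f₀ x : ℂ)‖ ≤ e)
    (h1 : ‖(diagonal fun x => (f₁ x : ℂ)) * h₁ - h₁ * diagonal fun x => (f₁ x : ℂ)‖ ≤ e)
    (hr : h₁ - h₀ = (diagonal fun x => (χ x : ℂ)) * (h₁ - h₀) * diagonal fun x => (χ x : ℂ))
    (hb : ‖h₁ - h₀‖ ≤ 2 * b) :
    CommSplit χ (AffineMap.lineMap f₀ f₁ t) (AffineMap.lineMap h₀ h₁ (t : ℂ)) e (a * b) := by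
  have ht0 := ht.1
  have ht1 : 0 ≤ 1 - t := sub_nonneg.mpr ht.2
  have hb0 : 0 ≤ b := by linarith [norm_nonneg (h₁ - h₀)]
  set D₀ : Matrix X X ℂ := diagonal fun x => (f₀ x : ℂ)
  set D₁ : Matrix X X ℂ := diagonal fun x => (f₁ x : ℂ)
  set P : Matrix X X ℂ := diagonal fun x => (χ x : ℂ)
  set r := h₁ - h₀ with hrdef
  have hD : (diagonal fun x => ((AffineMap.lineMap f₀ f₁ t : X → ℝ) x : ℂ))
      = ((1 - t : ℝ) : ℂ) • D₀ + (t : ℂ) • D₁ := by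
    rw [← diagonal_smul, ← diagonal_smul, diagonal_add]
    congr 1
    funext x
    simp [AffineMap.lineMap_apply_module]
  have hcomm : ∀ D : Matrix X X ℂ, P * D = D * P → D * r - r * D = P * (D * r - r * D) * P := by
    intro D hPD
    calc D * r - r * D = D * (P * r * P) - (P * r * P) * D := by rw [← hr]
      _ = (D * P) * r * P - P * r * (P * D) := by noncomm_ring
      _ = (P * D) * r * P - P * r * (D * P) := by rw [hPD]
      _ = P * (D * r - r * D) * P := by noncomm_ring
  have hP : P * (D₀ - D₁) = (D₀ - D₁) * P := by
    simp only [P, D₀, D₁, diagonal_sub, diagonal_mul_diagonal, mul_comm]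
  refine ⟨((1 - t : ℝ) : ℂ) • (D₀ * h₀ - h₀ * D₀) + (t : ℂ) • (D₁ * h₁ - h₁ * D₁),
    ((t * (1 - t) : ℝ) : ℂ) • ((D₀ - D₁) * r - r * (D₀ - D₁)), ?_, ?_, ?_⟩
  · rw [hD, mul_smul_comm, smul_mul_assoc, ← hcomm _ hP, AffineMap.lineMap_apply_module, hrdef]
    simp only [add_mul, mul_add, sub_mul, mul_sub, smul_mul_assoc, mul_smul_comm, smul_sub,
      smul_add, smul_smul]
    push_cast
    module
  · refine (norm_add_le _ _).trans ?_
    rw [norm_smul, norm_smul, Complex.norm_real, Complex.norm_real, Real.norm_of_nonneg ht0,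
      Real.norm_of_nonneg ht1]
    nlinarith
  · have hDn : ‖D₀ - D₁‖ ≤ a := by
      have : D₀ - D₁ = diagonal fun x => ((f₀ x - f₁ x : ℝ) : ℂ) := by
        simp [D₀, D₁, diagonal_sub]
      rw [this]
      exact norm_diagonal_le ha hf
    have hn : ‖(D₀ - D₁) * r - r * (D₀ - D₁)‖ ≤ 4 * (a * b) := by
      refine (norm_sub_le _ _).trans ?_
      have n1 := norm_mul_le (D₀ - D₁) r
      have n2 := norm_mul_le r (D₀ - D₁)
      have n3 : ‖D₀ - D₁‖ * ‖r‖ ≤ a * (2 * b) := by gcongr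
      linarith
    have htt : 4 * (t * (1 - t)) ≤ 1 := by nlinarith [sq_nonneg (2 * t - 1)]
    rw [norm_smul, Complex.norm_real, Real.norm_of_nonneg (mul_nonneg ht0 ht1)]
    calc t * (1 - t) * _ ≤ t * (1 - t) * (4 * (a * b)) := by gcongr
      _ = 4 * (t * (1 - t)) * (a * b) := by ring
      _ ≤ 1 * (a * b) := by gcongr
      _ = a * b := one_mul _

/-- Two localizers have the same signature if their Hamiltonians differ only where both position
functions are large. -/
theorem signature_locMat_eq_of_interpolation {γ : Fin (d - 1) → Matrix (Fin k) (Fin k) ℂ}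
    (hγ : IsIrredCliffordRep γ) (hd : 0 < d) {χ c₀ c₁ : X → ℝ} {s₀ s₁ : Fin d → X → ℝ}
    {h₀ h₁ : Matrix X X ℂ} (hh₀ : h₀.IsHermitian) (hh₁ : h₁.IsHermitian)
    (hχ : ∀ x, χ x * χ x = χ x) (hc₀ : ∀ x, χ x ≤ 4 * c₀ x) (hc₁ : ∀ x, χ x ≤ 4 * c₁ x)
    (hcs : ∀ t ∈ Set.Icc (0 : ℝ) 1, ∀ x, (1 - χ x) * (AffineMap.lineMap (c₀ x) (c₁ x) t) ^ 2
      ≤ d * ∑ j, (AffineMap.lineMap (s₀ j x) (s₁ j x) t) ^ 2)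
    (hcd : ∀ x, |c₀ x - c₁ x| ≤ 2 * d) (hsd : ∀ j x, |s₀ j x - s₁ j x| ≤ 2)
    {b g e ε : ℝ} (hb₀ : ‖h₀‖ ≤ b) (hb₁ : ‖h₁‖ ≤ b) (hg : 0 < g)
    (hgap : ∀ ψ, g * ‖ψ‖ ≤ ‖toEuclideanCLM (𝕜 := ℂ) h₁ ψ‖)
    (hr : h₁ - h₀ = (diagonal fun x => (χ x : ℂ)) * (h₁ - h₀) * diagonal fun x => (χ x : ℂ))
    (he : 0 ≤ e)
    (hce₀ : ‖(diagonal fun x => (c₀ x : ℂ)) * h₀ - h₀ * diagonal fun x => (c₀ x : ℂ)‖ ≤ e)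
    (hce₁ : ‖(diagonal fun x => (c₁ x : ℂ)) * h₁ - h₁ * diagonal fun x => (c₁ x : ℂ)‖ ≤ e)
    (hse₀ : ∀ j, ‖(diagonal fun x => (s₀ j x : ℂ)) * h₀ - h₀ * diagonal fun x => (s₀ j x : ℂ)‖
      ≤ ε)
    (hse₁ : ∀ j, ‖(diagonal fun x => (s₁ j x : ℂ)) * h₁ - h₁ * diagonal fun x => (s₁ j x : ℂ)‖
      ≤ ε)
    (hbd : 64 * d * b ≤ 1)
    (hnum : 8 * b * (b ^ 2 + e) * (1 + 32 * b ^ 2 + 32 * d ^ 2 * b) + d ^ 2 * ε < g ^ 2 / 4) :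
    signature (locMat (gammaHat γ) c₀ s₀ h₀) (locMat_isHermitian _ c₀ s₀ hh₀)
      = signature (locMat (gammaHat γ) c₁ s₁ h₁) (locMat_isHermitian _ c₁ s₁ hh₁) := by
  have hrn : ‖h₁ - h₀‖ ≤ 2 * b := (norm_sub_le _ _).trans (by linarith)
  have hht : ∀ t : ℝ, (AffineMap.lineMap h₀ h₁ (t : ℂ) : Matrix X X ℂ).IsHermitian := by
    intro t
    rw [AffineMap.lineMap_apply_module, Matrix.IsHermitian, conjTranspose_add, conjTranspose_smul,
      conjTranspose_smul, hh₀.eq, hh₁.eq]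
    simp
  have hpath := signature_eq_of_path
    (fun t : unitInterval => locMat (gammaHat γ) (AffineMap.lineMap c₀ c₁ (t : ℝ))
      (AffineMap.lineMap s₀ s₁ (t : ℝ)) (AffineMap.lineMap h₀ h₁ ((t : ℝ) : ℂ))) ?_
    (fun t => locMat_isHermitian _ _ _ (hht t)) ?_
  · simpa using hpath
  · refine continuous_matrix fun a b => ?_
    rcases a with ⟨x, i⟩ | ⟨x, i⟩ <;> rcases b with ⟨y, l⟩ | ⟨y, l⟩ <;>
    simp only [locMat, fromBlocks_apply₁₁, fromBlocks_apply₁₂, fromBlocks_apply₂₁,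
      fromBlocks_apply₂₂, Matrix.sum_apply, kroneckerMap_apply, Matrix.sub_apply, diagonal_apply,
      Matrix.neg_apply, AffineMap.lineMap_apply_module, Matrix.add_apply, Matrix.smul_apply,
      Pi.add_apply, Pi.smul_apply]
    all_goals
      by_cases hxy : x = y
      · simp only [hxy, if_true]; fun_prop
      · simp only [hxy, if_false]; fun_prop
  · rintro ⟨t, ht⟩
    have ht0 := ht.1
    have ht1 : 0 ≤ 1 - t := sub_nonneg.mpr ht.2
    refine det_ne_zero_of_injective fun ψ hψ => ?_
    rw [toEuclideanCLM_locMat hγ] at hψ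
    -- The gap is required only at the endpoint `h₁`; the outer remainder is `h₁ - h_t = (1 - t) (h₁
    -- - h₀)`.
    refine (concreteFrame X hγ).eq_zero_of_loc_eq_zero (hht t) hd hχ ?_ ?_ ?_ hg.le
      ((concreteFrame X hγ).mul_norm_le_norm_Φ_apply hg hgap) (r := ((1 - t : ℝ) : ℂ) • (h₁ - h₀))
      ?_ ?_ he ?_ (fun j => ?_) hbd hnum hψ
    · intro x
      have h0 := hc₀ x
      have h1 := hc₁ x
      simp only [AffineMap.lineMap_apply_module, Pi.add_apply, Pi.smul_apply, smul_eq_mul]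
      nlinarith
    · intro x
      have := hcs t ht x
      simpa [AffineMap.lineMap_apply_module, pow_two] using this
    · rw [AffineMap.lineMap_apply_module]
      refine (norm_add_le _ _).trans ?_
      have : (1 : ℂ) - t = ((1 - t : ℝ) : ℂ) := by push_cast; rfl
      rw [this, norm_smul, norm_smul, Complex.norm_real, Complex.norm_real,
        Real.norm_of_nonneg ht0, Real.norm_of_nonneg ht1]
      nlinarith
    · rw [mul_smul_comm, smul_mul_assoc, ← hr, AffineMap.lineMap_apply_module]
      push_cast
      module
    · rw [norm_smul, Complex.norm_real, Real.norm_of_nonneg ht1]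
      nlinarith [norm_nonneg (h₁ - h₀)]
    · exact commSplit_interpolation ht (by positivity) hcd hce₀ hce₁ hr hrn
    · have h2 := commSplit_interpolation ht (by norm_num) (hsd j) (hse₀ j) (hse₁ j) hr hrn
      convert h2 using 1
      funext x
      simp [AffineMap.lineMap_apply_module]

end Interpolation

end PeriodicLocalizer

namespace PeriodicLocalizer

open Matrix Topology
open scoped Matrix.Norms.L2Operator

/-! ### Trigonometric bounds for mass and sines. -/

section Trigonometry

/-- The angle has modulus between `π/4` and `π`, and `cos (π/4) < 3/4`. The hypothesis `ρ ≤ 2 r` is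
what limits the comparison of volumes to one doubling at a time. -/
theorem cos_le_of_half_le {r ρ c : ℝ} (hr : 0 < r) (h1 : r ≤ 2 * |c|) (h2 : |c| ≤ ρ)
    (h3 : ρ ≤ 2 * r) : Real.cos (Real.pi / ρ * c) ≤ 3 / 4 := by
  have hρ : 0 < ρ := by linarith
  have hθ : |Real.pi / ρ * c| = Real.pi * (|c| / ρ) := by
    rw [abs_mul, abs_of_pos (by positivity)]
    ring
  rw [← Real.cos_abs, hθ]
  have hq : 1 / 4 ≤ |c| / ρ := by rw [le_div_iff₀ hρ]; linarith
  have hq' : |c| / ρ ≤ 1 := by rw [div_le_one hρ]; exact h2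
  have h4 : Real.cos (Real.pi * (|c| / ρ)) ≤ Real.cos (Real.pi / 4) := by
    refine Real.cos_le_cos_of_nonneg_of_le_pi (by positivity) ?_ ?_
    · nlinarith [Real.pi_pos]
    · nlinarith [Real.pi_pos]
  rw [Real.cos_pi_div_four] at h4
  have h5 : √2 ≤ 3 / 2 := Real.sqrt_le_iff.mpr ⟨by norm_num, by norm_num⟩
  linarith

theorem one_sub_cos_le_sin {θ : ℝ} (h0 : 0 ≤ θ) (h1 : θ ≤ Real.pi / 2) :
    1 - Real.cos θ ≤ Real.sin θ := by
  have hc := Real.cos_nonneg_of_neg_pi_div_two_le_of_le (by linarith [Real.pi_pos]) h1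
  have hs := Real.sin_nonneg_of_nonneg_of_le_pi h0 (by linarith [Real.pi_pos])
  nlinarith [Real.sin_sq_add_cos_sq θ, Real.cos_le_one θ, Real.sin_le_one θ]

/-- Both angles lie in `[-π/2, π/2]`, where `1 - cos ≤ |sin|`, and they have the sign of `c`; thus
the two sines cannot cancel along the interpolation. -/
theorem lineMap_one_sub_cos_sq_le {ρ ρ' c t : ℝ} (hρ : 0 < ρ) (hρρ' : ρ ≤ ρ')
    (hc : 2 * |c| ≤ ρ) (ht : t ∈ Set.Icc (0 : ℝ) 1) :
    (AffineMap.lineMap (1 - Real.cos (Real.pi / ρ * c)) (1 - Real.cos (Real.pi / ρ' * c)) t) ^ 2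
      ≤ (AffineMap.lineMap (Real.sin (Real.pi / ρ * c)) (Real.sin (Real.pi / ρ' * c)) t) ^ 2 := by
  have ht0 := ht.1
  have ht1 : 0 ≤ 1 - t := sub_nonneg.mpr ht.2
  have hpos : ∀ r, ρ ≤ r → ∀ c, 0 ≤ c → 2 * c ≤ ρ →
      0 ≤ Real.pi / r * c ∧ Real.pi / r * c ≤ Real.pi / 2 := by
    intro r hr c hc0 hc
    have : 0 < r := by linarith
    refine ⟨by positivity, ?_⟩
    rw [div_mul_eq_mul_div, div_le_div_iff₀ this two_pos]
    nlinarith [Real.pi_pos]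
  have hcn : ∀ θ, 0 ≤ 1 - Real.cos θ := fun θ => sub_nonneg.mpr (Real.cos_le_one θ)
  have key : ∀ c, 0 ≤ c → 2 * c ≤ ρ →
      (AffineMap.lineMap (1 - Real.cos (Real.pi / ρ * c)) (1 - Real.cos (Real.pi / ρ' * c)) t) ^ 2
      ≤ (AffineMap.lineMap (Real.sin (Real.pi / ρ * c)) (Real.sin (Real.pi / ρ' * c)) t) ^ 2 := by
    intro c hc0 hc
    have a0 := hpos ρ le_rfl c hc0 hc
    have a1 := hpos ρ' hρρ' c hc0 hc
    have b0 := one_sub_cos_le_sin a0.1 a0.2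
    have b1 := one_sub_cos_le_sin a1.1 a1.2
    have c0 := hcn (Real.pi / ρ * c)
    have c1 := hcn (Real.pi / ρ' * c)
    simp only [AffineMap.lineMap_apply_module, smul_eq_mul]
    gcongr
  rcases le_total 0 c with h | h
  · rw [abs_of_nonneg h] at hc
    exact key c h hc
  · rw [abs_of_nonpos h] at hc
    have := key (-c) (by linarith) hc
    simp only [mul_neg, Real.cos_neg, Real.sin_neg, AffineMap.lineMap_apply_module,
      smul_eq_mul] at this ⊢
    nlinarith

end Trigonometry

/-! ### Embedding of a torus into a larger one; agreement of the Hamiltonians on the core. -/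

section Embedding

variable {ρ' d L ρ : ℕ}

/-- The inclusion of a torus into a larger one as sets of representatives. -/
def torusEmbed (L : ℕ) (h : ρ ≤ ρ') (u : Torus d ρ × Fin L) : Torus d ρ' × Fin L :=
  (fun j => ⟨u.1 j, Finset.mem_Ioc.mpr
    ⟨lt_of_le_of_lt (neg_le_neg (Nat.cast_le.mpr h)) (coord_mem u.1 j).1,
      (coord_mem u.1 j).2.trans (Nat.cast_le.mpr h)⟩⟩, u.2)

theorem coord_torusEmbed (h : ρ ≤ ρ') (u : Torus d ρ × Fin L) :
    (torusEmbed L h u).1.coord = u.1.coord := rfl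

theorem torusEmbed_injective (h : ρ ≤ ρ') :
    Function.Injective (torusEmbed (d := d) L h) := by
  intro u v huv
  have h1 := congrArg (fun w => w.1.coord) huv
  exact Prod.ext (coord_injective h1) (congrArg (fun w => w.2) huv)

theorem exists_torusEmbed_eq (h : ρ ≤ ρ') {u : Torus d ρ' × Fin L}
    (hu : ∀ j, |u.1.coord j| < ρ) : ∃ v, torusEmbed L h v = u := by
  refine ⟨(fun j => ⟨u.1.coord j, Finset.mem_Ioc.mpr ?_⟩, u.2), ?_⟩
  · have := abs_lt.mp (hu j)
    exact ⟨this.1, this.2.le⟩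
  · exact Prod.ext (coord_injective rfl) rfl

theorem exists_le_abs_coord_of_notMem_range (h : ρ ≤ ρ') {u : Torus d ρ' × Fin L}
    (hu : u ∉ Set.range (torusEmbed L h)) : ∃ j, (ρ : ℤ) ≤ |u.1.coord j| := by
  by_contra! hlt
  exact hu (exists_torusEmbed_eq h hlt)

theorem abs_coord_le (u : Torus d ρ) (j : Fin d) : |u.coord j| ≤ ρ :=
  abs_le.mpr ⟨(coord_mem u j).1.le, (coord_mem u j).2⟩

variable {H : Hilb d L →L[ℂ] Hilb d L} {R : ℝ} {p : Fin d → ℕ}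

theorem HasFiniteRange.kernel_eq_zero_of_core (hR : HasFiniteRange H R) (hRρ : 2 * R ≤ ρ)
    {x y : Fin d → ℤ} (hx : ∀ j, 2 * |x j| < ρ) {j : Fin d} (hy : (ρ : ℤ) ≤ |y j|) :
    kernel H x y = 0 := by
  refine hR.kernel_eq_zero (j := j) ?_
  have h1 : (2 * |(x j : ℝ)|) < ρ := by exact_mod_cast hx j
  have h2 : (ρ : ℝ) ≤ |(y j : ℝ)| := by exact_mod_cast hy
  have h3 := abs_sub_abs_le_abs_sub (y j : ℝ) (x j)
  rw [abs_sub_comm] at h3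
  linarith

/-- A core point is farther than `R ≤ ρ / 2` from every representative shifted by a nonzero period,
so no wrap-around term survives and tori of both sizes see the kernel of `H` itself. -/
theorem perHam_apply_of_core (hR : HasFiniteRange H R) (hRρ : 2 * R ≤ ρ) (h : ρ ≤ ρ')
    {u : Torus d ρ' × Fin L} (hu : ∀ j, 2 * |u.1.coord j| < ρ) (v : Torus d ρ' × Fin L) :
    perHam H ρ' u v = kernel H u.1.coord v.1.coord u.2 v.2 := by
  rw [perHam, of_apply, finsum_eq_single _ 0]
  · simp
  · intro a ha
    obtain ⟨j, hj⟩ := Function.ne_iff.mp ha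
    rw [hR.kernel_eq_zero_of_core hRρ hu (j := j)]
    · rfl
    · have h1 := abs_coord_le v.1 j
      have h2 : (1 : ℤ) ≤ |a j| := Int.one_le_abs hj
      have h3 : |2 * (ρ' : ℤ) * a j| = 2 * ρ' * |a j| := by
        rw [abs_mul, abs_of_nonneg (by positivity)]
      have h4 := abs_sub_abs_le_abs_sub (2 * (ρ' : ℤ) * a j) (-v.1.coord j)
      rw [abs_neg, sub_neg_eq_add, h3, add_comm (2 * (ρ' : ℤ) * a j)] at h4
      have h5 : (ρ : ℤ) ≤ ρ' := by exact_mod_cast h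
      simp only [Pi.add_apply, Pi.smul_apply, smul_eq_mul]
      nlinarith

theorem extendZero_perHam_apply_of_core (hR : HasFiniteRange H R) (hRρ : 2 * R ≤ ρ) (h : ρ ≤ ρ')
    {u : Torus d ρ' × Fin L} (hu : ∀ j, 2 * |u.1.coord j| < ρ) (v : Torus d ρ' × Fin L) (a : ℂ) :
    extendZero (torusEmbed L h) (a • perHam H ρ) u v = (a • perHam H ρ') u v := by
  obtain ⟨u, rfl⟩ := exists_torusEmbed_eq h fun j => by
    have := hu j
    have := abs_nonneg (u.1.coord j)
    linarith
  rw [Matrix.smul_apply, perHam_apply_of_core hR hRρ h hu]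
  by_cases hv : v ∈ Set.range (torusEmbed L h)
  · obtain ⟨v, rfl⟩ := hv
    rw [extendZero_apply (torusEmbed_injective h), Matrix.smul_apply,
      perHam_apply_of_core hR hRρ le_rfl hu]
    rfl
  · obtain ⟨j, hj⟩ := exists_le_abs_coord_of_notMem_range h hv
    rw [extendZero_apply_of_right _ _ hv, hR.kernel_eq_zero_of_core hRρ hu hj]
    simp

open Classical in
/-- The indicator function of the points with a coordinate of modulus at least `ρ / 2`. -/
noncomputable def outer (L ρ : ℕ) (u : Torus d ρ' × Fin L) : ℝ :=
  if ∃ j, (ρ : ℤ) ≤ 2 * |u.1.coord j| then 1 else 0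

/-- The two operators have equal rows at core points, hence by Hermiticity equal columns, and the
difference is supported between outer points. -/
theorem smul_perHam_sub_extendZero (hH : IsSelfAdjoint H) (hp : IsPeriodic H p)
    (hdvd : ∀ j, p j ∣ 2 * ρ) (hdvd' : ∀ j, p j ∣ 2 * ρ')
    (hR : HasFiniteRange H R) (hRρ : 2 * R ≤ ρ) (h : ρ ≤ ρ') (η : ℝ) :
    ((1 / η : ℝ) : ℂ) • perHam H ρ' - extendZero (torusEmbed L h) (((1 / η : ℝ) : ℂ) • perHam H ρ)
      = (diagonal fun u => (outer L ρ u : ℂ)) * (((1 / η : ℝ) : ℂ) • perHam H ρ'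
        - extendZero (torusEmbed L h) (((1 / η : ℝ) : ℂ) • perHam H ρ))
        * diagonal fun u => (outer L ρ u : ℂ) := by
  have hs := (smul_perHam_isHermitian (η := η) hH hp hdvd').sub
    (extendZero_isHermitian (torusEmbed L h) (smul_perHam_isHermitian (η := η) hH hp hdvd))
  set r := ((1 / η : ℝ) : ℂ) • perHam H ρ'
    - extendZero (torusEmbed L h) (((1 / η : ℝ) : ℂ) • perHam H ρ) with hrdef
  have h0 : ∀ u v, outer L ρ u = 0 → r u v = 0 := by
    intro u v hu
    have hu' : ∀ j, 2 * |u.1.coord j| < ρ := by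
      by_contra! hne
      simp [outer, hne] at hu
    rw [hrdef, Matrix.sub_apply, extendZero_perHam_apply_of_core hR hRρ h hu', sub_self]
  have h1 : ∀ u, outer L ρ u = 0 ∨ outer (ρ' := ρ') (d := d) L ρ u = 1 := by
    intro u
    unfold outer
    split_ifs <;> simp
  ext u v
  rw [mul_diagonal, diagonal_mul]
  rcases h1 u with hu | hu
  · simp [h0 u v hu]
  · rcases h1 v with hv | hv
    · have := hs.apply u v
      rw [h0 v u hv] at this
      simp [← this]
    · simp [hu, hv]

end Embedding

/-! ### Numerical inequality at the comparison scale. -/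

section Numerics

/-- Here `P b²` plays the role of the squared gap of the scaled Hamiltonian. The leading cost `8 b³
· 4/3` is below `P b² / 4` because `b ≤ P / 100`, and the commutator terms in `δ` are smaller by
orders of magnitude. -/
theorem comparison_numerics {d P b δ : ℝ} (hd : 1 ≤ d) (hP0 : 0 < P) (hP1 : P ≤ 1)
    (hb : b = P / (100 * d ^ 2)) (hδ0 : 0 ≤ δ) (hδ : δ ≤ P ^ 3 * b / (11 * 10 ^ 6 * d ^ 4)) :
    8 * b * (b ^ 2 + d * (Real.pi * δ)) * (1 + 32 * b ^ 2 + 32 * d ^ 2 * b)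
      + d ^ 2 * (Real.pi * δ) < P * b ^ 2 / 4 := by
  have hd2 : 1 ≤ d ^ 2 := by nlinarith
  have hb0 : 0 < b := by rw [hb]; positivity
  have hdb : d ^ 2 * b = P / 100 := by rw [hb]; field_simp
  have hbP : b ≤ P / 100 := by nlinarith
  have hPb : 0 < P * b ^ 2 := by positivity
  have h1 : 1 + 32 * b ^ 2 + 32 * d ^ 2 * b ≤ 4 / 3 := by nlinarith
  have h2 : d ^ 2 * (Real.pi * δ) ≤ P * b ^ 2 / 10000 := by
    calc d ^ 2 * (Real.pi * δ) ≤ d ^ 2 * (3.15 * (P ^ 3 * b / (11 * 10 ^ 6 * d ^ 4))) := by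
          gcongr
          exact Real.pi_lt_d2.le
      _ = 3.15 * 100 / (11 * 10 ^ 6) * (P ^ 2 * b * (P / (100 * d ^ 2))) := by
          field_simp
      _ = 3.15 * 100 / (11 * 10 ^ 6) * (P * (P * b ^ 2)) := by rw [← hb]; ring
      _ ≤ 3.15 * 100 / (11 * 10 ^ 6) * (1 * (P * b ^ 2)) := by gcongr
      _ ≤ P * b ^ 2 / 10000 := by nlinarith
  have h3 : d * (Real.pi * δ) ≤ P * b ^ 2 / 10000 := by
    refine le_trans ?_ h2
    exact mul_le_mul_of_nonneg_right (by nlinarith) (by positivity)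
  have h4 : b * (b ^ 2 + d * (Real.pi * δ)) ≤ P * b ^ 2 / 99 := by
    have e1 : b * b ^ 2 ≤ P / 100 * b ^ 2 := by gcongr
    have e2 : b * (d * (Real.pi * δ)) ≤ 1 / 100 * (P * b ^ 2 / 10000) := by
      gcongr
      linarith
    nlinarith
  have h5 : 8 * b * (b ^ 2 + d * (Real.pi * δ)) * (1 + 32 * b ^ 2 + 32 * d ^ 2 * b)
      ≤ 8 * (P * b ^ 2 / 99) * (4 / 3) := by
    rw [mul_assoc 8 b]
    gcongr
  nlinarith

end Numerics

section Commutators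

variable {X : Type*} [Fintype X] [DecidableEq X] {d : ℕ}

theorem norm_comm_sum_one_sub_cos_le {h : Matrix X X ℂ} (hh : h.IsHermitian) (θ : Fin d → X → ℝ)
    {ε : ℝ} (hε : ∀ j, ‖phase (θ j) * h - h * phase (θ j)‖ ≤ ε) :
    ‖(diagonal fun x => (((∑ j, fun x => 1 - Real.cos (θ j x)) x : ℝ) : ℂ)) * h
      - h * diagonal fun x => (((∑ j, fun x => 1 - Real.cos (θ j x)) x : ℝ) : ℂ)‖ ≤ d * ε := by
  have h1 : (diagonal fun x => (((∑ j, fun x => 1 - Real.cos (θ j x)) x : ℝ) : ℂ))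
      = ∑ j, (1 - diagonal fun x => ((Real.cos (θ j x) : ℝ) : ℂ)) := by
    ext u v
    rw [Matrix.sum_apply]
    by_cases huv : u = v
    · subst huv
      simp [Finset.sum_apply]
    · simp [huv]
  rw [h1, Finset.sum_mul, Finset.mul_sum, ← Finset.sum_sub_distrib]
  refine (norm_sum_le _ _).trans ?_
  refine (Finset.sum_le_card_nsmul _ _ ε fun j _ => ?_).trans (by simp)
  have h2 := norm_comm_cos_le hh (θ j) (hε j)
  rw [sub_mul, mul_sub, one_mul, mul_one, sub_sub_sub_cancel_left, norm_sub_rev]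
  exact h2

theorem norm_comm_extendZero_le {X' : Type*} [Fintype X'] [DecidableEq X'] {ι : X → X'}
    (hι : Function.Injective ι) (h : Matrix X X ℂ) (f : X → ℝ) (f' : X' → ℝ) {ε : ℝ}
    (hε : ‖(diagonal fun x => (f x : ℂ)) * h - h * diagonal fun x => (f x : ℂ)‖ ≤ ε) :
    ‖(diagonal fun x => ((Function.extend ι f f' x : ℝ) : ℂ)) * extendZero ι h
      - extendZero ι h * diagonal fun x => ((Function.extend ι f f' x : ℝ) : ℂ)‖ ≤ ε := by
  rw [diagonal_comm_extendZero]
  refine (norm_extendZero_le hι _).trans ?_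
  have : (fun x => ((Function.extend ι f f' x : ℝ) : ℂ)) ∘ ι = fun x => (f x : ℂ) := by
    funext x
    simp [hι.extend_apply]
  rw [this]
  exact hε

end Commutators

end PeriodicLocalizer

namespace PeriodicLocalizer

open Matrix Topology
open scoped Matrix.Norms.L2Operator

/-! ### Comparison of the signatures in different volumes. -/

section Comparison

variable {d L k ρ ρ' : ℕ} {H : Hilb d L →L[ℂ] Hilb d L} {R : ℝ} {p : Fin d → ℕ}
  {γ : Fin (d - 1) → Matrix (Fin k) (Fin k) ℂ}

/-- The mass function of the torus. -/
noncomputable def mass (d L ρ : ℕ) : Torus d ρ × Fin L → ℝ :=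
  ∑ j, fun u => 1 - Real.cos (angle L j u)

theorem mass_apply (u : Torus d ρ × Fin L) :
    mass d L ρ u = ∑ j, (1 - Real.cos (angle L j u)) := by
  simp [mass, Finset.sum_apply]

theorem mass_nonneg (u : Torus d ρ × Fin L) : 0 ≤ mass d L ρ u := by
  rw [mass_apply]
  exact Finset.sum_nonneg fun j _ => sub_nonneg.mpr (Real.cos_le_one _)

theorem mass_le (u : Torus d ρ × Fin L) : mass d L ρ u ≤ 2 * d := by
  rw [mass_apply]
  refine (Finset.sum_le_card_nsmul _ _ 2 fun j _ => ?_).trans (by simp [mul_comm])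
  linarith [Real.neg_one_le_cos (angle L j u)]

theorem one_le_four_mul_mass {r : ℕ} (hr : 0 < r) (hρ : ρ ≤ 2 * r) {u : Torus d ρ × Fin L}
    {j : Fin d} (hj : (r : ℤ) ≤ 2 * |u.1.coord j|) : 1 ≤ 4 * mass d L ρ u := by
  have h1 : Real.cos (angle L j u) ≤ 3 / 4 := by
    refine cos_le_of_half_le (r := r) (by exact_mod_cast hr) (by exact_mod_cast hj) ?_
      (by exact_mod_cast hρ)
    have := abs_coord_le u.1 j
    exact_mod_cast this
  have h2 : 1 - Real.cos (angle L j u) ≤ mass d L ρ u := by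
    rw [mass_apply]
    exact Finset.single_le_sum (f := fun j => 1 - Real.cos (angle L j u))
      (fun j _ => sub_nonneg.mpr (Real.cos_le_one _)) (Finset.mem_univ j)
  linarith

theorem outer_le_mass_extend (hρ : 0 < ρ) (h : ρ ≤ ρ') (u : Torus d ρ' × Fin L) :
    outer L ρ u ≤ 4 * Function.extend (torusEmbed L h) (mass d L ρ) (fun _ => 2) u := by
  by_cases hu : u ∈ Set.range (torusEmbed L h)
  · obtain ⟨v, rfl⟩ := hu
    rw [(torusEmbed_injective h).extend_apply]
    unfold outer
    split_ifs with hj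
    · obtain ⟨j, hj⟩ := hj
      exact one_le_four_mul_mass hρ (by omega) hj
    · exact mul_nonneg (by norm_num) (mass_nonneg v)
  · rw [Function.extend_apply' _ _ _ hu]
    unfold outer
    split_ifs <;> norm_num

theorem outer_le_mass (hρ : 0 < ρ) (h : ρ' ≤ 2 * ρ) (u : Torus d ρ' × Fin L) :
    outer L ρ u ≤ 4 * mass d L ρ' u := by
  unfold outer
  split_ifs with hj
  · obtain ⟨j, hj⟩ := hj
    exact one_le_four_mul_mass hρ h hj
  · exact mul_nonneg (by norm_num) (mass_nonneg u)

/-- Off the outer region every angle is at most `π/2` in modulus, so the bound holds coordinatewise;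
Cauchy–Schwarz over the coordinates costs the factor `d`. -/
theorem lineMap_mass_sq_le (hρ : 0 < ρ) (h : ρ ≤ ρ') {t : ℝ} (ht : t ∈ Set.Icc (0 : ℝ) 1)
    (u : Torus d ρ' × Fin L) :
    (1 - outer L ρ u) * (AffineMap.lineMap
        (Function.extend (torusEmbed L h) (mass d L ρ) (fun _ => 2) u) (mass d L ρ' u) t) ^ 2
      ≤ d * ∑ j, (AffineMap.lineMap
        (Function.extend (torusEmbed L h) (fun u => Real.sin (angle L j u)) 0 u)
        (Real.sin (angle L j u)) t) ^ 2 := by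
  by_cases hu : ∃ j, (ρ : ℤ) ≤ 2 * |u.1.coord j|
  · have : outer L ρ u = 1 := if_pos hu
    rw [this, sub_self, zero_mul]
    positivity
  · have h0 : outer L ρ u = 0 := if_neg hu
    push Not at hu
    obtain ⟨u, rfl⟩ := exists_torusEmbed_eq h fun j => by
      have := hu j
      have := abs_nonneg (u.1.coord j)
      linarith
    rw [h0, sub_zero, one_mul, (torusEmbed_injective h).extend_apply]
    simp only [(torusEmbed_injective h).extend_apply]
    have hsum : AffineMap.lineMap (mass d L ρ u) (mass d L ρ' (torusEmbed L h u)) t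
        = ∑ j, AffineMap.lineMap (1 - Real.cos (angle L j u))
          (1 - Real.cos (angle L j (torusEmbed L h u))) t := by
      simp only [mass_apply, AffineMap.lineMap_apply_module, smul_eq_mul, Finset.mul_sum,
        Finset.sum_add_distrib]
    rw [hsum]
    refine sq_sum_le_card_mul_sum_sq.trans ?_
    rw [Finset.card_univ, Fintype.card_fin]
    refine mul_le_mul_of_nonneg_left (Finset.sum_le_sum fun j _ => ?_) (Nat.cast_nonneg d)
    refine lineMap_one_sub_cos_sq_le (ρ := ρ) (ρ' := ρ') (by exact_mod_cast hρ)
      (by exact_mod_cast h) ?_ ht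
    have := (hu j).le
    rw [coord_torusEmbed] at this
    exact_mod_cast this

theorem abs_mass_extend_sub_le (hd : 0 < d) (h : ρ ≤ ρ') (u : Torus d ρ' × Fin L) :
    |Function.extend (torusEmbed L h) (mass d L ρ) (fun _ => 2) u - mass d L ρ' u| ≤ 2 * d := by
  have h1 := mass_nonneg u
  have h2 := mass_le u
  have hd1 : (1 : ℝ) ≤ d := by exact_mod_cast hd
  by_cases hu : u ∈ Set.range (torusEmbed L h)
  · obtain ⟨v, rfl⟩ := hu
    rw [(torusEmbed_injective h).extend_apply, abs_le]
    constructor <;> linarith [mass_nonneg v, mass_le v]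
  · rw [Function.extend_apply' _ _ _ hu, abs_le]
    constructor <;> linarith

theorem abs_sin_extend_sub_le (h : ρ ≤ ρ') (j : Fin d) (u : Torus d ρ' × Fin L) :
    |Function.extend (torusEmbed L h) (fun u => Real.sin (angle L j u)) 0 u
      - Real.sin (angle L j u)| ≤ 2 := by
  have h1 := Real.neg_one_le_sin (angle L j u)
  have h2 := Real.sin_le_one (angle L j u)
  by_cases hu : u ∈ Set.range (torusEmbed L h)
  · obtain ⟨v, rfl⟩ := hu
    rw [(torusEmbed_injective h).extend_apply, abs_le]
    constructor <;> linarith [Real.neg_one_le_sin (angle L j v), Real.sin_le_one (angle L j v)]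
  · rw [Function.extend_apply' _ _ _ hu, abs_le]
    constructor <;> simp only [Pi.zero_apply] <;> linarith

/-- A value of `η` at which the localizers of different volumes can be compared. -/
noncomputable def comparisonScale (H : Hilb d L →L[ℂ] Hilb d L) : ℝ :=
  100 * d ^ 2 * ‖H‖ ^ 3 / gap H ^ 2

theorem signature_perLocalizer_eq_of_le_two_mul (hd : 0 < d) (hL : 0 < L) (hH : IsSelfAdjoint H)
    (h0 : (0 : ℂ) ∉ spectrum ℂ H) (hR : HasFiniteRange H R) (hp : IsPeriodic H p)
    (hγ : IsIrredCliffordRep γ) (hρ : 0 < ρ) (h : ρ ≤ ρ') (h2 : ρ' ≤ 2 * ρ)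
    (hdvd : ∀ j, p j ∣ 2 * ρ) (hdvd' : ∀ j, p j ∣ 2 * ρ') (hRρ : 2 * R ≤ ρ)
    (hbig : 11 * 10 ^ 6 * d ^ 4 * maxCommutator H * ‖H‖ ^ 5 ≤ ρ * gap H ^ 6) :
    signature (perLocalizer H γ (comparisonScale H) ρ) (perLocalizer_isHermitian hH hp hdvd γ _)
      = signature (perLocalizer H γ (comparisonScale H) ρ')
        (perLocalizer_isHermitian hH hp hdvd' γ _) := by
  have hg := gap_pos hL h0
  have hn : 0 < ‖H‖ := hg.trans_le (gap_le_norm hL h0)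
  have hM := maxCommutator_nonneg H
  have hd1 : (1 : ℝ) ≤ d := by exact_mod_cast hd
  have hρr : (0 : ℝ) < ρ := by exact_mod_cast hρ
  have hρ' : 0 < ρ' := hρ.trans_le h
  set η := comparisonScale H with hη
  have hη0 : 0 < η := by rw [hη, comparisonScale]; positivity
  have hι := torusEmbed_injective (d := d) (L := L) h
  have hh := smul_perHam_isHermitian (η := η) hH hp hdvd
  have hh' := smul_perHam_isHermitian (η := η) hH hp hdvd'
  set b := ‖H‖ / η with hb
  set P := (gap H / ‖H‖) ^ 2 with hP
  set δ := maxCommutator H / (η * ρ) with hδ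
  have hP0 : 0 < P := by positivity
  have hP1 : P ≤ 1 := by
    rw [hP]
    exact pow_le_one₀ (by positivity) ((div_le_one hn).mpr (gap_le_norm hL h0))
  -- The comparison scale is chosen for this identity, which makes `b` small compared with the
  -- relative squared gap `P`.
  have hbP : b = P / (100 * d ^ 2) := by
    rw [hb, hP, hη, comparisonScale]
    field_simp
  have hδ0 : 0 ≤ δ := by positivity
  have hδP : δ ≤ P ^ 3 * b / (11 * 10 ^ 6 * d ^ 4) := by
    rw [hδ, hP, hb, div_le_div_iff₀ (by positivity) (by positivity)]
    have : (((gap H / ‖H‖) ^ 2) ^ 3 * (‖H‖ / η)) * (η * ρ) = (ρ * gap H ^ 6) / ‖H‖ ^ 5 := by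
      field_simp
    rw [this, le_div_iff₀ (by positivity)]
    linarith
  have hgP : (gap H / η) ^ 2 = P * b ^ 2 := by
    rw [hP, hb]
    field_simp
  have hδ' : maxCommutator H / (η * ρ') ≤ δ := by
    rw [hδ]
    gcongr
  have hε : ∀ j : Fin d, _ := norm_phase_comm_smul_perHam_le hρ hR hp hdvd hη0
  have hε' : ∀ j : Fin d, ‖phase (angle L j) * (((1 / η : ℝ) : ℂ) • perHam H ρ')
      - (((1 / η : ℝ) : ℂ) • perHam H ρ') * phase (angle L j)‖ ≤ Real.pi * δ := fun j =>
    (norm_phase_comm_smul_perHam_le hρ' hR hp hdvd' hη0 j).trans (by gcongr)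
  have key := signature_locMat_eq_of_interpolation hγ hd (χ := outer L ρ)
    (c₀ := Function.extend (torusEmbed L h) (mass d L ρ) fun _ => 2) (c₁ := mass d L ρ')
    (s₀ := fun j => Function.extend (torusEmbed L h) (fun u => Real.sin (angle L j u)) 0)
    (s₁ := fun j u => Real.sin (angle L j u))
    (extendZero_isHermitian (torusEmbed L h) hh) hh'
    (fun u => by unfold outer; split_ifs <;> simp)
    (outer_le_mass_extend hρ h) (outer_le_mass hρ h2)
    (fun t ht u => lineMap_mass_sq_le hρ h ht u) (abs_mass_extend_sub_le hd h)
    (fun j u => abs_sin_extend_sub_le h j u)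
    ((norm_extendZero_le hι _).trans (norm_smul_perHam_le hρ hR hp hdvd hη0))
    (norm_smul_perHam_le hρ' hR hp hdvd' hη0) (div_pos hg hη0)
    (mul_norm_le_norm_smul_perHam_apply hL h0 hρ' hR hp hdvd' hη0)
    (smul_perHam_sub_extendZero hH hp hdvd hdvd' hR hRρ h η)
    (e := d * (Real.pi * δ)) (ε := Real.pi * δ) (by positivity)
    (norm_comm_extendZero_le hι _ _ _ (norm_comm_sum_one_sub_cos_le hh _ hε))
    (norm_comm_sum_one_sub_cos_le hh' _ hε')
    (fun j => norm_comm_extendZero_le hι _ _ _ (norm_comm_sin_le hh _ (hε j)))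
    (fun j => norm_comm_sin_le hh' _ (hε' j))
    (by
      rw [← hb, hbP, mul_div_assoc', div_le_one (by positivity)]
      nlinarith)
    (by
      rw [hgP]
      exact comparison_numerics hd1 hP0 hP1 hbP hδ0 hδP)
  rw [signature_locMat_extend (gammaHat γ) hι (mass d L ρ) (fun j u => Real.sin (angle L j u)) hh]
    at key
  rw [signature_congr (perLocalizer_eq_locMat H γ η ρ) _ (locMat_isHermitian _ _ _ hh),
    signature_congr (perLocalizer_eq_locMat H γ η ρ') _ (locMat_isHermitian _ _ _ hh')]
  exact key

/-- The volumes `2 ρ, 4 ρ, …` keep the divisibility by the periods and the size bounds, so doubling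
can continue until the remaining ratio is at most two. -/
theorem signature_perLocalizer_eq_of_le (hd : 0 < d) (hL : 0 < L) (hH : IsSelfAdjoint H)
    (h0 : (0 : ℂ) ∉ spectrum ℂ H) (hR : HasFiniteRange H R) (hp : IsPeriodic H p)
    (hγ : IsIrredCliffordRep γ) (hdvd' : ∀ j, p j ∣ 2 * ρ') (m : ℕ) :
    ∀ (ρ : ℕ), 0 < ρ → ρ ≤ ρ' → ρ' ≤ 2 ^ m * ρ → ∀ (hdvd : ∀ j, p j ∣ 2 * ρ), 2 * R ≤ ρ →
    11 * 10 ^ 6 * d ^ 4 * maxCommutator H * ‖H‖ ^ 5 ≤ ρ * gap H ^ 6 →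
    signature (perLocalizer H γ (comparisonScale H) ρ) (perLocalizer_isHermitian hH hp hdvd γ _)
      = signature (perLocalizer H γ (comparisonScale H) ρ')
        (perLocalizer_isHermitian hH hp hdvd' γ _) := by
  have hstep := fun (ρ ρ' : ℕ) => signature_perLocalizer_eq_of_le_two_mul (ρ := ρ) (ρ' := ρ') hd hL
    hH h0 hR hp hγ
  induction m with
  | zero =>
    intro ρ hρ h hm hdvd hRρ hbig
    exact hstep ρ ρ' hρ h (by omega) hdvd hdvd' hRρ hbig
  | succ m ih =>
    intro ρ hρ h hm hdvd hRρ hbig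
    rcases le_total ρ' (2 * ρ) with h2 | h2
    · exact hstep ρ ρ' hρ h h2 hdvd hdvd' hRρ hbig
    · have hρr : (0 : ℝ) < ρ := by exact_mod_cast hρ
      have hg := gap_pos hL h0
      have hdvd2 : ∀ j, p j ∣ 2 * (2 * ρ) := fun j => (hdvd j).mul_left 2
      rw [hstep ρ (2 * ρ) hρ (by omega) le_rfl hdvd hdvd2 hRρ hbig]
      refine ih (2 * ρ) (by omega) h2 (by rw [pow_succ] at hm; linarith) hdvd2 ?_ ?_
      · push_cast; linarith
      · refine hbig.trans ?_
        push_cast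
        gcongr
        linarith

end Comparison

/-! ### Consequences of admissibility. -/

section Admissibility

variable {d L k : ℕ} {H : Hilb d L →L[ℂ] Hilb d L} {R : ℝ} {p : Fin d → ℕ} {η : ℝ} {ρ : ℕ}

theorem Admissible.mul_sub_le (ha : Admissible H R p η ρ) (hd : 0 < d) (hn : 0 < ‖H‖) :
    16 * d * (η * (‖H‖ - η)) ≤ gap H ^ 2 := by
  have hη := ha.eta_pos
  have hd' : (0 : ℝ) < d := by exact_mod_cast hd
  have h1 : 4 * (1 - η / ‖H‖) ≤ gap H ^ 2 / (4 * d * η * ‖H‖) :=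
    le_trans (by linarith [sq_nonneg (1 - gap H / ‖H‖)]) ha.flatness
  rw [le_div_iff₀ (by positivity)] at h1
  calc 16 * d * (η * (‖H‖ - η)) = 4 * (1 - η / ‖H‖) * (4 * d * η * ‖H‖) := by
        field_simp
        ring
    _ ≤ _ := h1

/-- With `κ = g / ‖H‖ ≤ 1`, the bounds `η ≥ g / 4` and `d ≥ 2` make the right side of the flatness
condition at most `κ / 2`, so `4 (1 - η / ‖H‖) ≤ 1/2`. -/
theorem Admissible.seven_eighths_le (ha : Admissible H R p η ρ) (hd : 2 ≤ d) (hg : 0 < gap H)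
    (hgn : gap H ≤ ‖H‖) : 7 / 8 * ‖H‖ ≤ η := by
  have hη := ha.eta_pos
  have hn : 0 < ‖H‖ := hg.trans_le hgn
  have hd' : (2 : ℝ) ≤ d := by exact_mod_cast hd
  have h1 : gap H ^ 2 / (4 * d * η * ‖H‖) ≤ gap H / ‖H‖ / 2 := by
    rw [div_div, div_le_div_iff₀ (by positivity) (by positivity)]
    have h2 : 2 * (gap H / 4) ≤ d * η := mul_le_mul hd' ha.eta_ge (by positivity) (by positivity)
    have h3 : 0 ≤ gap H * ‖H‖ := by positivity
    nlinarith
  have h2 := ha.flatness.trans h1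
  set κ := gap H / ‖H‖
  have hκ : κ ≤ 1 := (div_le_one hn).mpr hgn
  have h3 : 7 / 8 ≤ η / ‖H‖ := by nlinarith
  rwa [le_div_iff₀ hn] at h3

theorem Admissible.rho_mul_gap_pow_ge (ha : Admissible H R p η ρ) (hg : 0 < gap H) :
    15 * 10 ^ 6 * d ^ 4 * maxCommutator H * ‖H‖ ^ 3 * η ^ 2 ≤ ρ * gap H ^ 6 := by
  have h := ha.rho_ge
  rwa [div_le_iff₀ (by positivity)] at h

/-- Removes `η` from the volume condition, using `15 · (7/8)² > 11`. -/
theorem Admissible.rho_mul_gap_pow_ge_norm (ha : Admissible H R p η ρ) (hd : 2 ≤ d)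
    (hg : 0 < gap H) (hgn : gap H ≤ ‖H‖) :
    11 * 10 ^ 6 * d ^ 4 * maxCommutator H * ‖H‖ ^ 5 ≤ ρ * gap H ^ 6 := by
  refine le_trans ?_ (ha.rho_mul_gap_pow_ge hg)
  have hM := maxCommutator_nonneg H
  have h1 := ha.seven_eighths_le hd hg hgn
  have hn : 0 < ‖H‖ := hg.trans_le hgn
  have h2 : (7 / 8 * ‖H‖) ^ 2 ≤ η ^ 2 := by gcongr
  have h3 : 11 * ‖H‖ ^ 2 ≤ 15 * η ^ 2 := by nlinarith
  calc 11 * 10 ^ 6 * d ^ 4 * maxCommutator H * ‖H‖ ^ 5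
      = 10 ^ 6 * d ^ 4 * maxCommutator H * ‖H‖ ^ 3 * (11 * ‖H‖ ^ 2) := by ring
    _ ≤ 10 ^ 6 * d ^ 4 * maxCommutator H * ‖H‖ ^ 3 * (15 * η ^ 2) := by gcongr
    _ = _ := by ring

theorem Admissible.size_le (ha : Admissible H R p η ρ) (hd : 2 ≤ d)
    (hg : 0 < gap H) (hgn : gap H ≤ ‖H‖) :
    40 * d * maxCommutator H * η ≤ gap H ^ 2 * ρ := by
  have hM := maxCommutator_nonneg H
  have h1 := ha.seven_eighths_le hd hg hgn
  have h2 := ha.rho_mul_gap_pow_ge hg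
  have hη := ha.eta_pos
  have hn : 0 < ‖H‖ := hg.trans_le hgn
  have hd1 : (1 : ℝ) ≤ d := by exact_mod_cast (by omega : 1 ≤ d)
  have hd4 : (d : ℝ) ≤ d ^ 4 := le_self_pow₀ hd1 (by norm_num)
  refine le_of_mul_le_mul_right ?_ (pow_pos hg 4)
  calc 40 * d * maxCommutator H * η * gap H ^ 4
      = 40 * d * maxCommutator H * η * gap H ^ 3 * gap H := by ring
    _ ≤ 40 * d ^ 4 * maxCommutator H * η * ‖H‖ ^ 3 * (2 * η) := by
        gcongr
        linarith
    _ = 80 * (d ^ 4 * maxCommutator H * ‖H‖ ^ 3 * η ^ 2) := by ring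
    _ ≤ 15 * 10 ^ 6 * (d ^ 4 * maxCommutator H * ‖H‖ ^ 3 * η ^ 2) := by gcongr; norm_num
    _ = 15 * 10 ^ 6 * d ^ 4 * maxCommutator H * ‖H‖ ^ 3 * η ^ 2 := by ring
    _ ≤ ρ * gap H ^ 6 := h2
    _ = gap H ^ 2 * ρ * gap H ^ 4 := by ring

theorem Admissible.comparisonScale_size_le (ha : Admissible H R p η ρ) (hd : 2 ≤ d)
    (hg : 0 < gap H) (hgn : gap H ≤ ‖H‖) :
    40 * d * maxCommutator H * comparisonScale H ≤ gap H ^ 2 * ρ := by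
  have hM := maxCommutator_nonneg H
  have h2 := ha.rho_mul_gap_pow_ge_norm hd hg hgn
  have hn : 0 < ‖H‖ := hg.trans_le hgn
  have hd1 : (1 : ℝ) ≤ d := by exact_mod_cast (by omega : 1 ≤ d)
  have hd4 : (d : ℝ) ^ 3 ≤ d ^ 4 := pow_le_pow_right₀ hd1 (by norm_num)
  refine le_of_mul_le_mul_right ?_ (pow_pos hg 4)
  calc 40 * d * maxCommutator H * comparisonScale H * gap H ^ 4
      = 4000 * d ^ 3 * maxCommutator H * ‖H‖ ^ 3 * gap H ^ 2 := by
        rw [comparisonScale]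
        field_simp
        ring
    _ ≤ 4000 * d ^ 4 * maxCommutator H * ‖H‖ ^ 3 * ‖H‖ ^ 2 := by gcongr
    _ = 4000 * (d ^ 4 * maxCommutator H * ‖H‖ ^ 5) := by ring
    _ ≤ 11 * 10 ^ 6 * (d ^ 4 * maxCommutator H * ‖H‖ ^ 5) := by gcongr; norm_num
    _ = 11 * 10 ^ 6 * d ^ 4 * maxCommutator H * ‖H‖ ^ 5 := by ring
    _ ≤ ρ * gap H ^ 6 := h2
    _ = gap H ^ 2 * ρ * gap H ^ 4 := by ring

theorem norm_le_comparisonScale (hd : 0 < d) (hg : 0 < gap H) (hgn : gap H ≤ ‖H‖) :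
    ‖H‖ ≤ comparisonScale H := by
  have hn : 0 < ‖H‖ := hg.trans_le hgn
  have hd1 : (1 : ℝ) ≤ d := by exact_mod_cast hd
  rw [comparisonScale, le_div_iff₀ (by positivity)]
  calc ‖H‖ * gap H ^ 2 ≤ ‖H‖ * ‖H‖ ^ 2 := by gcongr
    _ = 1 * 1 ^ 2 * ‖H‖ ^ 3 := by ring
    _ ≤ 100 * d ^ 2 * ‖H‖ ^ 3 := by gcongr; norm_num

/-- The function `t (‖H‖ - t)` decreases beyond `‖H‖ / 2` and `η ≥ 7 ‖H‖ / 8`, so moving up from `η`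
only improves the first bound; points `t ≥ ‖H‖` satisfy it trivially. The second bound is linear in
`t` and follows from the endpoints. -/
theorem Admissible.segment_bounds (ha : Admissible H R p η ρ) (hd : 2 ≤ d)
    (hg : 0 < gap H) (hgn : gap H ≤ ‖H‖) :
    ∀ t ∈ segment ℝ η (comparisonScale H), 0 < t ∧ 16 * d * (t * (‖H‖ - t)) ≤ gap H ^ 2 ∧
      40 * d * maxCommutator H * t ≤ gap H ^ 2 * ρ := by
  intro t ht
  have hM := maxCommutator_nonneg H
  have hn : 0 < ‖H‖ := hg.trans_le hgn
  have hη := ha.eta_pos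
  have h1 := norm_le_comparisonScale (by omega) hg hgn
  have h7 := ha.seven_eighths_le hd hg hgn
  rw [segment_eq_uIcc, Set.mem_uIcc] at ht
  have ht0 : 0 < t := by rcases ht with ht | ht <;> linarith
  refine ⟨ht0, ?_, ?_⟩
  · rcases le_or_gt ‖H‖ t with hnt | hnt
    · refine le_trans ?_ (sq_nonneg _)
      have : t * (‖H‖ - t) ≤ 0 := mul_nonpos_of_nonneg_of_nonpos ht0.le (by linarith)
      exact mul_nonpos_of_nonneg_of_nonpos (by positivity) this
    · have hηt : η ≤ t := by rcases ht with ht | ht <;> linarith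
      refine le_trans ?_ (ha.mul_sub_le (by omega) hn)
      gcongr 16 * d * ?_
      nlinarith
  · rcases ht with ht | ht
    · refine le_trans ?_ (ha.comparisonScale_size_le hd hg hgn)
      gcongr
      exact ht.2
    · refine le_trans ?_ (ha.size_le hd hg hgn)
      gcongr
      exact ht.2

end Admissibility

end PeriodicLocalizer

theorem mainTheorem4 {d L k : ℕ} (hd : Even d) (hd0 : 0 < d) (hL : 0 < L)
    (H : Hilb d L →L[ℂ] Hilb d L) (hH : IsSelfAdjoint H) (hgap : (0 : ℂ) ∉ spectrum ℂ H)
    (R : ℝ) (hR : HasFiniteRange H R)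
    (p : Fin d → ℕ) (hp0 : ∀ j, 0 < p j) (hp : IsPeriodic H p)
    (γ : Fin (d - 1) → Matrix (Fin k) (Fin k) ℂ) (hγ : IsIrredCliffordRep γ) :
    (∀ (η : ℝ) (ρ : ℕ), Admissible H R p η ρ →
      (perLocalizer H γ η ρ ^ 2
        - ((gap H ^ 2 / (600 * d * η ^ 2) : ℝ) : ℂ) •
          (1 : Matrix (LocIndex d L k ρ) (LocIndex d L k ρ) ℂ)).PosSemidef) ∧
    (∀ (η η' : ℝ) (ρ ρ' : ℕ) (h : Admissible H R p η ρ) (h' : Admissible H R p η' ρ'),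
      signature (perLocalizer H γ η ρ)
          (perLocalizer_isHermitian hH hp h.period_dvd γ η)
        = signature (perLocalizer H γ η' ρ')
          (perLocalizer_isHermitian hH hp h'.period_dvd γ η')) := by
  have hd2 : 2 ≤ d := by
    obtain ⟨m, rfl⟩ := hd
    omega
  have hg := gap_pos hL hgap
  have hgn := gap_le_norm hL hgap
  have hn : 0 < ‖H‖ := hg.trans_le hgn
  refine ⟨fun η ρ ha => ?_, fun η η' ρ ρ' h h' => ?_⟩
  · refine posSemidef_sq_sub_smul_one (perLocalizer_isHermitian hH hp ha.period_dvd γ η)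
      fun ψ => ?_
    have hη := ha.eta_pos
    have hd1 : (1 : ℝ) ≤ d := by exact_mod_cast hd0
    refine le_trans ?_ (norm_perLocalizer_apply_sq_ge hL hH hgap hR hp hγ ha.rho_pos
      ha.period_dvd hη (ha.mul_sub_le hd0 hn) (ha.size_le hd2 hg hgn) ψ)
    -- The estimate proved has `2` in place of `600 d`.
    gcongr
    linarith
  · have key : ∀ (η η' : ℝ) (ρ ρ' : ℕ) (_ : ρ ≤ ρ') (h : Admissible H R p η ρ)
        (h' : Admissible H R p η' ρ'), signature (perLocalizer H γ η ρ)
          (perLocalizer_isHermitian hH hp h.period_dvd γ η)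
        = signature (perLocalizer H γ η' ρ')
          (perLocalizer_isHermitian hH hp h'.period_dvd γ η') := by
      intro η η' ρ ρ' hle h h'
      rw [signature_perLocalizer_eq_of_segment hL hH hgap hR hp hγ h.rho_pos h.period_dvd
          (h.segment_bounds hd2 hg hgn),
        signature_perLocalizer_eq_of_segment hL hH hgap hR hp hγ h'.rho_pos h'.period_dvd
          (h'.segment_bounds hd2 hg hgn)]
      refine signature_perLocalizer_eq_of_le hd0 hL hH hgap hR hp hγ h'.period_dvd ρ' ρ h.rho_pos
        hle ?_ h.period_dvd h.two_range_le (h.rho_mul_gap_pow_ge_norm hd2 hg hgn)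
      -- A generous number of doublings: `ρ' ≤ 2 ^ ρ' * ρ`.
      exact (Nat.lt_two_pow_self (n := ρ')).le.trans (Nat.le_mul_of_pos_right _ h.rho_pos)
    rcases le_total ρ ρ' with hle | hle
    · exact key η η' ρ ρ' hle h h'
    · exact (key η' η ρ' ρ hle h' h).symm
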